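/- **Theorem (Bias of FedAvg, homogeneous clients).** Let $(\mathsf Z,\mathcal Z)$ be a measurable space, $\xi$ a probability measure on it, $Z\sim\xi$, and $(z,\theta)\mapsto F_z(\theta)$, $\mathsf Z\times\mathbb R^d\to\mathbb R$, a measurable map with $F_Z(\theta)$ integrable for every $\theta$. Put $f(\theta)=\mathbb E[F_Z(\theta)]$, let $\theta^\star$ be a minimizer of $f$, and let $\varepsilon_z(\theta)=\nabla F_z(\theta)-\nabla f(\theta)$. Let $\mu,L>0$ and $\tau,k\ge 0$, and assume: 1. $f$ is three times differentiable, $\mu\,\mathrm{Id}\preccurlyeq\nabla^2 f(\theta)\preccurlyeq L\,\mathrm{Id}$ for all $\theta$, and $\nabla^3 f(\theta)-\nabla^3 f(\theta^\star)=O(\|\theta-\theta^\star\|)$ as $\theta\to\theta^\star$; 2. for every $z$, $F_z$ is differentiable with $L$-Lipschitz gradient, and $\|\nabla F_z(\theta)-\nabla F_z(\vartheta)\|^2\le 2L\langle\theta-\vartheta,\nabla F_z(\theta)-\nabla F_z(\vartheta)\rangle$ for all $\theta,\vartheta$; 3. $\mathbb E[\|\varepsilon_Z(\theta)\|^{2p}]^{1/p}\le\tau^2\{1+\|\theta-\theta^\star\|^k\}$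 for all $\theta$ and $p\in\{1,2,3\}$. For integers $N,H\ge1$ and $\gamma>0$, consider FedAvg with $N$ identical clients: from $\theta_t$, client $c$ sets $\theta_{c,t}^0=\theta_t$ and $\theta_{c,t}^{h+1}=\theta_{c,t}^h-\gamma\nabla F_{Z_{c,t}^{h+1}}(\theta_{c,t}^h)$ for $0\le h<H$, with all $Z_{c,t}^h$ independent of law $\xi$, and $\theta_{t+1}=\frac1N\sum_{c=1}^N\theta_{c,t}^H$. Define $$\mathbf A=(\mathrm{Id}\otimes\nabla^2f(\theta^\star)+\nabla^2f(\theta^\star)\otimes\mathrm{Id})^{-1},\qquad \mathcal C(\theta^\star)=\mathbb E[\varepsilon_Z(\theta^\star)^{\otimes2}],\qquad \mathrm b=\nabla^2f(\theta^\star)^{-1}\,\nabla^3f(\theta^\star)\,\mathbf A\,\mathcal C(\theta^\star).$$ Then for all $N,H\ge1$ and $0<\gamma\le\frac1{8L}\wedge\frac1H$ the Markov chain $(\theta_t)$ has a unique stationary distribution $\pi^{(\gamma,H)}$; it has a finite second moment, and its mean $\bar\theta^{(\gamma,H)}=\int\vartheta\,\pi^{(\gamma,H)}(d\vartheta)$ and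 covariance about the minimizer $\bar\Sigma^{(\gamma,H)}=\int(\vartheta-\theta^\star)^{\otimes2}\,\pi^{(\gamma,H)}(d\vartheta)$ satisfy $$\bar\theta^{(\gamma,H)}-\theta^\star=-\frac{\gamma}{2N}\,\mathrm b+O(\gamma^2H+\gamma^{3/2}),\qquad \bar\Sigma^{(\gamma,H)}=\frac{\gamma}{N}\,\mathbf A\,\mathcal C(\theta^\star)+O(\gamma^2H+\gamma^{3/2}),$$ where the constants in $O(\cdot)$ do not depend on $\gamma$, $H$ and $N$. In particular, if $\mathrm b\neq0$, then for all $N,H\ge1$ FedAvg is biased for all small enough step sizes: there is $\gamma_0>0$ such that, for every $0<\gamma<\gamma_0$, every stationary distribution of $(\theta_t)$ has mean different from $\theta^\star$. -/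

import Mathlib

open MeasureTheory ProbabilityTheory
open scoped Topology

namespace FedAvg

/-- The parameter space `ℝ^d` with its Euclidean norm. -/
abbrev Param (d : ℕ) : Type := EuclideanSpace ℝ (Fin d)

/-- Operators on `ℝ^d`; they also stand for the elements of `ℝ^d ⊗ ℝ^d` (that is, `d × d` matrices),
`u ⊗ v` being the operator `w ↦ ⟨v, w⟩ u`. The norm is the operator norm. -/
abbrev Op (d : ℕ) : Type := Param d →L[ℝ] Param d

/-- The tensor square `u ⊗ u`, that is, the matrix `u uᵀ`. -/
noncomputable def tensorSq {d : ℕ} (u : Param d) : Op d :=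
  InnerProductSpace.rankOne ℝ u u

/-- The Hessian `∇²f(θ)`, as an operator: the derivative of the gradient. -/
noncomputable def hess {d : ℕ} (f : Param d → ℝ) (θ : Param d) : Op d :=
  fderiv ℝ (gradient f) θ

/-- The third derivative `∇³f(θ)`: the derivative of the Hessian. -/
noncomputable def third {d : ℕ} (f : Param d → ℝ) (θ : Param d) : Param d →L[ℝ] Op d :=
  fderiv ℝ (hess f) θ

/-- Action of a third derivative `T` on a matrix `M`: `(T M)_i = ∑_{j,k} T_{ijk} M_{jk}`.
It is linear in `M` and sends `u ⊗ u` to `T u u`. -/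
noncomputable def contract {d : ℕ} (T : Param d →L[ℝ] Op d) (M : Op d) : Param d :=
  ∑ j : Fin d, T (M (EuclideanSpace.single j 1)) (EuclideanSpace.single j 1)

/-- The operator `Id ⊗ A + A ⊗ Id` on matrices, `M ↦ M A + A M` (for a symmetric `A`). -/
noncomputable def kronSum {d : ℕ} (A : Op d) : Op d →L[ℝ] Op d :=
  (ContinuousLinearMap.compL ℝ (Param d) (Param d) (Param d)).flip A
    + ContinuousLinearMap.compL ℝ (Param d) (Param d) (Param d) A

/-- The operator `𝐀 = (Id ⊗ ∇²f(θ) + ∇²f(θ) ⊗ Id)⁻¹` on matrices. -/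
noncomputable def opA {d : ℕ} (f : Param d → ℝ) (θ : Param d) : Op d →L[ℝ] Op d :=
  Ring.inverse (kronSum (hess f θ))

section Client

variable {Z : Type*} [MeasurableSpace Z] {d : ℕ}

/-- The objective `f(θ) = 𝔼[F_Z(θ)]`, `Z ∼ ξ`, of a client with stochastic functions `F_z`. -/
noncomputable def objective (F : Z → Param d → ℝ) (ξ : Measure Z) (θ : Param d) : ℝ :=
  ∫ z, F z θ ∂ξ

/-- The centered stochastic gradient `ε_z(θ) = ∇F_z(θ) - ∇f(θ)`. -/
noncomputable def gradNoise (F : Z → Param d → ℝ) (ξ : Measure Z) (z : Z) (θ : Param d) :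
    Param d :=
  gradient (F z) θ - gradient (objective F ξ) θ

/-- The covariance `𝒞(θ) = 𝔼[ε_Z(θ) ⊗ ε_Z(θ)]` of the stochastic gradient. (Its average over
identical clients is the same matrix.) -/
noncomputable def noiseCov (F : Z → Param d → ℝ) (ξ : Measure Z) (θ : Param d) : Op d :=
  ∫ z, tensorSq (gradNoise F ξ z θ) ∂ξ

/-- The vector `∇²f(θ)⁻¹ ∇³f(θ) 𝐀 𝒞(θ)`. -/
noncomputable def stochBias (F : Z → Param d → ℝ) (ξ : Measure Z) (θ : Param d) : Param d :=
  Ring.inverse (hess (objective F ξ) θ)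
    (contract (third (objective F ξ) θ) (opA (objective F ξ) θ (noiseCov F ξ θ)))

end Client

section Algorithm

variable {Z : Type*} {d : ℕ}

/-- `h` local stochastic gradient steps of a client, started from `θ`, with step size `γ` and
random states `z 0, …, z (h - 1)` used in this order. -/
noncomputable def localUpdate (F : Z → Param d → ℝ) (γ : ℝ) :
    (h : ℕ) → Param d → (Fin h → Z) → Param d
  | 0, θ, _ => θ
  | h + 1, θ, z =>
      localUpdate F γ h θ (Fin.init z)
        - γ • gradient (F (z (Fin.last h))) (localUpdate F γ h θ (Fin.init z))

/-- One communication round of FedAvg with `N` clients and `H` local steps: the average of the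
clients' last local iterates. Client `c` has the stochastic functions `F c`. -/
noncomputable def globalUpdate {N : ℕ} (F : Fin N → Z → Param d → ℝ) (γ : ℝ) (H : ℕ)
    (θ : Param d) (z : Fin N → Fin H → Z) : Param d :=
  (N : ℝ)⁻¹ • ∑ c, localUpdate (F c) γ H θ (z c)

/-- The joint law of the random states of one round: they are independent, and those of client `c`
have law `ξ c`. -/
noncomputable def stateLaw [MeasurableSpace Z] {N : ℕ} (ξ : Fin N → Measure Z) (H : ℕ) :
    Measure (Fin N → Fin H → Z) :=
  Measure.pi fun c => Measure.pi fun _ : Fin H => ξ c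

/-- The Markov kernel of the global iterates of FedAvg: `κ(θ, ·)` is the law of
`globalUpdate F γ H θ z` for `z` distributed as `stateLaw ξ H`. -/
noncomputable def kernel [MeasurableSpace Z] {N : ℕ} (F : Fin N → Z → Param d → ℝ)
    (ξ : Fin N → Measure Z) (γ : ℝ) (H : ℕ) : Kernel (Param d) (Param d) :=
  (Kernel.prod Kernel.id (Kernel.const (Param d) (stateLaw ξ H))).map
    fun p => globalUpdate F γ H p.1 p.2

/-- `π` is a stationary distribution of the global iterates of FedAvg. -/
def IsStationary [MeasurableSpace Z] {N : ℕ} (F : Fin N → Z → Param d → ℝ)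
    (ξ : Fin N → Measure Z) (γ : ℝ) (H : ℕ) (π : Measure (Param d)) : Prop :=
  IsProbabilityMeasure π ∧ Kernel.Invariant (kernel F ξ γ H) π

end Algorithm

end FedAvg

/-! Write `s = √γ`, let `x₀` be the minimizer, `A` the Hessian there, `K` its Kronecker sum, `Q` the
contraction with the third derivative, and `C` the noise covariance at `x₀`.

Existence and uniqueness. Cocoercivity makes a local step nonexpansive for every sample, and strong
monotonicity makes it contract in mean by `1 - γμ/2`; both survive composition and averaging over
clients. A stationary law is then the law of the limit of backward iterations
(`IsMeanContraction.exists_stationary`), and it is unique because Lipschitz test functions are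
flattened geometrically (`IsMeanContraction.stationary_unique`).

Scale. One local step multiplies the fourth moment of the deviation by at most `1 - γμ` and adds
`O(γ³)`. At stationarity, and throughout a round, the fourth moment is therefore `O(γ²)`, uniformly
in `N` and `H`: deviations have size `s` (`lintegral_le_of_drift`,
`IsGradientOracle.fourthMomentLE_parallelLaw`).

Expansion. The joint law of the `N` clients is followed one local step at a time. Let `U` and `m` be
the second moment and mean of the averaged deviation. Taylor expansion and independence of the noise
give `U' = U - γ K U + (γ²/N) C + O(s⁵)` and `m' = m - γ A m - (γ/2) Q V + O(s⁵)`, where `V`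
averages the second moments of the individual clients (`norm_covDev_step_le`,
`norm_meanDev_step_le`). After `H` steps the averaging restores the stationary law, so `U` and `m`
return to their initial values. A periodic solution of a contracting recursion lies within error/(1
- rate) of the fixed point, whatever the period (`le_of_periodic_recursion`). Since 1 - rate is of
order `γ`, an `O(s⁵)` error costs only `O(γ^{3/2})`, and `U ≈ (γ/N) K⁻¹ C`.

The matrix `V` differs from `U`, since it does not see the averaging. All clients start the round at
a common stationary point, however, and one local step changes a client's second moment by `O(γ²)`;
so `V` is within `O(γ²H)` of the stationary covariance (`norm_local_cov_sub_le`). This is the origin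
of the `γ²H` term. Inserting `V ≈ (γ/N) K⁻¹ C` into the recursion for `m` yields `-(γ/2N) A⁻¹ Q K⁻¹
C`. -/

set_option linter.unusedSectionVars false

namespace FedAvg

/-! ### Stationary laws of random maps, moment bounds from drift, shift of an i.i.d. sequence. -/

section RandomMap

open Filter
open scoped ENNReal NNReal

variable {E Ω : Type*} [MeasurableSpace E] [MeasurableSpace Ω]

/-- `π` is a stationary probability of the chain driven by the random map `Φ` with noise law `P`. -/
def IsStationaryMap (Φ : E → Ω → E) (P : Measure Ω) (π : Measure E) : Prop :=
  IsProbabilityMeasure π ∧ (π.prod P).map (Function.uncurry Φ) = π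

theorem lintegral_stationary {Φ : E → Ω → E} {P : Measure Ω} [SFinite P] {π : Measure E}
    (hΦ : Measurable (Function.uncurry Φ)) (h : IsStationaryMap Φ P π) {f : E → ℝ≥0∞}
    (hf : Measurable f) : ∫⁻ x, f x ∂π = ∫⁻ x, ∫⁻ ω, f (Φ x ω) ∂P ∂π := by
  conv_lhs => rw [← h.2]
  rw [lintegral_map hf hΦ]
  exact lintegral_prod _ (hf.comp hΦ).aemeasurable

/-- A Foster-Lyapunov drift bounds the corresponding moment of every stationary probability. -/
theorem lintegral_le_of_drift {Φ : E → Ω → E} {P : Measure Ω} [IsProbabilityMeasure P]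
    {π : Measure E} (hΦ : Measurable (Function.uncurry Φ)) (h : IsStationaryMap Φ P π)
    {V : E → ℝ≥0∞} (hV : Measurable V) (hVtop : ∀ x, V x ≠ ∞) {a b B : ℝ≥0∞} (ha : a < 1)
    (hB : a * B + b ≤ B) (hdrift : ∀ x, ∫⁻ ω, V (Φ x ω) ∂P ≤ a * V x + b) :
    ∫⁻ x, V x ∂π ≤ B := by
  have := h.1
  -- The moment of `V` may be infinite a priori, so stationarity is used on the bounded functions
  -- `min (s * V + t) M`. They are concave in `V`, so the integral over the noise passes inside.
  have hstep : ∀ (s t M : ℝ≥0∞), ∫⁻ x, min (s * V x + t) M ∂π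
      ≤ ∫⁻ x, min (s * (a * V x + b) + t) M ∂π := by
    intro s t M
    rw [lintegral_stationary hΦ h (by fun_prop)]
    refine lintegral_mono fun x => le_min ?_ ?_
    · have hm : Measurable fun ω => V (Φ x ω) := hV.comp (hΦ.comp measurable_prodMk_left)
      calc ∫⁻ ω, min (s * V (Φ x ω) + t) M ∂P ≤ ∫⁻ ω, (s * V (Φ x ω) + t) ∂P :=
            lintegral_mono fun ω => min_le_left _ _
        _ = s * ∫⁻ ω, V (Φ x ω) ∂P + t := by
            rw [lintegral_add_right _ measurable_const, lintegral_const_mul _ hm]; simp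
        _ ≤ _ := by gcongr; exact hdrift x
    · calc ∫⁻ ω, min (s * V (Φ x ω) + t) M ∂P ≤ ∫⁻ _, M ∂P :=
            lintegral_mono fun ω => min_le_right _ _
        _ = M := by simp
  -- The invariant `t + a ^ n * B ≤ B` keeps the accumulated constant below `B` for all `n`. Letting
  -- `n → ∞` kills the factor of `V`; then `M → ∞` by monotone convergence.
  have hiter : ∀ (M : ℝ≥0∞) (n : ℕ), ∃ t, t + a ^ n * B ≤ B ∧
      ∫⁻ x, min (V x) M ∂π ≤ ∫⁻ x, min (a ^ n * V x + t) M ∂π := by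
    intro M n
    induction n with
    | zero => exact ⟨0, by simp, by simp⟩
    | succ n ih =>
      obtain ⟨t, ht, hle⟩ := ih
      refine ⟨a ^ n * b + t, ?_, hle.trans ((hstep _ _ _).trans_eq ?_)⟩
      · calc a ^ n * b + t + a ^ (n + 1) * B = t + a ^ n * (a * B + b) := by ring
          _ ≤ t + a ^ n * B := by gcongr
          _ ≤ B := ht
      · refine lintegral_congr fun x => ?_
        congr 1; ring
  have htrunc : ∀ M : ℕ, ∫⁻ x, min (V x) M ∂π ≤ B := by
    intro M
    have hlim : Tendsto (fun n : ℕ => ∫⁻ x, min (a ^ n * V x + B) M ∂π) atTop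
        (𝓝 (∫⁻ x, min (0 * V x + B) M ∂π)) := by
      refine tendsto_lintegral_of_dominated_convergence (fun _ => (M : ℝ≥0∞))
        (fun n => by fun_prop) (fun n => ae_of_all _ fun x => min_le_right _ _)
        (by simp) (ae_of_all _ fun x => ?_)
      have h0 : Tendsto (fun n : ℕ => a ^ n * V x) atTop (𝓝 (0 * V x)) :=
        ENNReal.Tendsto.mul_const (ENNReal.tendsto_pow_atTop_nhds_zero_of_lt_one ha)
          (Or.inr (hVtop x))
      exact (h0.add_const B).min tendsto_const_nhds
    have hle : ∀ n : ℕ, ∫⁻ x, min (V x) M ∂π ≤ ∫⁻ x, min (a ^ n * V x + B) M ∂π := by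
      intro n
      obtain ⟨t, ht, hle⟩ := hiter M n
      refine hle.trans (lintegral_mono fun x => ?_)
      have : t ≤ B := le_self_add.trans ht
      gcongr
    refine (ge_of_tendsto' hlim hle).trans ?_
    calc ∫⁻ x, min (0 * V x + B) M ∂π ≤ ∫⁻ _, B ∂π := lintegral_mono fun x => by simp
      _ = B := by simp
  have hsup : ∀ x, V x = ⨆ M : ℕ, min (V x) M := by
    intro x
    obtain ⟨M, hM⟩ := ENNReal.exists_nat_gt (hVtop x)
    refine le_antisymm (le_iSup_of_le M ?_) (iSup_le fun M => min_le_left _ _)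
    rw [min_eq_left hM.le]
  calc ∫⁻ x, V x ∂π = ∫⁻ x, ⨆ M : ℕ, min (V x) M ∂π := lintegral_congr hsup
    _ = ⨆ M : ℕ, ∫⁻ x, min (V x) M ∂π := by
        refine lintegral_iSup (fun M => by fun_prop) fun m n hmn x => ?_
        have : (m : ℝ≥0∞) ≤ n := by exact_mod_cast hmn
        dsimp only
        gcongr
    _ ≤ B := iSup_le htrunc

variable (P : Measure Ω) [IsProbabilityMeasure P]

/-- Splitting off the first coordinate of an independent sequence. -/
theorem measurePreserving_head_tail :
    MeasurePreserving (fun ω : ℕ → Ω => (ω 0, fun k => ω (k + 1)))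
      (Measure.infinitePi fun _ : ℕ => P) (P.prod (Measure.infinitePi fun _ : ℕ => P)) := by
  let cons : Ω × (ℕ → Ω) → ℕ → Ω := fun p n => Nat.casesOn n p.1 p.2
  have hcons : Measurable cons := by
    refine measurable_pi_iff.2 fun n => ?_
    cases n with
    | zero => exact measurable_fst
    | succ n => exact (measurable_pi_apply n).comp measurable_snd
  have hmap : (P.prod (Measure.infinitePi fun _ : ℕ => P)).map cons
      = Measure.infinitePi fun _ : ℕ => P := by
    classical
    refine Measure.eq_infinitePi _ fun s t ht => ?_
    -- Padding with `univ` turns an arbitrary cylinder into one over an initial segment, where the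
    -- head splits off.
    let t' : ℕ → Set Ω := fun i => if i ∈ s then t i else Set.univ
    have ht' : ∀ i, MeasurableSet (t' i) := fun i => by
      by_cases hi : i ∈ s <;> simp [t', hi, ht]
    obtain ⟨n, hn⟩ : ∃ n, s ⊆ Finset.range (n + 1) :=
      ⟨s.sup id, fun i hi => Finset.mem_range.2 (Nat.lt_succ_of_le (Finset.le_sup (f := id) hi))⟩
    have hpre : cons ⁻¹' (Set.pi s t)
        = t' 0 ×ˢ Set.pi (Finset.range n : Set ℕ) fun i => t' (i + 1) := by
      ext p
      simp only [Set.mem_preimage, Set.mem_pi, Set.mem_prod, Finset.mem_coe, Finset.mem_range]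
      constructor
      · intro hp
        refine ⟨?_, fun i _ => ?_⟩
        · by_cases h0 : 0 ∈ s
          · simpa [t', h0, cons] using hp 0 h0
          · simp [t', h0]
        · by_cases h0 : i + 1 ∈ s
          · simpa [t', h0] using hp (i + 1) h0
          · simp [t', h0]
      · rintro ⟨h0, h1⟩ i hi
        cases i with
        | zero => simpa [t', hi, cons] using h0
        | succ i =>
          have := h1 i (by simpa using hn hi)
          simpa [t', hi] using this
    rw [Measure.map_apply hcons (MeasurableSet.pi s.countable_toSet fun i _ => ht i), hpre,
      Measure.prod_prod, Measure.infinitePi_pi _ fun i _ => ht' (i + 1), mul_comm,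
      ← Finset.prod_range_succ' (fun i => P (t' i)), ← Finset.prod_subset hn]
    · exact Finset.prod_congr rfl fun i hi => by simp [t', hi]
    · intro i _ hi
      simp [t', hi]
  have hmeas : Measurable fun ω : ℕ → Ω => (ω 0, fun k => ω (k + 1)) :=
    (measurable_pi_apply 0).prodMk (measurable_pi_iff.2 fun k => measurable_pi_apply (k + 1))
  refine ⟨hmeas, ?_⟩
  conv_lhs => rw [← hmap]
  rw [Measure.map_map hmeas hcons]
  exact Measure.map_id

end RandomMap

/-! ### Existence and uniqueness of the stationary law of a mean contraction. -/

section Contraction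

open Filter
open scoped ENNReal NNReal

variable {E Ω : Type*} [NormedAddCommGroup E] [MeasurableSpace E] [BorelSpace E]
  [SecondCountableTopology E] [MeasurableSpace Ω]

/-- A random map that is almost surely nonexpansive and contracts in mean. -/
structure IsMeanContraction (Φ : E → Ω → E) (P : Measure Ω) (q : ℝ≥0∞) : Prop where
  measurable : Measurable (Function.uncurry Φ)
  nonexpansive : ∀ ω x y, ‖Φ x ω - Φ y ω‖ ≤ ‖x - y‖
  contract : ∀ x y, ∫⁻ ω, ‖Φ x ω - Φ y ω‖ₑ ∂P ≤ q * ‖x - y‖ₑ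

namespace IsMeanContraction

variable {Φ : E → Ω → E} {P : Measure Ω} [IsProbabilityMeasure P] {q : ℝ≥0∞}

/-- `ψ` is the `n`-th iterate of the Markov operator applied to `φ`: stationarity preserves its
integral, and each application multiplies the Lipschitz constant by `q`. -/
theorem exists_smoothed (hΦ : IsMeanContraction Φ P q) {φ : E → ℂ} (hφm : Measurable φ)
    (hφ : ∀ x, ‖φ x‖ ≤ 1) {K : ℝ≥0∞} (hK : ∀ x y, ‖φ x - φ y‖ₑ ≤ K * ‖x - y‖ₑ) (n : ℕ) :
    ∃ ψ : E → ℂ, Measurable ψ ∧ (∀ x, ‖ψ x‖ ≤ 1) ∧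
      (∀ x y, ‖ψ x - ψ y‖ₑ ≤ K * q ^ n * ‖x - y‖ₑ) ∧
      ∀ π, IsStationaryMap Φ P π → ∫ x, ψ x ∂π = ∫ x, φ x ∂π := by
  induction n with
  | zero => exact ⟨φ, hφm, hφ, by simpa using hK, fun _ _ => rfl⟩
  | succ n ih =>
    obtain ⟨ψ, hψm, hψ, hψK, hψint⟩ := ih
    have hm : Measurable fun p : E × Ω => ψ (Φ p.1 p.2) := hψm.comp hΦ.measurable
    have hint : ∀ x, Integrable (fun ω => ψ (Φ x ω)) P := fun x =>
      Integrable.of_bound (hm.comp measurable_prodMk_left).aestronglyMeasurable 1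
        (ae_of_all _ fun ω => hψ _)
    refine ⟨fun x => ∫ ω, ψ (Φ x ω) ∂P, ?_, fun x => ?_, fun x y => ?_, fun π hπ => ?_⟩
    · exact (hm.stronglyMeasurable.integral_prod_right' (ν := P)).measurable
    · calc ‖∫ ω, ψ (Φ x ω) ∂P‖ ≤ 1 * P.real Set.univ :=
            norm_integral_le_of_norm_le_const (ae_of_all _ fun ω => hψ _)
        _ = 1 := by simp
    · rw [← integral_sub (hint x) (hint y)]
      calc ‖∫ ω, (ψ (Φ x ω) - ψ (Φ y ω)) ∂P‖ₑ ≤ ∫⁻ ω, ‖ψ (Φ x ω) - ψ (Φ y ω)‖ₑ ∂P :=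
            enorm_integral_le_lintegral_enorm _
        _ ≤ ∫⁻ ω, K * q ^ n * ‖Φ x ω - Φ y ω‖ₑ ∂P := lintegral_mono fun ω => hψK _ _
        _ = K * q ^ n * ∫⁻ ω, ‖Φ x ω - Φ y ω‖ₑ ∂P := by
            refine lintegral_const_mul _ ?_
            exact ((hΦ.measurable.comp measurable_prodMk_left).sub
              (hΦ.measurable.comp measurable_prodMk_left)).enorm
        _ ≤ K * q ^ n * (q * ‖x - y‖ₑ) := by gcongr; exact hΦ.contract x y
        _ = _ := by ring
    · have := hπ.1
      rw [← hψint π hπ]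
      conv_rhs => rw [← hπ.2]
      rw [integral_map hΦ.measurable.aemeasurable hψm.aestronglyMeasurable]
      exact (integral_prod (fun p : E × Ω => ψ (Φ p.1 p.2))
        (Integrable.of_bound hm.aestronglyMeasurable 1 (ae_of_all _ fun p => hψ _))).symm

/-- Both integrals are compared under the product coupling of the two laws, after smoothing `φ` many
times. The trivial bound `2` dominates, so the limit needs no moment of either law. -/
theorem integral_eq (hΦ : IsMeanContraction Φ P q) (hq : q < 1) {φ : E → ℂ} (hφm : Measurable φ)
    (hφ : ∀ x, ‖φ x‖ ≤ 1) {K : ℝ≥0∞} (hKtop : K ≠ ∞) (hK : ∀ x y, ‖φ x - φ y‖ₑ ≤ K * ‖x - y‖ₑ)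
    {π π' : Measure E} (hπ : IsStationaryMap Φ P π) (hπ' : IsStationaryMap Φ P π') :
    ∫ x, φ x ∂π = ∫ x, φ x ∂π' := by
  have := hπ.1
  have := hπ'.1
  have hlim : Tendsto (fun n : ℕ => ∫⁻ p : E × E, min 2 (K * q ^ n * ‖p.1 - p.2‖ₑ) ∂(π.prod π'))
      atTop (𝓝 (∫⁻ _ : E × E, 0 ∂(π.prod π'))) := by
    refine tendsto_lintegral_of_dominated_convergence (fun _ => (2 : ℝ≥0∞))
      (fun n => by fun_prop) (fun n => ae_of_all _ fun x => min_le_left _ _) (by simp)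
      (ae_of_all _ fun p => ?_)
    have h0 : Tendsto (fun n : ℕ => K * q ^ n * ‖p.1 - p.2‖ₑ) atTop (𝓝 (K * 0 * ‖p.1 - p.2‖ₑ)) :=
      ENNReal.Tendsto.mul_const (ENNReal.Tendsto.const_mul
        (ENNReal.tendsto_pow_atTop_nhds_zero_of_lt_one hq) (Or.inr hKtop)) (Or.inr enorm_ne_top)
    simpa using (tendsto_const_nhds (x := (2 : ℝ≥0∞))).min h0
  have hle : ∀ n : ℕ, ‖∫ x, φ x ∂π - ∫ x, φ x ∂π'‖ₑ
      ≤ ∫⁻ p : E × E, min 2 (K * q ^ n * ‖p.1 - p.2‖ₑ) ∂(π.prod π') := by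
    intro n
    obtain ⟨ψ, hψm, hψ, hψK, hψint⟩ := hΦ.exists_smoothed hφm hφ hK n
    have h1 : Integrable (fun p : E × E => ψ p.1) (π.prod π') :=
      Integrable.of_bound (hψm.comp measurable_fst).aestronglyMeasurable 1
        (ae_of_all _ fun p => hψ _)
    have h2 : Integrable (fun p : E × E => ψ p.2) (π.prod π') :=
      Integrable.of_bound (hψm.comp measurable_snd).aestronglyMeasurable 1
        (ae_of_all _ fun p => hψ _)
    have e1 : ∫ x, ψ x ∂π = ∫ p : E × E, ψ p.1 ∂(π.prod π') := by
      rw [integral_fun_fst]; simp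
    have e2 : ∫ x, ψ x ∂π' = ∫ p : E × E, ψ p.2 ∂(π.prod π') := by
      rw [integral_fun_snd]; simp
    rw [← hψint π hπ, ← hψint π' hπ', e1, e2, ← integral_sub h1 h2]
    refine (enorm_integral_le_lintegral_enorm _).trans (lintegral_mono fun p => le_min ?_ (hψK _ _))
    refine (enorm_sub_le).trans ?_
    have h3 : ∀ x, ‖ψ x‖ₑ ≤ 1 := fun x => by
      rw [← ofReal_norm]; exact ENNReal.ofReal_le_one.2 (hψ x)
    calc ‖ψ p.1‖ₑ + ‖ψ p.2‖ₑ ≤ 1 + 1 := add_le_add (h3 _) (h3 _)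
      _ = 2 := one_add_one_eq_two
  have h0 := ge_of_tendsto' hlim hle
  simp only [lintegral_zero, nonpos_iff_eq_zero, enorm_eq_zero] at h0
  exact sub_eq_zero.1 h0

end IsMeanContraction

/-- Backward iteration: composing the random maps with the newest one innermost gives increments
with geometrically decaying mean. The iterates thus converge almost surely, whereas the forward
chain converges only in law. -/
theorem IsMeanContraction.exists_stationary [CompleteSpace E] {Φ : E → Ω → E} {P : Measure Ω}
    [IsProbabilityMeasure P] {q : ℝ≥0∞} (hΦ : IsMeanContraction Φ P q) (hq : q < 1) (x₀ : E)
    (hx₀ : ∫⁻ ω, ‖Φ x₀ ω - x₀‖ₑ ∂P ≠ ∞) : ∃ π, IsStationaryMap Φ P π := by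
  set P' : Measure (ℕ → Ω) := Measure.infinitePi fun _ : ℕ => P with hP'
  have hsplit := measurePreserving_head_tail P
  have htail : MeasurePreserving (fun (ω : ℕ → Ω) k => ω (k + 1)) P' P' :=
    (measurePreserving_snd (μ := P) (ν := P')).comp hsplit
  -- `Y n ω = Φ(⋯Φ(x₀, ω (n-1))⋯, ω 0)`; the recursion applies `ω 0` last, to an iterate driven by
  -- the shifted sequence.
  let Y : ℕ → (ℕ → Ω) → E := fun n =>
    Nat.rec (fun _ => x₀) (fun _ y ω => Φ (y fun k => ω (k + 1)) (ω 0)) n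
  have hY : ∀ n, Measurable (Y n) := by
    intro n
    induction n with
    | zero => exact measurable_const
    | succ n ih =>
      exact hΦ.measurable.comp ((ih.comp htail.measurable).prodMk (measurable_pi_apply 0))
  have hYsub : ∀ m n, Measurable fun ω => ‖Y m ω - Y n ω‖ₑ := fun m n =>
    ((hY m).sub (hY n)).enorm
  have hstep : ∀ n, ∫⁻ ω, ‖Y (n + 2) ω - Y (n + 1) ω‖ₑ ∂P'
      ≤ q * ∫⁻ ω, ‖Y (n + 1) ω - Y n ω‖ₑ ∂P' := by
    intro n
    have hm : Measurable fun p : Ω × (ℕ → Ω) => ‖Φ (Y (n + 1) p.2) p.1 - Φ (Y n p.2) p.1‖ₑ :=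
      ((hΦ.measurable.comp (((hY (n + 1)).comp measurable_snd).prodMk measurable_fst)).sub
        (hΦ.measurable.comp (((hY n).comp measurable_snd).prodMk measurable_fst))).enorm
    calc ∫⁻ ω, ‖Y (n + 2) ω - Y (n + 1) ω‖ₑ ∂P'
        = ∫⁻ p : Ω × (ℕ → Ω), ‖Φ (Y (n + 1) p.2) p.1 - Φ (Y n p.2) p.1‖ₑ ∂(P.prod P') :=
          hsplit.lintegral_comp hm
      _ = ∫⁻ ω, ∫⁻ ω₀, ‖Φ (Y (n + 1) ω) ω₀ - Φ (Y n ω) ω₀‖ₑ ∂P ∂P' :=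
          lintegral_prod_symm' _ hm
      _ ≤ ∫⁻ ω, q * ‖Y (n + 1) ω - Y n ω‖ₑ ∂P' := lintegral_mono fun ω => hΦ.contract _ _
      _ = _ := lintegral_const_mul _ (hYsub (n + 1) n)
  have hzero : ∫⁻ ω, ‖Y 1 ω - Y 0 ω‖ₑ ∂P' = ∫⁻ ω, ‖Φ x₀ ω - x₀‖ₑ ∂P :=
    (measurePreserving_eval_infinitePi (fun _ : ℕ => P) 0).lintegral_comp
      (f := fun ω => ‖Φ x₀ ω - x₀‖ₑ)
      ((hΦ.measurable.comp measurable_prodMk_left).sub measurable_const).enorm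
  have hgeom : ∀ n, ∫⁻ ω, ‖Y (n + 1) ω - Y n ω‖ₑ ∂P' ≤ q ^ n * ∫⁻ ω, ‖Φ x₀ ω - x₀‖ₑ ∂P := by
    intro n
    induction n with
    | zero => simp [hzero]
    | succ n ih =>
      calc _ ≤ q * (q ^ n * ∫⁻ ω, ‖Φ x₀ ω - x₀‖ₑ ∂P) := (hstep n).trans (by gcongr)
        _ = _ := by ring
  have hsum : ∫⁻ ω, ∑' n, ‖Y (n + 1) ω - Y n ω‖ₑ ∂P' ≠ ∞ := by
    rw [lintegral_tsum fun n => (hYsub (n + 1) n).aemeasurable]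
    refine ne_top_of_le_ne_top ?_ (ENNReal.tsum_le_tsum hgeom)
    rw [ENNReal.tsum_mul_right, ENNReal.tsum_geometric]
    exact ENNReal.mul_ne_top (ENNReal.inv_ne_top.2 (tsub_pos_of_lt hq).ne') hx₀
  have hconv : ∀ᵐ ω ∂P', ∃ l, Tendsto (fun n => Y n ω) atTop (𝓝 l) := by
    have hfin : ∀ᵐ ω ∂P', ∑' n, ‖Y (n + 1) ω - Y n ω‖ₑ < ∞ :=
      ae_lt_top (Measurable.tsum fun n => hYsub (n + 1) n) hsum
    filter_upwards [hfin] with ω hω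
    refine cauchySeq_tendsto_of_complete
      (cauchySeq_of_edist_le_of_tsum_ne_top (fun n => ‖Y (n + 1) ω - Y n ω‖ₑ) (fun n => ?_) hω.ne)
    rw [edist_comm, edist_eq_enorm_sub]
  obtain ⟨Yl, hYl, hlim⟩ := measurable_limit_of_tendsto_metrizable_ae
    (fun n => (hY n).aemeasurable) hconv
  -- The limit solves the fixed point equation because `Φ · (ω 0)` is continuous, being
  -- nonexpansive. As `ω 0` is independent of the shifted sequence, this equation says that the law
  -- of `Yl` is stationary.
  have hfix : ∀ᵐ ω ∂P', Yl ω = Φ (Yl fun k => ω (k + 1)) (ω 0) := by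
    filter_upwards [hlim, htail.quasiMeasurePreserving.ae hlim] with ω h1 h2
    have hcont : Continuous fun x => Φ x (ω 0) :=
      (LipschitzWith.of_dist_le_mul (K := 1) fun x y => by
        simpa [dist_eq_norm] using hΦ.nonexpansive (ω 0) x y).continuous
    exact tendsto_nhds_unique ((tendsto_add_atTop_iff_nat 1).2 h1) ((hcont.tendsto _).comp h2)
  refine ⟨P'.map Yl, Measure.isProbabilityMeasure_map hYl.aemeasurable, ?_⟩
  have hprod : ((P'.map Yl).prod P) = (P.prod P').map fun p => (Yl p.2, p.1) := by
    have h := Measure.map_prod_map P' P hYl (measurable_id (α := Ω))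
    rw [Measure.map_id] at h
    rw [h, ← Measure.prod_swap, Measure.map_map (by fun_prop) measurable_swap]
    rfl
  rw [hprod, Measure.map_map hΦ.measurable (by fun_prop), ← hsplit.map_eq,
    Measure.map_map (hΦ.measurable.comp (by fun_prop)) hsplit.measurable]
  exact (Measure.map_congr hfix).symm

end Contraction

/-- Characteristic functions determine the law, and `x ↦ exp(i⟨x, t⟩)` is bounded by `1` and
`‖t‖`-Lipschitz. -/
theorem IsMeanContraction.stationary_unique {E Ω : Type*} [NormedAddCommGroup E]
    [InnerProductSpace ℝ E] [CompleteSpace E]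
    [MeasurableSpace E] [BorelSpace E] [SecondCountableTopology E] [MeasurableSpace Ω]
    {Φ : E → Ω → E} {P : Measure Ω} [IsProbabilityMeasure P] {q : ENNReal}
    (hΦ : IsMeanContraction Φ P q) (hq : q < 1)
    {π π' : Measure E} (hπ : IsStationaryMap Φ P π) (hπ' : IsStationaryMap Φ P π') : π = π' := by
  have := hπ.1
  have := hπ'.1
  refine Measure.ext_of_charFun (funext fun t => ?_)
  rw [charFun_apply, charFun_apply]
  refine hΦ.integral_eq hq (by fun_prop) (fun x => (Complex.norm_exp_ofReal_mul_I _).le)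
    (K := ‖t‖ₑ) enorm_ne_top (fun x y => ?_) hπ hπ'
  rw [← ofReal_norm, ← ofReal_norm, ← ofReal_norm, ← ENNReal.ofReal_mul (norm_nonneg _)]
  refine ENNReal.ofReal_le_ofReal ?_
  have h1 : Complex.exp ((inner ℝ x t : ℝ) * Complex.I) - Complex.exp ((inner ℝ y t : ℝ) * Complex.I)
      = Complex.exp ((inner ℝ y t : ℝ) * Complex.I)
        * (Complex.exp (Complex.I * (inner ℝ (x - y) t : ℝ)) - 1) := by
    rw [mul_sub, ← Complex.exp_add, inner_sub_left]
    push_cast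
    ring_nf
  rw [h1, norm_mul, Complex.norm_exp_ofReal_mul_I, one_mul]
  refine (Real.norm_exp_I_mul_ofReal_sub_one_le).trans ?_
  rw [mul_comm]
  exact norm_inner_le_norm _ _

/-! ### Pointwise inequalities for one stochastic gradient step. -/

section StepInequalities

variable {E : Type*} [NormedAddCommGroup E] [InnerProductSpace ℝ E]

theorem norm_sub_smul_sq_le {L γ : ℝ} (hγ : 0 ≤ γ) (hγL : γ * L ≤ 1 / 8) {δ D : E}
    (hco : ‖D‖ ^ 2 ≤ 2 * L * inner ℝ δ D) (hs : 0 ≤ inner ℝ δ D) :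
    ‖δ - γ • D‖ ^ 2 ≤ ‖δ‖ ^ 2 - 7 / 4 * γ * inner ℝ δ D := by
  have h : ‖δ - γ • D‖ ^ 2 = ‖δ‖ ^ 2 - 2 * γ * inner ℝ δ D + γ ^ 2 * ‖D‖ ^ 2 := by
    rw [norm_sub_sq_real, inner_smul_right, norm_smul, Real.norm_of_nonneg hγ]; ring
  have h1 : γ ^ 2 * ‖D‖ ^ 2 ≤ γ ^ 2 * (2 * L * inner ℝ δ D) := by gcongr
  have h2 : γ * inner ℝ δ D * (γ * L) ≤ γ * inner ℝ δ D * (1 / 8) := by gcongr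
  rw [h]; nlinarith

theorem inner_nonneg_of_cocoercive {L : ℝ} (hL : 0 < L) {δ D : E}
    (hco : ‖D‖ ^ 2 ≤ 2 * L * inner ℝ δ D) : 0 ≤ (inner ℝ δ D : ℝ) := by
  have : 0 ≤ 2 * L * (inner ℝ δ D : ℝ) := (sq_nonneg _).trans hco
  exact nonneg_of_mul_nonneg_right this (by positivity)

/-- Here `d`, `D`, `e` are the norms of the deviation, the gradient increment and the noise, and
`s`, `u`, `w` the inner products deviation-increment, deviation-noise, increment-noise. The aim is
to isolate a term linear in the noise with coefficient `d ^ 2`. The natural coefficient `Q` depends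
on the sample, whereas `d ^ 2` does not, so that `-4γd²u` has mean zero. -/
theorem quartic_bound {L γ d s D e u w : ℝ} (hγ : 0 ≤ γ) (hL : 0 ≤ L) (hγL : γ * L ≤ 1 / 8)
    (hd : 0 ≤ d) (he : 0 ≤ e) (hs : 0 ≤ s) (hsd : s ≤ L * d ^ 2)
    (hco : D ^ 2 ≤ 2 * L * s) (hu : |u| ≤ d * e) (hw : |w| ≤ L * d * e)
    (hQ : 0 ≤ d ^ 2 - 2 * γ * s + γ ^ 2 * D ^ 2) :
    (d ^ 2 - 2 * γ * s + γ ^ 2 * D ^ 2 - 2 * γ * u + 2 * γ ^ 2 * w + γ ^ 2 * e ^ 2) ^ 2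
      ≤ d ^ 4 - 7 / 4 * γ * d ^ 2 * s - 4 * γ * d ^ 2 * u + 12 * γ ^ 2 * L * d ^ 3 * e
        + 15 * γ ^ 2 * d ^ 2 * e ^ 2 + 3 * γ ^ 4 * e ^ 4 := by
  set Q := d ^ 2 - 2 * γ * s + γ ^ 2 * D ^ 2 with hQdef
  have hγD : γ ^ 2 * D ^ 2 ≤ 1 / 4 * γ * s := by
    have h1 : γ ^ 2 * D ^ 2 ≤ γ ^ 2 * (2 * L * s) := by gcongr
    have h2 : γ * s * (γ * L) ≤ γ * s * (1 / 8) := by gcongr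
    nlinarith
  have hγs : 0 ≤ γ * s := by positivity
  have hQ1 : Q ≤ d ^ 2 - 7 / 4 * γ * s := by rw [hQdef]; linarith
  have hQ2 : Q ≤ d ^ 2 := by linarith
  have hQ3 : d ^ 2 - Q ≤ 2 * γ * s := by
    have : 0 ≤ γ ^ 2 * D ^ 2 := by positivity
    rw [hQdef]; linarith
  have t1 : Q ^ 2 ≤ d ^ 4 - 7 / 4 * γ * d ^ 2 * s := by
    calc Q ^ 2 = Q * Q := sq Q
      _ ≤ d ^ 2 * (d ^ 2 - 7 / 4 * γ * s) := mul_le_mul hQ2 hQ1 hQ (by positivity)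
      _ = _ := by ring
  -- Replacing `Q` by `d ^ 2` costs `(d ^ 2 - Q) |u|`, which is of second order in `γ`.
  have t2 : -(4 * γ * Q * u) ≤ -(4 * γ * d ^ 2 * u) + 8 * γ ^ 2 * L * d ^ 3 * e := by
    have h1 : (d ^ 2 - Q) * u ≤ 2 * γ * (L * d ^ 2) * (d * e) :=
      calc (d ^ 2 - Q) * u ≤ (d ^ 2 - Q) * |u| :=
            mul_le_mul_of_nonneg_left (le_abs_self u) (by linarith)
        _ ≤ 2 * γ * s * (d * e) := mul_le_mul hQ3 hu (abs_nonneg _) (by positivity)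
        _ ≤ _ := by gcongr
    have h2 : 4 * γ * ((d ^ 2 - Q) * u) ≤ 4 * γ * (2 * γ * (L * d ^ 2) * (d * e)) := by gcongr
    nlinarith
  have t3 : 4 * γ ^ 2 * Q * w ≤ 4 * γ ^ 2 * L * d ^ 3 * e := by
    have h1 : Q * w ≤ d ^ 2 * (L * d * e) :=
      calc Q * w ≤ Q * |w| := mul_le_mul_of_nonneg_left (le_abs_self w) hQ
        _ ≤ _ := mul_le_mul hQ2 hw (abs_nonneg _) (by positivity)
    have h2 : 4 * γ ^ 2 * (Q * w) ≤ 4 * γ ^ 2 * (d ^ 2 * (L * d * e)) := by gcongr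
    nlinarith
  have t4 : 2 * γ ^ 2 * Q * e ^ 2 ≤ 2 * γ ^ 2 * d ^ 2 * e ^ 2 := by gcongr
  have hu2 : u ^ 2 ≤ d ^ 2 * e ^ 2 := by
    calc u ^ 2 = |u| ^ 2 := (sq_abs u).symm
      _ ≤ (d * e) ^ 2 := by gcongr
      _ = _ := by ring
  have hw2 : γ ^ 2 * w ^ 2 ≤ 1 / 64 * (d ^ 2 * e ^ 2) := by
    calc γ ^ 2 * w ^ 2 = γ ^ 2 * |w| ^ 2 := by rw [sq_abs]
      _ ≤ γ ^ 2 * (L * d * e) ^ 2 := by gcongr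
      _ = (γ * L) ^ 2 * (d ^ 2 * e ^ 2) := by ring
      _ ≤ (1 / 8) ^ 2 * (d ^ 2 * e ^ 2) := by gcongr
      _ = _ := by ring
  have t5 : (-2 * γ * u + 2 * γ ^ 2 * w + γ ^ 2 * e ^ 2) ^ 2
      ≤ 13 * γ ^ 2 * d ^ 2 * e ^ 2 + 3 * γ ^ 4 * e ^ 4 := by
    have h1 : (-2 * γ * u + 2 * γ ^ 2 * w + γ ^ 2 * e ^ 2) ^ 2
        ≤ 3 * ((2 * γ * u) ^ 2 + (2 * γ ^ 2 * w) ^ 2 + (γ ^ 2 * e ^ 2) ^ 2) := by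
      nlinarith [sq_nonneg (2 * γ * u + 2 * γ ^ 2 * w), sq_nonneg (2 * γ * u + γ ^ 2 * e ^ 2),
        sq_nonneg (2 * γ ^ 2 * w - γ ^ 2 * e ^ 2)]
    have h2 : γ ^ 2 * u ^ 2 ≤ γ ^ 2 * (d ^ 2 * e ^ 2) := by gcongr
    have h3 : γ ^ 2 * (γ ^ 2 * w ^ 2) ≤ γ ^ 2 * (1 / 64 * (d ^ 2 * e ^ 2)) := by gcongr
    have h4 : 0 ≤ γ ^ 2 * (d ^ 2 * e ^ 2) := by positivity
    nlinarith
  have hexp : (Q - 2 * γ * u + 2 * γ ^ 2 * w + γ ^ 2 * e ^ 2) ^ 2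
      = Q ^ 2 + -(4 * γ * Q * u) + 4 * γ ^ 2 * Q * w + 2 * γ ^ 2 * Q * e ^ 2
        + (-2 * γ * u + 2 * γ ^ 2 * w + γ ^ 2 * e ^ 2) ^ 2 := by ring
  rw [hexp]
  linarith

/-- The constant in the drift of the fourth moment. -/
noncomputable def driftConst (μ L : ℝ) : ℝ := (15 + 18 * L / μ) ^ 2 / μ + 3 / (8 * L)

/-- Young's inequality is used twice, each time spending `γ(μ/4)d⁴` of the contraction: first on the
`d³e` term, which becomes a `d²e²` term, then on all `d²e²` terms together. What remains is `γ³e⁴`,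
the order that makes the stationary fourth moment `O(γ²)`. -/
theorem quartic_young {μ L γ d e : ℝ} (hμ : 0 < μ) (hL : 0 < L) (hγ : 0 ≤ γ)
    (hγL : γ * L ≤ 1 / 8) :
    12 * γ ^ 2 * L * d ^ 3 * e + 15 * γ ^ 2 * d ^ 2 * e ^ 2 + 3 * γ ^ 4 * e ^ 4
      ≤ γ * (μ / 2) * d ^ 4 + driftConst μ L * γ ^ 3 * e ^ 4 := by
  have young : ∀ x y : ℝ, x * y ≤ μ / 4 * x ^ 2 + y ^ 2 / μ := by
    intro x y
    have h : 0 ≤ (μ / 2 * x - y) ^ 2 / μ := by positivity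
    have h' : (μ / 2 * x - y) ^ 2 / μ = μ / 4 * x ^ 2 + y ^ 2 / μ - x * y := by
      field_simp; ring
    linarith
  set c := 15 + 18 * L / μ with hc
  have h1 : 12 * γ ^ 2 * L * d ^ 3 * e ≤ γ * (μ / 4) * d ^ 4 + 18 * L / μ * γ ^ 2 * d ^ 2 * e ^ 2 := by
    have h := mul_le_mul_of_nonneg_left (young (d ^ 2) (12 * γ * L * d * e)) hγ
    have h2 : γ * ((12 * γ * L * d * e) ^ 2 / μ) ≤ 18 * L / μ * γ ^ 2 * d ^ 2 * e ^ 2 := by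
      have h3 : γ * L * (144 * L / μ * γ ^ 2 * d ^ 2 * e ^ 2)
          ≤ 1 / 8 * (144 * L / μ * γ ^ 2 * d ^ 2 * e ^ 2) := by gcongr
      calc γ * ((12 * γ * L * d * e) ^ 2 / μ) = γ * L * (144 * L / μ * γ ^ 2 * d ^ 2 * e ^ 2) := by
            ring
        _ ≤ _ := h3
        _ = _ := by ring
    nlinarith
  have h2 : c * γ ^ 2 * d ^ 2 * e ^ 2 ≤ γ * (μ / 4) * d ^ 4 + c ^ 2 / μ * γ ^ 3 * e ^ 4 := by
    have h := mul_le_mul_of_nonneg_left (young (d ^ 2) (c * γ * e ^ 2)) hγ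
    calc c * γ ^ 2 * d ^ 2 * e ^ 2 = γ * (d ^ 2 * (c * γ * e ^ 2)) := by ring
      _ ≤ _ := h
      _ = _ := by ring
  have h3 : 3 * γ ^ 4 * e ^ 4 ≤ 3 / (8 * L) * γ ^ 3 * e ^ 4 := by
    have hγ' : γ ≤ 1 / (8 * L) := by rw [le_div_iff₀ (by positivity)]; linarith
    have h4 : γ * (3 * γ ^ 3 * e ^ 4) ≤ 1 / (8 * L) * (3 * γ ^ 3 * e ^ 4) := by gcongr
    calc 3 * γ ^ 4 * e ^ 4 = γ * (3 * γ ^ 3 * e ^ 4) := by ring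
      _ ≤ _ := h4
      _ = _ := by ring
  have h4 : driftConst μ L = c ^ 2 / μ + 3 / (8 * L) := rfl
  rw [h4]
  have h5 : c * γ ^ 2 * d ^ 2 * e ^ 2
      = 15 * γ ^ 2 * d ^ 2 * e ^ 2 + 18 * L / μ * γ ^ 2 * d ^ 2 * e ^ 2 := by rw [hc]; ring
  linarith

theorem driftConst_nonneg {μ L : ℝ} (hμ : 0 < μ) (hL : 0 < L) : 0 ≤ driftConst μ L := by
  unfold driftConst; positivity

theorem norm_step_pow_four_le {μ L γ : ℝ} (hμ : 0 < μ) (hL : 0 < L) (hγ : 0 ≤ γ)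
    (hγL : γ * L ≤ 1 / 8) {δ D : E} (e : E) (hlip : ‖D‖ ≤ L * ‖δ‖)
    (hco : ‖D‖ ^ 2 ≤ 2 * L * inner ℝ δ D) :
    ‖δ - γ • (D + e)‖ ^ 4 ≤ (1 + γ * (μ / 2)) * ‖δ‖ ^ 4 - 7 / 4 * γ * ‖δ‖ ^ 2 * inner ℝ δ D
      - 4 * γ * ‖δ‖ ^ 2 * inner ℝ δ e + driftConst μ L * γ ^ 3 * ‖e‖ ^ 4 := by
  have hs := inner_nonneg_of_cocoercive hL hco
  have hsd : (inner ℝ δ D : ℝ) ≤ L * ‖δ‖ ^ 2 := by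
    calc (inner ℝ δ D : ℝ) ≤ ‖δ‖ * ‖D‖ := real_inner_le_norm _ _
      _ ≤ ‖δ‖ * (L * ‖δ‖) := by gcongr
      _ = _ := by ring
  have hQ : ‖δ‖ ^ 2 - 2 * γ * inner ℝ δ D + γ ^ 2 * ‖D‖ ^ 2 = ‖δ - γ • D‖ ^ 2 := by
    rw [norm_sub_sq_real, inner_smul_right, norm_smul, Real.norm_of_nonneg hγ]; ring
  have hw : |(inner ℝ D e : ℝ)| ≤ L * ‖δ‖ * ‖e‖ :=
    (abs_real_inner_le_norm _ _).trans (by gcongr)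
  have h := quartic_bound hγ hL.le hγL (norm_nonneg δ) (norm_nonneg e) hs hsd hco
    (abs_real_inner_le_norm δ e) hw (by rw [hQ]; positivity)
  have hexp : ‖δ - γ • (D + e)‖ ^ 2 = ‖δ‖ ^ 2 - 2 * γ * inner ℝ δ D + γ ^ 2 * ‖D‖ ^ 2
      - 2 * γ * inner ℝ δ e + 2 * γ ^ 2 * inner ℝ D e + γ ^ 2 * ‖e‖ ^ 2 := by
    rw [norm_sub_sq_real, inner_smul_right, norm_smul, Real.norm_of_nonneg hγ, mul_pow,
      norm_add_sq_real, inner_add_right]; ring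
  have hy := quartic_young (d := ‖δ‖) (e := ‖e‖) hμ hL hγ hγL
  have h4 : ‖δ - γ • (D + e)‖ ^ 4 = (‖δ - γ • (D + e)‖ ^ 2) ^ 2 := by ring
  rw [h4, hexp]
  linarith

end StepInequalities

/-! ### Stochastic gradient oracles: mean contraction and fourth moment drift of one step. -/

section Oracle

variable {Z E : Type*} [MeasurableSpace Z] [NormedAddCommGroup E]

/-- The fourth moment of the stochastic gradient at the critical point. -/
noncomputable def noiseMoment (G : Z → E → E) (ξ : Measure Z) (x₀ : E) : ℝ :=
  ∫ z, ‖G z x₀‖ ^ 4 ∂ξ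

theorem noiseMoment_nonneg (G : Z → E → E) (ξ : Measure Z) (x₀ : E) : 0 ≤ noiseMoment G ξ x₀ :=
  integral_nonneg fun _ => by positivity

variable [InnerProductSpace ℝ E] [MeasurableSpace E]

/-- Unbiased, Lipschitz and cocoercive stochastic gradients `G z` of a strongly monotone field `g`
that vanishes at `x₀`, with a fourth moment at `x₀`. -/
structure IsGradientOracle (G : Z → E → E) (g : E → E) (ξ : Measure Z) (x₀ : E) (μ L : ℝ) :
    Prop where
  measurable : Measurable (Function.uncurry G)
  lipschitz : ∀ z x y, ‖G z x - G z y‖ ≤ L * ‖x - y‖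
  cocoercive : ∀ z x y, ‖G z x - G z y‖ ^ 2 ≤ 2 * L * inner ℝ (x - y) (G z x - G z y)
  moment : Integrable (fun z => ‖G z x₀‖ ^ 4) ξ
  integral_eq : ∀ x, ∫ z, G z x ∂ξ = g x
  critical : g x₀ = 0
  strongMono : ∀ x y, μ * ‖x - y‖ ^ 2 ≤ inner ℝ (x - y) (g x - g y)
  mu_pos : 0 < μ
  L_pos : 0 < L
  mu_le : μ ≤ L

namespace IsGradientOracle

variable {G : Z → E → E} {g : E → E} {ξ : Measure Z} {x₀ : E} {μ L : ℝ}

theorem measurable_apply (hG : IsGradientOracle G g ξ x₀ μ L) (x : E) :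
    Measurable fun z => G z x :=
  hG.measurable.comp measurable_prodMk_right

theorem nonexpansive (hG : IsGradientOracle G g ξ x₀ μ L) {γ : ℝ} (hγ : 0 ≤ γ)
    (hγL : γ * L ≤ 1 / 8) (z : Z) (x y : E) :
    ‖(x - γ • G z x) - (y - γ • G z y)‖ ≤ ‖x - y‖ := by
  have h0 := inner_nonneg_of_cocoercive hG.L_pos (hG.cocoercive z x y)
  have h := norm_sub_smul_sq_le hγ hγL (hG.cocoercive z x y) h0
  rw [sub_sub_sub_comm, ← smul_sub]
  refine le_of_sq_le_sq ?_ (norm_nonneg _)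
  have : 0 ≤ 7 / 4 * γ * inner ℝ (x - y) (G z x - G z y) := by positivity
  linarith

variable [BorelSpace E] [SecondCountableTopology E] [IsProbabilityMeasure ξ]

theorem memLp (hG : IsGradientOracle G g ξ x₀ μ L) : MemLp (fun z => G z x₀) 4 ξ := by
  rw [← integrable_norm_rpow_iff (hG.measurable_apply x₀).aestronglyMeasurable (by norm_num)
    (by norm_num)]
  refine hG.moment.congr (ae_of_all _ fun z => ?_)
  simp only
  rw [← Real.rpow_natCast]
  norm_num

theorem integrable_sub (hG : IsGradientOracle G g ξ x₀ μ L) (x y : E) :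
    Integrable (fun z => G z x - G z y) ξ :=
  Integrable.of_bound ((hG.measurable_apply x).sub (hG.measurable_apply y)).aestronglyMeasurable
    (L * ‖x - y‖) (ae_of_all _ fun z => hG.lipschitz z x y)

theorem integrable (hG : IsGradientOracle G g ξ x₀ μ L) (x : E) :
    Integrable (fun z => G z x) ξ := by
  refine ((hG.integrable_sub x x₀).add (hG.memLp.integrable (by norm_num))).congr
    (ae_of_all _ fun z => ?_)
  simp

theorem integral_sub_eq (hG : IsGradientOracle G g ξ x₀ μ L) (x y : E) :
    ∫ z, (G z x - G z y) ∂ξ = g x - g y := by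
  rw [integral_sub (hG.integrable x) (hG.integrable y), hG.integral_eq, hG.integral_eq]

theorem norm_field_sub_le (hG : IsGradientOracle G g ξ x₀ μ L) (x y : E) :
    ‖g x - g y‖ ≤ L * ‖x - y‖ := by
  rw [← hG.integral_sub_eq]
  calc _ ≤ L * ‖x - y‖ * ξ.real Set.univ :=
        norm_integral_le_of_norm_le_const (ae_of_all _ fun z => hG.lipschitz z x y)
    _ = _ := by simp

theorem norm_field_le (hG : IsGradientOracle G g ξ x₀ μ L) (x : E) :
    ‖g x‖ ≤ L * ‖x - x₀‖ := by
  simpa [hG.critical] using hG.norm_field_sub_le x x₀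

variable [CompleteSpace E]

/-- From `ab ≤ (a² + b²)/2` with `a = ‖x - y‖` and `b` the distance after the step: the
squared-distance inequality then bounds `ab` by an expression affine in the sample gradients, which
integrates to the strongly monotone field. -/
theorem integral_norm_step_sub_le (hG : IsGradientOracle G g ξ x₀ μ L) {γ : ℝ} (hγ : 0 ≤ γ)
    (hγL : γ * L ≤ 1 / 8) (x y : E) :
    ∫ z, ‖(x - γ • G z x) - (y - γ • G z y)‖ ∂ξ ≤ (1 - γ * μ / 2) * ‖x - y‖ := by
  rcases eq_or_ne x y with rfl | hxy
  · simp
  have hd : 0 < ‖x - y‖ := norm_pos_iff.2 (sub_ne_zero.2 hxy)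
  have hint : Integrable (fun z => inner ℝ (x - y) (G z x - G z y)) ξ :=
    (hG.integrable_sub x y).const_inner _
  have hm : Measurable fun z => (x - γ • G z x) - (y - γ • G z y) :=
    (measurable_const.sub ((hG.measurable_apply x).const_smul γ)).sub
      (measurable_const.sub ((hG.measurable_apply y).const_smul γ))
  have hleft : Integrable (fun z => ‖(x - γ • G z x) - (y - γ • G z y)‖) ξ :=
    Integrable.of_bound hm.norm.aestronglyMeasurable ‖x - y‖
      (ae_of_all _ fun z => by simpa using hG.nonexpansive hγ hγL z x y)
  have hpt : ∀ z, ‖x - y‖ * ‖(x - γ • G z x) - (y - γ • G z y)‖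
      ≤ ‖x - y‖ ^ 2 - 7 / 8 * γ * inner ℝ (x - y) (G z x - G z y) := by
    intro z
    have h0 := inner_nonneg_of_cocoercive hG.L_pos (hG.cocoercive z x y)
    have h := norm_sub_smul_sq_le hγ hγL (hG.cocoercive z x y) h0
    rw [sub_sub_sub_comm, ← smul_sub]
    nlinarith [sq_nonneg (‖x - y‖ - ‖(x - y) - γ • (G z x - G z y)‖)]
  have hI := integral_mono (hleft.const_mul ‖x - y‖)
    ((integrable_const _).sub (hint.const_mul (7 / 8 * γ))) hpt
  have hint' : ∫ z, inner ℝ (x - y) (G z x - G z y) ∂ξ = inner ℝ (x - y) (g x - g y) := by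
    rw [integral_inner (hG.integrable_sub x y), hG.integral_sub_eq]
  simp only [Pi.sub_apply] at hI
  rw [integral_const_mul, integral_sub (integrable_const _) (hint.const_mul _),
    integral_const_mul, hint'] at hI
  simp only [integral_const, probReal_univ, one_smul] at hI
  have hmono := mul_le_mul_of_nonneg_left (hG.strongMono x y) (by positivity : 0 ≤ 7 / 8 * γ)
  have hpos : 0 ≤ γ * μ * ‖x - y‖ ^ 2 := by have := hG.mu_pos; positivity
  refine le_of_mul_le_mul_left (hI.trans ?_) hd
  nlinarith

theorem integral_norm_step_pow_four_le (hG : IsGradientOracle G g ξ x₀ μ L) {γ : ℝ} (hγ : 0 ≤ γ)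
    (hγL : γ * L ≤ 1 / 8) (x : E) :
    Integrable (fun z => ‖x - γ • G z x - x₀‖ ^ 4) ξ ∧
    ∫ z, ‖x - γ • G z x - x₀‖ ^ 4 ∂ξ
      ≤ (1 - γ * μ) * ‖x - x₀‖ ^ 4 + driftConst μ L * noiseMoment G ξ x₀ * γ ^ 3 := by
  have hint : Integrable (fun z => inner ℝ (x - x₀) (G z x - G z x₀)) ξ :=
    (hG.integrable_sub x x₀).const_inner _
  have hint0 : Integrable (fun z => inner ℝ (x - x₀) (G z x₀)) ξ :=
    (hG.integrable x₀).const_inner _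
  have hm : Measurable fun z => ‖x - γ • G z x - x₀‖ ^ 4 :=
    (((measurable_const.sub ((hG.measurable_apply x).const_smul γ)).sub
      measurable_const).norm).pow_const 4
  have hpt : ∀ z, ‖x - γ • G z x - x₀‖ ^ 4 ≤ (1 + γ * (μ / 2)) * ‖x - x₀‖ ^ 4
      - 7 / 4 * γ * ‖x - x₀‖ ^ 2 * inner ℝ (x - x₀) (G z x - G z x₀)
      - 4 * γ * ‖x - x₀‖ ^ 2 * inner ℝ (x - x₀) (G z x₀)
      + driftConst μ L * γ ^ 3 * ‖G z x₀‖ ^ 4 := by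
    intro z
    have h := norm_step_pow_four_le hG.mu_pos hG.L_pos hγ hγL (G z x₀)
      (hG.lipschitz z x x₀) (hG.cocoercive z x x₀)
    rwa [sub_add_cancel, sub_right_comm] at h
  have i1 := hint.const_mul (7 / 4 * γ * ‖x - x₀‖ ^ 2)
  have i2 := hint0.const_mul (4 * γ * ‖x - x₀‖ ^ 2)
  have i3 := hG.moment.const_mul (driftConst μ L * γ ^ 3)
  have i0 : Integrable (fun _ : Z => (1 + γ * (μ / 2)) * ‖x - x₀‖ ^ 4) ξ := integrable_const _
  have hleft : Integrable (fun z => ‖x - γ • G z x - x₀‖ ^ 4) ξ :=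
    (((i0.sub i1).sub i2).add i3).mono' hm.aestronglyMeasurable
      (ae_of_all _ fun z => by rw [Real.norm_of_nonneg (by positivity)]; exact hpt z)
  refine ⟨hleft, ?_⟩
  have hI := integral_mono hleft (((i0.sub i1).sub i2).add i3) hpt
  have e1 : ∫ z, inner ℝ (x - x₀) (G z x - G z x₀) ∂ξ = inner ℝ (x - x₀) (g x - g x₀) := by
    rw [integral_inner (hG.integrable_sub x x₀), hG.integral_sub_eq]
  have e2 : ∫ z, inner ℝ (x - x₀) (G z x₀) ∂ξ = 0 := by
    rw [integral_inner (hG.integrable x₀), hG.integral_eq, hG.critical, inner_zero_right]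
  rw [integral_add' ((i0.sub i1).sub i2) i3, integral_sub' (i0.sub i1) i2, integral_sub' i0 i1,
    integral_const_mul (7 / 4 * γ * ‖x - x₀‖ ^ 2), integral_const_mul (4 * γ * ‖x - x₀‖ ^ 2),
    integral_const_mul (driftConst μ L * γ ^ 3), e1, e2] at hI
  simp only [integral_const, probReal_univ, one_smul, mul_zero, sub_zero] at hI
  have hmono := mul_le_mul_of_nonneg_left (hG.strongMono x x₀)
    (by positivity : 0 ≤ 7 / 4 * γ * ‖x - x₀‖ ^ 2)
  -- Strong monotonicity gains `7/4 γμ` and the Young terms lose `1/2 γμ`; of the remaining `5/4 γμ`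
  -- only `γμ` is kept.
  have hpos : 0 ≤ γ * μ * ‖x - x₀‖ ^ 4 := by have := hG.mu_pos; positivity
  refine hI.trans ?_
  have : driftConst μ L * γ ^ 3 * ∫ z, ‖G z x₀‖ ^ 4 ∂ξ
      = driftConst μ L * noiseMoment G ξ x₀ * γ ^ 3 := by unfold noiseMoment; ring
  rw [this]
  nlinarith

end IsGradientOracle

end Oracle

/-! ### Outer products and covariances of independent sums. -/

section Outer

variable {E : Type*} [NormedAddCommGroup E] [InnerProductSpace ℝ E]

/-- The outer product `u ⊗ v`, as a continuous bilinear map. -/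
noncomputable def outerL (E : Type*) [NormedAddCommGroup E] [InnerProductSpace ℝ E] :
    E →L[ℝ] E →L[ℝ] E →L[ℝ] E :=
  LinearMap.mkContinuous₂
    (LinearMap.mk₂ ℝ (fun u v : E => (InnerProductSpace.rankOne ℝ u v : E →L[ℝ] E))
      (fun u u' v => by simp) (fun c u v => by simp) (fun u v v' => by simp)
      (fun c u v => by simp)) 1 (fun u v => by simp)

theorem outerL_eq_rankOne (u v : E) : outerL E u v = InnerProductSpace.rankOne ℝ u v := rfl

@[simp] theorem outerL_apply (u v w : E) : outerL E u v w = (inner ℝ v w : ℝ) • u := by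
  rw [outerL_eq_rankOne, InnerProductSpace.rankOne_apply]

@[simp] theorem norm_outerL (u v : E) : ‖outerL E u v‖ = ‖u‖ * ‖v‖ := by
  rw [outerL_eq_rankOne, InnerProductSpace.norm_rankOne]

theorem norm_outer_sub_le (u v : E) :
    ‖outerL E u u - outerL E v v‖ ≤ ‖u - v‖ * (2 * ‖v‖ + ‖u - v‖) := by
  have h : outerL E u u - outerL E v v
      = outerL E (u - v) (u - v) + outerL E (u - v) v + outerL E v (u - v) := by
    simp only [map_sub, sub_apply]; abel
  rw [h]
  calc _ ≤ ‖outerL E (u - v) (u - v)‖ + ‖outerL E (u - v) v‖ + ‖outerL E v (u - v)‖ :=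
        norm_add₃_le
    _ = _ := by simp only [norm_outerL]; ring

end Outer

section Independent

variable {E Z ι : Type*} [NormedAddCommGroup E] [InnerProductSpace ℝ E] [CompleteSpace E]
  [MeasurableSpace Z] [Fintype ι] {ξ : Measure Z} [IsProbabilityMeasure ξ]

theorem integrable_outer {α : Type*} [MeasurableSpace α] {ρ : Measure α} {X Y : α → E}
    (hX : MemLp X 2 ρ) (hY : MemLp Y 2 ρ) : Integrable (fun a => outerL E (X a) (Y a)) ρ := by
  have h : Integrable (fun a => ‖X a‖ * ‖Y a‖) ρ := hX.norm.integrable_mul hY.norm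
  have hm : AEStronglyMeasurable (fun a => outerL E (X a) (Y a)) ρ :=
    (outerL E).aestronglyMeasurable_comp₂ hX.aestronglyMeasurable hY.aestronglyMeasurable
  exact h.mono' hm (ae_of_all _ fun a => (norm_outerL _ _).le)

/-- Cross terms vanish by independence and centering. With weights `1/N` this produces the factor
`1/N` of the leading terms. -/
theorem integral_outer_pi {X : ι → Z → E} (hX : ∀ c, MemLp (X c) 2 ξ)
    (h0 : ∀ c, ∫ z, X c z ∂ξ = 0) :
    ∫ z : ι → Z, outerL E (∑ c, X c (z c)) (∑ c, X c (z c)) ∂(Measure.pi fun _ => ξ)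
      = ∑ c, ∫ z, outerL E (X c z) (X c z) ∂ξ := by
  classical
  have hmp : ∀ c : ι, MeasurePreserving (Function.eval c) (Measure.pi fun _ : ι => ξ) ξ :=
    fun c => measurePreserving_eval (fun _ : ι => ξ) c
  have hL : ∀ c, MemLp (fun z : ι → Z => X c (z c)) 2 (Measure.pi fun _ => ξ) :=
    fun c => (hX c).comp_measurePreserving (hmp c)
  have hind : iIndepFun (fun (c : ι) (z : ι → Z) => z c) (Measure.pi fun _ : ι => ξ) :=
    iIndepFun_pi (X := fun (_ : ι) (z : Z) => z) fun _ => aemeasurable_id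
  have hmap : ∀ c, (Measure.pi fun _ : ι => ξ).map (fun z : ι → Z => z c) = ξ :=
    fun c => (hmp c).map_eq
  have hpair : ∀ c c', ∫ z : ι → Z, outerL E (X c (z c)) (X c' (z c')) ∂(Measure.pi fun _ => ξ)
      = if c = c' then ∫ z, outerL E (X c z) (X c z) ∂ξ else 0 := by
    intro c c'
    split_ifs with h
    · subst h
      have hm : AEStronglyMeasurable (fun z => outerL E (X c z) (X c z))
          ((Measure.pi fun _ : ι => ξ).map (fun z : ι → Z => z c)) := by
        rw [hmap]; exact (integrable_outer (hX c) (hX c)).aestronglyMeasurable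
      conv_rhs => rw [← hmap c, integral_map (measurable_pi_apply c).aemeasurable hm]
    · have hi := (hind.indepFun h).integral_bilin_comp_comp (f := X c) (g := X c')
        (measurable_pi_apply c).aemeasurable (measurable_pi_apply c').aemeasurable
        (by rw [hmap]; exact (hX c).integrable (by norm_num))
        (by rw [hmap]; exact (hX c').integrable (by norm_num)) (outerL E)
      rw [hi]
      have : ∫ z : ι → Z, X c (z c) ∂(Measure.pi fun _ => ξ) = 0 := by
        rw [← h0 c]
        conv_rhs => rw [← hmap c, integral_map (measurable_pi_apply c).aemeasurable
          (by rw [hmap]; exact (hX c).aestronglyMeasurable)]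
      rw [this]; simp
  simp only [map_sum, sum_apply]
  rw [integral_finsetSum _ fun c _ => integrable_finsetSum _ fun c' _ => integrable_outer (hL c') (hL c)]
  simp_rw [integral_finsetSum _ fun c' _ => integrable_outer (hL c') (hL _), hpair]
  simp

end Independent

/-! ### One parallel local step acting on the joint law of the clients. -/

section StepLaw

variable {Z E ι : Type*} [MeasurableSpace Z] [NormedAddCommGroup E] [InnerProductSpace ℝ E]
  [MeasurableSpace E]

/-- One local step of all clients in parallel. -/
def parallelStep (G : Z → E → E) (γ : ℝ) (x : ι → E) (z : ι → Z) : ι → E :=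
  fun c => x c - γ • G (z c) (x c)

theorem IsGradientOracle.measurable_parallelStep [BorelSpace E]
    [SecondCountableTopology E] {G : Z → E → E} {g : E → E} {ξ : Measure Z} {x₀ : E} {μ L : ℝ}
    (hG : IsGradientOracle G g ξ x₀ μ L) (γ : ℝ) :
    Measurable fun p : (ι → E) × (ι → Z) => parallelStep G γ p.1 p.2 := by
  refine measurable_pi_iff.2 fun c => ?_
  have h1 : Measurable fun p : (ι → E) × (ι → Z) => p.1 c := by fun_prop
  have h2 : Measurable fun p : (ι → E) × (ι → Z) => p.2 c := by fun_prop
  exact h1.sub ((hG.measurable.comp (h2.prodMk h1)).const_smul γ)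

variable [Fintype ι]

/-- The law of the clients' iterates after one local step with independent noise. -/
noncomputable def stepLaw (G : Z → E → E) (ξ : Measure Z) (γ : ℝ) (ν : Measure (ι → E)) :
    Measure (ι → E) :=
  (ν.prod (Measure.pi fun _ : ι => ξ)).map fun p => parallelStep G γ p.1 p.2

/-- The weighted deviation of the clients from `x₀`. -/
def deviation (w : ι → ℝ) (x₀ : E) (x : ι → E) : E := ∑ c, w c • (x c - x₀)

namespace IsGradientOracle

variable {G : Z → E → E} {g : E → E} {ξ : Measure Z} {x₀ : E} {μ L γ : ℝ}
  [BorelSpace E] [SecondCountableTopology E]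

variable [IsProbabilityMeasure ξ] {ν : Measure (ι → E)} [IsProbabilityMeasure ν]

theorem isProbabilityMeasure_stepLaw (hG : IsGradientOracle G g ξ x₀ μ L) :
    IsProbabilityMeasure (stepLaw G ξ γ ν) :=
  Measure.isProbabilityMeasure_map (hG.measurable_parallelStep γ).aemeasurable

variable [CompleteSpace E]

theorem lintegral_stepLaw_le (hG : IsGradientOracle G g ξ x₀ μ L) (hγ : 0 ≤ γ)
    (hγL : γ * L ≤ 1 / 8) (c : ι) :
    ∫⁻ x, ENNReal.ofReal (‖x c - x₀‖ ^ 4) ∂(stepLaw G ξ γ ν)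
      ≤ ENNReal.ofReal (1 - γ * μ) * ∫⁻ x, ENNReal.ofReal (‖x c - x₀‖ ^ 4) ∂ν
        + ENNReal.ofReal (driftConst μ L * noiseMoment G ξ x₀ * γ ^ 3) := by
  have hm : Measurable fun x : ι → E => ENNReal.ofReal (‖x c - x₀‖ ^ 4) := by fun_prop
  have hγμ : 0 ≤ 1 - γ * μ := by
    have := mul_le_mul_of_nonneg_left hG.mu_le hγ
    linarith
  rw [stepLaw, lintegral_map hm (hG.measurable_parallelStep γ),
    ← lintegral_const_mul _ hm]
  calc _ = ∫⁻ x : ι → E, ∫⁻ z : ι → Z, ENNReal.ofReal (‖parallelStep G γ x z c - x₀‖ ^ 4)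
          ∂(Measure.pi fun _ => ξ) ∂ν :=
        lintegral_prod _ (hm.comp (hG.measurable_parallelStep γ)).aemeasurable
    _ ≤ ∫⁻ x : ι → E, (ENNReal.ofReal (1 - γ * μ) * ENNReal.ofReal (‖x c - x₀‖ ^ 4)
        + ENNReal.ofReal (driftConst μ L * noiseMoment G ξ x₀ * γ ^ 3)) ∂ν := by
        refine lintegral_mono fun x => ?_
        obtain ⟨hint, hle⟩ := hG.integral_norm_step_pow_four_le hγ hγL (x c)
        have hmz : Measurable fun z : Z => ENNReal.ofReal (‖x c - γ • G z (x c) - x₀‖ ^ 4) :=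
          ((((measurable_const.sub ((hG.measurable_apply (x c)).const_smul γ)).sub
            measurable_const).norm).pow_const 4).ennreal_ofReal
        have h1 := (measurePreserving_eval (fun _ : ι => ξ) c).lintegral_comp hmz
        calc _ = ∫⁻ z, ENNReal.ofReal (‖x c - γ • G z (x c) - x₀‖ ^ 4) ∂ξ := h1
          _ = ENNReal.ofReal (∫ z, ‖x c - γ • G z (x c) - x₀‖ ^ 4 ∂ξ) :=
              (ofReal_integral_eq_lintegral_ofReal hint
                (ae_of_all _ fun z => by positivity)).symm
          _ ≤ ENNReal.ofReal ((1 - γ * μ) * ‖x c - x₀‖ ^ 4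
                + driftConst μ L * noiseMoment G ξ x₀ * γ ^ 3) := ENNReal.ofReal_le_ofReal hle
          _ ≤ _ := by
              rw [← ENNReal.ofReal_mul hγμ]
              exact ENNReal.ofReal_add_le
    _ = _ := by rw [lintegral_add_right _ measurable_const]; simp

end IsGradientOracle

/-- Every client's deviation from `x₀` has fourth moment at most `M`. -/
def FourthMomentLE (ν : Measure (ι → E)) (x₀ : E) (M : ℝ) : Prop :=
  ∀ c, ∫⁻ x, ENNReal.ofReal (‖x c - x₀‖ ^ 4) ∂ν ≤ ENNReal.ofReal M

namespace FourthMomentLE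

variable {ν : Measure (ι → E)} {x₀ : E} {M : ℝ} [BorelSpace E] [SecondCountableTopology E]

theorem integrable (h : FourthMomentLE ν x₀ M) (c : ι) :
    Integrable (fun x : ι → E => ‖x c - x₀‖ ^ 4) ν := by
  refine ⟨(by fun_prop : Measurable _).aestronglyMeasurable, ?_⟩
  rw [hasFiniteIntegral_iff_ofReal (ae_of_all _ fun x => by positivity)]
  exact (h c).trans_lt ENNReal.ofReal_lt_top

theorem integral_le (h : FourthMomentLE ν x₀ M) (hM : 0 ≤ M) (c : ι) :
    ∫ x, ‖x c - x₀‖ ^ 4 ∂ν ≤ M := by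
  rw [integral_eq_lintegral_of_nonneg_ae (ae_of_all _ fun x => by positivity)
    (h.integrable c).aestronglyMeasurable]
  exact ENNReal.toReal_le_of_le_ofReal hM (h c)

theorem memLp (h : FourthMomentLE ν x₀ M) (c : ι) :
    MemLp (fun x : ι → E => x c - x₀) 4 ν := by
  rw [← integrable_norm_rpow_iff (by fun_prop : Measurable _).aestronglyMeasurable
    (by norm_num) (by norm_num)]
  refine (h.integrable c).congr (ae_of_all _ fun z => ?_)
  simp only
  rw [← Real.rpow_natCast]
  norm_num

theorem memLp_deviation [IsFiniteMeasure ν] (h : FourthMomentLE ν x₀ M) (w : ι → ℝ) :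
    MemLp (deviation w x₀) 2 ν := by
  have : deviation w x₀ = fun x : ι → E => ∑ c, w c • (x c - x₀) := rfl
  rw [this]
  exact memLp_finsetSum _ fun c _ => ((h.memLp c).mono_exponent (by norm_num)).const_smul (w c)

end FourthMomentLE

end StepLaw

/-! ### Conditional mean and second moment of the weighted deviation after one step. -/

section StepExpansion

variable {Z E ι : Type*} [MeasurableSpace Z] [NormedAddCommGroup E] [InnerProductSpace ℝ E]

theorem integral_outer_const_add [CompleteSpace E] {α : Type*} [MeasurableSpace α] {ρ : Measure α}
    [IsProbabilityMeasure ρ] (p : E) {n : α → E} (hn : MemLp n 2 ρ) (h0 : ∫ a, n a ∂ρ = 0) :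
    ∫ a, outerL E (p + n a) (p + n a) ∂ρ = outerL E p p + ∫ a, outerL E (n a) (n a) ∂ρ := by
  have hI : Integrable n ρ := hn.integrable (by norm_num)
  have i0 : Integrable (fun _ : α => outerL E p p) ρ := integrable_const _
  have i1 : Integrable (fun a => outerL E p (n a)) ρ := (outerL E p).integrable_comp hI
  have i2 : Integrable (fun a => outerL E (n a) p) ρ := ((outerL E).flip p).integrable_comp hI
  have e1 : ∫ a, outerL E p (n a) ∂ρ = 0 := by
    rw [(outerL E p).integral_comp_comm hI, h0, map_zero]
  have e2 : ∫ a, outerL E (n a) p ∂ρ = 0 := by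
    have := ((outerL E).flip p).integral_comp_comm hI
    rw [h0, map_zero] at this
    exact this
  have hexp : ∀ a, outerL E (p + n a) (p + n a)
      = outerL E p p + outerL E p (n a) + outerL E (n a) p + outerL E (n a) (n a) := by
    intro a
    simp only [map_add, add_apply]
    abel
  simp_rw [hexp]
  rw [integral_add ((i0.fun_add i1).fun_add i2) (integrable_outer hn hn),
    integral_add (i0.fun_add i1) i2, integral_add i0 i1, e1, e2]
  simp

/-- The covariance of the stochastic gradient at `y`. -/
noncomputable def covAt (G : Z → E → E) (g : E → E) (ξ : Measure Z) (y : E) : E →L[ℝ] E :=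
  ∫ z, outerL E (G z y - g y) (G z y - g y) ∂ξ

variable [Fintype ι]

/-- The second moment matrix of the weighted deviation. -/
noncomputable def covDev [MeasurableSpace E] (w : ι → ℝ) (x₀ : E) (ν : Measure (ι → E)) :
    E →L[ℝ] E :=
  ∫ x, outerL E (deviation w x₀ x) (deviation w x₀ x) ∂ν

/-- The mean of the weighted deviation. -/
noncomputable def meanDev [MeasurableSpace E] (w : ι → ℝ) (x₀ : E) (ν : Measure (ι → E)) : E :=
  ∫ x, deviation w x₀ x ∂ν

/-- The deviation after one step along the mean field. -/
noncomputable def driftedDev (g : E → E) (γ : ℝ) (w : ι → ℝ) (x₀ : E) (x : ι → E) : E :=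
  deviation w x₀ x - γ • ∑ c, w c • g (x c)

theorem deviation_parallelStep (G : Z → E → E) (g : E → E) (γ : ℝ) (w : ι → ℝ) (x₀ : E)
    (x : ι → E) (z : ι → Z) :
    deviation w x₀ (parallelStep G γ x z)
      = driftedDev g γ w x₀ x + ∑ c, (-(γ * w c)) • (G (z c) (x c) - g (x c)) := by
  simp only [deviation, driftedDev, parallelStep, Finset.smul_sum, ← Finset.sum_sub_distrib,
    ← Finset.sum_add_distrib]
  refine Finset.sum_congr rfl fun c _ => ?_
  module

namespace IsGradientOracle

variable [MeasurableSpace E] {G : Z → E → E} {g : E → E} {ξ : Measure Z} {x₀ : E} {μ L γ : ℝ}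
  [BorelSpace E] [SecondCountableTopology E] [IsProbabilityMeasure ξ]

theorem memLp_apply (hG : IsGradientOracle G g ξ x₀ μ L) (y : E) :
    MemLp (fun z => G z y) 4 ξ := by
  have h : MemLp (fun z => G z y - G z x₀) 4 ξ :=
    MemLp.of_bound ((hG.measurable_apply y).sub (hG.measurable_apply x₀)).aestronglyMeasurable
      (L * ‖y - x₀‖) (ae_of_all _ fun z => hG.lipschitz z y x₀)
  exact (h.add hG.memLp).ae_eq (ae_of_all _ fun z => by simp)

theorem memLp_noise (hG : IsGradientOracle G g ξ x₀ μ L) (y : E) :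
    MemLp (fun z => G z y - g y) 2 ξ :=
  ((hG.memLp_apply y).mono_exponent (by norm_num)).sub (memLp_const _)

variable [CompleteSpace E]

theorem integral_noise (hG : IsGradientOracle G g ξ x₀ μ L) (y : E) :
    ∫ z, (G z y - g y) ∂ξ = 0 := by
  rw [integral_sub (hG.integrable y) (integrable_const _), hG.integral_eq]
  simp

/-- The Lipschitz constant of the noise covariance at the critical point. -/
noncomputable def covLip (G : Z → E → E) (ξ : Measure Z) (x₀ : E) (L : ℝ) : ℝ :=
  4 * L * ∫ z, ‖G z x₀‖ ∂ξ + 4 * L ^ 2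

theorem covLip_nonneg (hL : 0 ≤ L) : 0 ≤ covLip G ξ x₀ L := by
  have : 0 ≤ ∫ z, ‖G z x₀‖ ∂ξ := integral_nonneg fun _ => norm_nonneg _
  unfold covLip; positivity

theorem norm_covAt_sub_le (hG : IsGradientOracle G g ξ x₀ μ L) (y : E) :
    ‖covAt G g ξ y - covAt G g ξ x₀‖ ≤ covLip G ξ x₀ L * (‖y - x₀‖ + ‖y - x₀‖ ^ 2) := by
  set r := ‖y - x₀‖
  have hr : 0 ≤ r := norm_nonneg _
  have hL := hG.L_pos.le
  have hint : Integrable (fun z => ‖G z x₀‖) ξ := (hG.integrable x₀).norm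
  rw [covAt, covAt, ← integral_sub (integrable_outer (hG.memLp_noise y) (hG.memLp_noise y))
    (integrable_outer (hG.memLp_noise x₀) (hG.memLp_noise x₀))]
  have hpt : ∀ z, ‖outerL E (G z y - g y) (G z y - g y)
      - outerL E (G z x₀ - g x₀) (G z x₀ - g x₀)‖ ≤ 4 * L * r * ‖G z x₀‖ + 4 * L ^ 2 * r ^ 2 := by
    intro z
    refine (norm_outer_sub_le _ _).trans ?_
    have h1 : ‖G z y - g y - (G z x₀ - g x₀)‖ ≤ 2 * L * r := by
      calc _ = ‖(G z y - G z x₀) - (g y - g x₀)‖ := by congr 1; abel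
        _ ≤ ‖G z y - G z x₀‖ + ‖g y - g x₀‖ := norm_sub_le _ _
        _ ≤ L * r + L * r := add_le_add (hG.lipschitz z y x₀) (hG.norm_field_sub_le y x₀)
        _ = _ := by ring
    have h2 : G z x₀ - g x₀ = G z x₀ := by rw [hG.critical, sub_zero]
    rw [h2] at h1 ⊢
    calc _ ≤ 2 * L * r * (2 * ‖G z x₀‖ + 2 * L * r) := by gcongr
      _ = _ := by ring
  refine (norm_integral_le_of_norm_le ((hint.const_mul _).add (integrable_const _))
    (ae_of_all _ hpt)).trans ?_
  rw [integral_add' (hint.const_mul _) (integrable_const _), integral_const_mul]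
  simp only [integral_const, probReal_univ, one_smul]
  have h0 : 0 ≤ ∫ z, ‖G z x₀‖ ∂ξ := integral_nonneg fun _ => norm_nonneg _
  unfold covLip
  have h3 : 0 ≤ 4 * L * (∫ z, ‖G z x₀‖ ∂ξ) * r ^ 2 := by positivity
  have h4 : 0 ≤ 4 * L ^ 2 * r := by positivity
  nlinarith

variable {ν : Measure (ι → E)} [IsProbabilityMeasure ν]

theorem integral_stepLaw {F : Type*} [NormedAddCommGroup F] [NormedSpace ℝ F]
    (hG : IsGradientOracle G g ξ x₀ μ L) {Ψ : (ι → E) → F}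
    (hΨ : Integrable Ψ (stepLaw G ξ γ ν)) :
    Integrable (fun x => ∫ z, Ψ (parallelStep G γ x z) ∂(Measure.pi fun _ => ξ)) ν ∧
    ∫ x, Ψ x ∂(stepLaw G ξ γ ν)
      = ∫ x, ∫ z, Ψ (parallelStep G γ x z) ∂(Measure.pi fun _ => ξ) ∂ν := by
  have hm := (hG.measurable_parallelStep (ι := ι) γ).aemeasurable
    (μ := ν.prod (Measure.pi fun _ : ι => ξ))
  have hint : Integrable (fun p : (ι → E) × (ι → Z) => Ψ (parallelStep G γ p.1 p.2))
      (ν.prod (Measure.pi fun _ : ι => ξ)) := hΨ.comp_aemeasurable hm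
  refine ⟨hint.integral_prod_left, ?_⟩
  rw [stepLaw, integral_map hm hΨ.aestronglyMeasurable]
  exact integral_prod _ hint

theorem memLp_noise_pi (hG : IsGradientOracle G g ξ x₀ μ L) (y : E) (a : ℝ) (c : ι) :
    MemLp (fun z : ι → Z => a • (G (z c) y - g y)) 2 (Measure.pi fun _ => ξ) :=
  ((hG.memLp_noise y).const_smul a).comp_measurePreserving
    (measurePreserving_eval (fun _ : ι => ξ) c)

theorem integral_noise_pi (hG : IsGradientOracle G g ξ x₀ μ L) (y : E) (a : ℝ) (c : ι) :
    ∫ z : ι → Z, a • (G (z c) y - g y) ∂(Measure.pi fun _ => ξ) = 0 := by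
  have hm : AEStronglyMeasurable (fun z => a • (G z y - g y))
      ((Measure.pi fun _ : ι => ξ).map (Function.eval c)) := by
    rw [(measurePreserving_eval (fun _ : ι => ξ) c).map_eq]
    exact ((hG.memLp_noise y).const_smul a).aestronglyMeasurable
  have hev : Measurable (Function.eval c : (ι → Z) → Z) := measurable_pi_apply c
  have h := integral_map hev.aemeasurable hm
  rw [(measurePreserving_eval (fun _ : ι => ξ) c).map_eq, integral_smul, hG.integral_noise,
    smul_zero] at h
  exact h.symm

theorem integral_deviation_step (hG : IsGradientOracle G g ξ x₀ μ L) (w : ι → ℝ) (x : ι → E) :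
    ∫ z, deviation w x₀ (parallelStep G γ x z) ∂(Measure.pi fun _ => ξ)
      = driftedDev g γ w x₀ x := by
  have hi : ∀ c : ι, Integrable (fun z : ι → Z => (-(γ * w c)) • (G (z c) (x c) - g (x c)))
      (Measure.pi fun _ => ξ) := fun c => (hG.memLp_noise_pi _ _ c).integrable (by norm_num)
  simp_rw [deviation_parallelStep G g]
  rw [integral_add (integrable_const _) (integrable_finsetSum _ fun c _ => hi c),
    integral_finsetSum _ fun c _ => hi c]
  simp_rw [hG.integral_noise_pi]
  simp

/-- Given the current iterates, the new deviation is a deterministic drifted part plus independent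
centered noises, so only the drift and the individual noise covariances survive. -/
theorem integral_outer_deviation_step (hG : IsGradientOracle G g ξ x₀ μ L) (w : ι → ℝ)
    (x : ι → E) :
    ∫ z, outerL E (deviation w x₀ (parallelStep G γ x z)) (deviation w x₀ (parallelStep G γ x z))
        ∂(Measure.pi fun _ => ξ)
      = outerL E (driftedDev g γ w x₀ x) (driftedDev g γ w x₀ x)
        + ∑ c, (γ ^ 2 * w c ^ 2) • covAt G g ξ (x c) := by
  set p := driftedDev g γ w x₀ x
  set X : ι → Z → E := fun c z => (-(γ * w c)) • (G z (x c) - g (x c)) with hX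
  have hXL : ∀ c, MemLp (X c) 2 ξ := fun c => (hG.memLp_noise (x c)).const_smul _
  have hX0 : ∀ c, ∫ z, X c z ∂ξ = 0 := fun c => by
    simp only [hX]; rw [integral_smul, hG.integral_noise, smul_zero]
  have hnL : MemLp (fun z : ι → Z => ∑ c, X c (z c)) 2 (Measure.pi fun _ => ξ) :=
    memLp_finsetSum _ fun c _ => hG.memLp_noise_pi _ _ c
  have hn0 : ∫ z : ι → Z, ∑ c, X c (z c) ∂(Measure.pi fun _ => ξ) = 0 := by
    rw [integral_finsetSum _ fun c _ => (hG.memLp_noise_pi _ _ c).integrable (by norm_num)]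
    exact Finset.sum_eq_zero fun c _ => hG.integral_noise_pi _ _ c
  have e3 : ∀ c, ∫ z, outerL E (X c z) (X c z) ∂ξ = (γ ^ 2 * w c ^ 2) • covAt G g ξ (x c) := by
    intro c
    rw [covAt, ← integral_smul]
    refine integral_congr_ae (ae_of_all _ fun z => ?_)
    simp only [hX, map_smul, smul_apply, smul_smul]
    congr 1; ring
  simp_rw [deviation_parallelStep G g]
  rw [integral_outer_const_add p hnL hn0, integral_outer_pi hXL hX0]
  simp_rw [e3]

end IsGradientOracle

end StepExpansion

/-- `b`, `a`, `P` play the roles of first, second and fourth powers of a deviation of typical size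
`s`. Each bound is affine in `P`, and it has the expected order in `s` once `P` averages to `O(s ^
4)`. Thus the fourth moment controls every error term. -/
theorem moment_interpolation {s a b P : ℝ} (hs : 0 < s) (hba : b ^ 2 ≤ a) (haP : a ^ 2 ≤ P) :
    a ≤ s ^ 2 + P / s ^ 2 ∧ b * a ≤ s ^ 3 + P / s ∧ b ≤ 2 * s + P / s ^ 3 := by
  have h1 : a ≤ s ^ 2 + P / s ^ 2 := by
    have h : a ≤ s ^ 2 + a ^ 2 / s ^ 2 := by
      have e : s ^ 2 + a ^ 2 / s ^ 2 - a = ((a / s - s / 2) ^ 2 + 3 / 4 * s ^ 2) := by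
        field_simp; ring
      have : 0 ≤ (a / s - s / 2) ^ 2 + 3 / 4 * s ^ 2 := by positivity
      linarith
    exact h.trans (by gcongr)
  have h1s : s * a ≤ s ^ 3 + P / s := by
    calc s * a ≤ s * (s ^ 2 + P / s ^ 2) := by gcongr
      _ = _ := by field_simp
  have hP : 0 ≤ P := (sq_nonneg a).trans haP
  refine ⟨h1, ?_, ?_⟩
  · have h2 : b * a ≤ s * b ^ 2 / 2 + a ^ 2 / s / 2 := by
      have e : s * b ^ 2 / 2 + a ^ 2 / s / 2 - b * a = (s * b - a) ^ 2 / (2 * s) := by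
        field_simp; ring
      have : 0 ≤ (s * b - a) ^ 2 / (2 * s) := by positivity
      linarith
    have h3 : s * b ^ 2 ≤ s * a := by gcongr
    have h4 : a ^ 2 / s ≤ P / s := by gcongr
    have h5 : 0 < s ^ 3 := by positivity
    linarith
  · have h2 : b ≤ s + b ^ 2 / s := by
      have e : s + b ^ 2 / s - b = ((b - s / 2) ^ 2 + 3 / 4 * s ^ 2) / s := by
        field_simp; ring
      have : 0 ≤ ((b - s / 2) ^ 2 + 3 / 4 * s ^ 2) / s := by positivity
      linarith
    have h3 : b ^ 2 / s ≤ (s ^ 2 + P / s ^ 2) / s := by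
      gcongr; exact hba.trans h1
    have h4 : (s ^ 2 + P / s ^ 2) / s = s + P / s ^ 3 := by field_simp
    linarith

theorem integral_weighted_sum {α ι F : Type*} [MeasurableSpace α] {ρ : Measure α} [Fintype ι]
    [NormedAddCommGroup F] [NormedSpace ℝ F] {f : ι → α → F} (hf : ∀ c, Integrable (f c) ρ)
    (w : ι → ℝ) : Integrable (fun a => ∑ c, w c • f c a) ρ ∧
      ∫ a, ∑ c, w c • f c a ∂ρ = ∑ c, w c • ∫ a, f c a ∂ρ := by
  have h : ∀ c, Integrable (fun a => w c • f c a) ρ := fun c => (hf c).smul (w c)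
  refine ⟨integrable_finsetSum _ fun c _ => h c, ?_⟩
  rw [integral_finsetSum _ fun c _ => h c]
  exact Finset.sum_congr rfl fun c _ => integral_smul _ _

theorem norm_sum_weights_le {ι F : Type*} [Fintype ι] [NormedAddCommGroup F]
    [NormedSpace ℝ F] {w : ι → ℝ} (hw : ∀ c, 0 ≤ w c) {v : ι → F} {b : ι → ℝ}
    (h : ∀ c, ‖v c‖ ≤ b c) : ‖∑ c, w c • v c‖ ≤ ∑ c, w c * b c := by
  refine norm_sum_le_of_le _ fun c _ => ?_
  rw [norm_smul, Real.norm_of_nonneg (hw c)]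
  exact mul_le_mul_of_nonneg_left (h c) (hw c)

/-! ### Taylor expansion of the field and weighted moments of the deviations. -/

section Expansion

variable {E : Type*} [NormedAddCommGroup E] [InnerProductSpace ℝ E]

/-- Taylor bounds at `x₀` for the field `g`: `A` is its derivative, `Q` (acting on outer products)
its second derivative, and `K` the Kronecker sum of `A` with itself. -/
structure HasFieldExpansion (g : E → E) (x₀ : E) (A : E →L[ℝ] E)
    (K : (E →L[ℝ] E) →L[ℝ] (E →L[ℝ] E)) (Q : (E →L[ℝ] E) →L[ℝ] E) (C₂ C₃ : ℝ) : Prop where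
  quad : ∀ y, ‖g y - A (y - x₀)‖ ≤ C₂ * ‖y - x₀‖ ^ 2
  cubic : ∀ y, ‖g y - A (y - x₀) - (1 / 2 : ℝ) • Q (outerL E (y - x₀) (y - x₀))‖
    ≤ C₃ * ‖y - x₀‖ ^ 3
  kron : ∀ u, K (outerL E u u) = outerL E (A u) u + outerL E u (A u)
  C₂_nonneg : 0 ≤ C₂
  C₃_nonneg : 0 ≤ C₃

/-- With `v` the mean drift, `K` collects the first-order change of `δ ⊗ δ` when `v` is linearized
to `A δ`. The linearization error and the term quadratic in `γ` are left over. -/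
theorem HasFieldExpansion.norm_outer_drift_le {g : E → E} {x₀ : E} {A : E →L[ℝ] E}
    {K : (E →L[ℝ] E) →L[ℝ] (E →L[ℝ] E)} {Q : (E →L[ℝ] E) →L[ℝ] E} {C₂ C₃ : ℝ}
    (h : HasFieldExpansion g x₀ A K Q C₂ C₃) {γ : ℝ} (hγ : 0 ≤ γ) (δ v : E) :
    ‖outerL E (δ - γ • v) (δ - γ • v) - outerL E δ δ + γ • K (outerL E δ δ)‖
      ≤ 2 * γ * (‖δ‖ * ‖v - A δ‖) + γ ^ 2 * ‖v‖ ^ 2 := by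
  have e : outerL E (δ - γ • v) (δ - γ • v) - outerL E δ δ + γ • K (outerL E δ δ)
      = -(γ • outerL E (v - A δ) δ) - γ • outerL E δ (v - A δ) + γ ^ 2 • outerL E v v := by
    rw [h.kron]
    simp only [map_sub, map_smul, sub_apply, smul_apply, smul_sub, smul_add, smul_smul]
    rw [← sq]
    abel
  rw [e]
  calc _ ≤ ‖-(γ • outerL E (v - A δ) δ) - γ • outerL E δ (v - A δ)‖ + ‖γ ^ 2 • outerL E v v‖ :=
        norm_add_le _ _
    _ ≤ ‖-(γ • outerL E (v - A δ) δ)‖ + ‖γ • outerL E δ (v - A δ)‖ + ‖γ ^ 2 • outerL E v v‖ := by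
        gcongr; exact norm_sub_le _ _
    _ = _ := by
        rw [norm_neg, norm_smul, norm_smul, norm_smul, norm_outerL, norm_outerL, norm_outerL,
          Real.norm_of_nonneg hγ, Real.norm_of_nonneg (by positivity)]
        ring

end Expansion

section Weights

variable {E ι : Type*} [NormedAddCommGroup E] [InnerProductSpace ℝ E] [Fintype ι]

/-- `∑ w_c ‖x_c - x₀‖ⁿ`. -/
def absDev (w : ι → ℝ) (x₀ : E) (n : ℕ) (x : ι → E) : ℝ := ∑ c, w c * ‖x c - x₀‖ ^ n

theorem norm_deviation_le {w : ι → ℝ} (hw : ∀ c, 0 ≤ w c) (x₀ : E) (x : ι → E) :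
    ‖deviation w x₀ x‖ ≤ absDev w x₀ 1 x := by
  refine (norm_sum_le _ _).trans_eq (Finset.sum_congr rfl fun c _ => ?_)
  rw [norm_smul, Real.norm_of_nonneg (hw c), pow_one]

theorem absDev_one_sq_le {w : ι → ℝ} (hw : ∀ c, 0 ≤ w c) (hw1 : ∑ c, w c = 1) (x₀ : E)
    (x : ι → E) : absDev w x₀ 1 x ^ 2 ≤ absDev w x₀ 2 x := by
  simpa [absDev] using Real.pow_arith_mean_le_arith_mean_pow Finset.univ w
    (fun c => ‖x c - x₀‖) (fun c _ => hw c) hw1 (fun c _ => norm_nonneg _) 2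

theorem absDev_two_sq_le {w : ι → ℝ} (hw : ∀ c, 0 ≤ w c) (hw1 : ∑ c, w c = 1) (x₀ : E)
    (x : ι → E) : absDev w x₀ 2 x ^ 2 ≤ absDev w x₀ 4 x := by
  have := Real.pow_arith_mean_le_arith_mean_pow Finset.univ w
    (fun c => ‖x c - x₀‖ ^ 2) (fun c _ => hw c) hw1 (fun c _ => by positivity) 2
  simpa [absDev, ← pow_mul] using this

theorem absDev_nonneg {w : ι → ℝ} (hw : ∀ c, 0 ≤ w c) (x₀ : E) (n : ℕ) (x : ι → E) :
    0 ≤ absDev w x₀ n x :=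
  Finset.sum_nonneg fun c _ => mul_nonneg (hw c) (by positivity)

theorem absDev_three_le {w : ι → ℝ} (hw : ∀ c, 0 ≤ w c) (hw1 : ∑ c, w c = 1) (x₀ : E)
    (x : ι → E) {s : ℝ} (hs : 0 < s) :
    absDev w x₀ 3 x ≤ s ^ 3 + absDev w x₀ 4 x / s := by
  have h : ∀ r : ℝ, 0 ≤ r → r ^ 3 ≤ s ^ 3 + r ^ 4 / s := by
    intro r hr
    have := (moment_interpolation (s := s) (a := r ^ 2) (b := r) (P := r ^ 4) hs le_rfl
      (by rw [← pow_mul])).2.1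
    calc r ^ 3 = r * r ^ 2 := by ring
      _ ≤ _ := this
  calc absDev w x₀ 3 x ≤ ∑ c, (w c * s ^ 3 + w c * ‖x c - x₀‖ ^ 4 / s) := by
        refine Finset.sum_le_sum fun c _ => ?_
        have := mul_le_mul_of_nonneg_left (h _ (norm_nonneg (x c - x₀))) (hw c)
        calc _ ≤ _ := this
          _ = _ := by ring
    _ = _ := by
        rw [Finset.sum_add_distrib, ← Finset.sum_mul, hw1, one_mul, ← Finset.sum_div]; rfl

end Weights

/-! ### One-step recursions for the second moment and the mean. -/

section StepEstimates

variable {Z E ι : Type*} [MeasurableSpace Z] [NormedAddCommGroup E] [InnerProductSpace ℝ E]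
  [MeasurableSpace E] [BorelSpace E] [SecondCountableTopology E] [CompleteSpace E] [Fintype ι]
  {w : ι → ℝ} {x₀ : E} {ν : Measure (ι → E)} {M : ℝ}

namespace FourthMomentLE

theorem integrable_absDev (h : FourthMomentLE ν x₀ M) (w : ι → ℝ) :
    Integrable (absDev w x₀ 4) ν :=
  integrable_finsetSum _ fun c _ => (h.integrable c).const_mul (w c)

theorem integral_absDev_le (h : FourthMomentLE ν x₀ M) (hM : 0 ≤ M) (hw : ∀ c, 0 ≤ w c)
    (hw1 : ∑ c, w c = 1) : ∫ x, absDev w x₀ 4 x ∂ν ≤ M := by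
  simp only [absDev]
  rw [integral_finsetSum _ fun c _ => (h.integrable c).const_mul (w c)]
  simp_rw [integral_const_mul]
  calc _ ≤ ∑ c, w c * M := Finset.sum_le_sum fun c _ =>
        mul_le_mul_of_nonneg_left (h.integral_le hM c) (hw c)
    _ = M := by rw [← Finset.sum_mul, hw1, one_mul]

/-- A pointwise bound that is affine in the fourth moment integrates to a bound. -/
theorem norm_integral_le [IsProbabilityMeasure ν] {F : Type*} [NormedAddCommGroup F]
    [NormedSpace ℝ F] (h : FourthMomentLE ν x₀ M) (hM : 0 ≤ M) (hw : ∀ c, 0 ≤ w c)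
    (hw1 : ∑ c, w c = 1) {Ψ : (ι → E) → F} {α β : ℝ} (hβ : 0 ≤ β)
    (hΨ : ∀ x, ‖Ψ x‖ ≤ α + β * absDev w x₀ 4 x) : ‖∫ x, Ψ x ∂ν‖ ≤ α + β * M := by
  have hi := h.integrable_absDev w
  refine (norm_integral_le_of_norm_le ((integrable_const α).fun_add (hi.const_mul β))
    (ae_of_all _ hΨ)).trans ?_
  rw [integral_add (integrable_const α) (hi.const_mul β), integral_const_mul]
  simp only [integral_const, probReal_univ, one_smul]
  gcongr
  exact h.integral_absDev_le hM hw hw1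

theorem norm_covDev_le [IsProbabilityMeasure ν] {B s : ℝ} (hB : 0 ≤ B) (hs : 0 < s)
    (h : FourthMomentLE ν x₀ (B * s ^ 4)) (hw : ∀ c, 0 ≤ w c) (hw1 : ∑ c, w c = 1) :
    ‖covDev w x₀ ν‖ ≤ (1 + B) * s ^ 2 := by
  have hb := h.norm_integral_le (by positivity) hw hw1
    (Ψ := fun x => outerL E (deviation w x₀ x) (deviation w x₀ x)) (α := s ^ 2) (β := 1 / s ^ 2)
    (by positivity) fun x => by
      rw [norm_outerL, ← sq]
      calc ‖deviation w x₀ x‖ ^ 2 ≤ absDev w x₀ 1 x ^ 2 := by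
            gcongr; exact norm_deviation_le hw x₀ x
        _ ≤ absDev w x₀ 2 x := absDev_one_sq_le hw hw1 x₀ x
        _ ≤ _ := (moment_interpolation hs (absDev_one_sq_le hw hw1 x₀ x)
            (absDev_two_sq_le hw hw1 x₀ x)).1
        _ = _ := by ring
  refine hb.trans_eq ?_
  field_simp

end FourthMomentLE

variable {G : Z → E → E} {g : E → E} {ξ : Measure Z} [IsProbabilityMeasure ξ] {μ L γ : ℝ}
  [IsProbabilityMeasure ν]
  {A : E →L[ℝ] E} {K : (E →L[ℝ] E) →L[ℝ] (E →L[ℝ] E)} {Q : (E →L[ℝ] E) →L[ℝ] E} {C₂ C₃ : ℝ}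

/-- The constant in the one-step expansion of the covariance. -/
noncomputable def covErr (B C₂ L κ S : ℝ) : ℝ :=
  (1 + B) * (2 * C₂ + L ^ 2 * S + κ * S) + κ * (2 + B)

theorem sum_field_sub_eq (A : E →L[ℝ] E) (g : E → E) (w : ι → ℝ) (x₀ : E) (x : ι → E) :
    ∑ c, w c • g (x c) - A (deviation w x₀ x) = ∑ c, w c • (g (x c) - A (x c - x₀)) := by
  rw [deviation, map_sum, ← Finset.sum_sub_distrib]
  exact Finset.sum_congr rfl fun c _ => by rw [map_smul, smul_sub]

/-- With deviations of size `s` and `γ = s ^ 2`, the errors are `γ` times a cubic Taylor term, `γ²`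
times a squared drift, and `γ²` times the variation of the noise covariance away from `x₀`; the last
is linear in the deviation. Each is `O(s ^ 5)` for bounded `s`. The weights are free, so the bound
serves both the average of the clients and a single client. -/
theorem norm_covDev_step_le (hG : IsGradientOracle G g ξ x₀ μ L)
    (hE : HasFieldExpansion g x₀ A K Q C₂ C₃) {s S B : ℝ} (hs : 0 < s) (hsS : s ≤ S)
    (hγ : γ = s ^ 2) (hB : 0 ≤ B) (hν : FourthMomentLE ν x₀ (B * s ^ 4))
    (hν' : FourthMomentLE (stepLaw G ξ γ ν) x₀ M) (hw : ∀ c, 0 ≤ w c) (hw1 : ∑ c, w c = 1) :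
    ‖covDev w x₀ (stepLaw G ξ γ ν) - (covDev w x₀ ν - γ • K (covDev w x₀ ν)
        + (γ ^ 2 * ∑ c, w c ^ 2) • covAt G g ξ x₀)‖
      ≤ covErr B C₂ L (IsGradientOracle.covLip G ξ x₀ L) S * s ^ 5 := by
  have := hG.isProbabilityMeasure_stepLaw (γ := γ) (ν := ν)
  set κ := IsGradientOracle.covLip G ξ x₀ L
  have hκ : 0 ≤ κ := IsGradientOracle.covLip_nonneg hG.L_pos.le
  have hL := hG.L_pos.le
  have hγ0 : 0 ≤ γ := by rw [hγ]; positivity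
  obtain ⟨hi, he⟩ := hG.integral_stepLaw
    (integrable_outer (hν'.memLp_deviation w) (hν'.memLp_deviation w))
  simp_rw [hG.integral_outer_deviation_step] at hi he
  have hi0 := integrable_outer (hν.memLp_deviation w) (hν.memLp_deviation w)
  have hiK : Integrable (fun x => γ • K (outerL E (deviation w x₀ x) (deviation w x₀ x))) ν :=
    (K.integrable_comp hi0).smul γ
  set D : (ι → E) → (E →L[ℝ] E) := fun x =>
    (outerL E (driftedDev g γ w x₀ x) (driftedDev g γ w x₀ x)
        + ∑ c, (γ ^ 2 * w c ^ 2) • covAt G g ξ (x c))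
      - ((outerL E (deviation w x₀ x) (deviation w x₀ x)
        - γ • K (outerL E (deviation w x₀ x) (deviation w x₀ x)))
        + (γ ^ 2 * ∑ c, w c ^ 2) • covAt G g ξ x₀) with hD
  have hint : covDev w x₀ (stepLaw G ξ γ ν) - (covDev w x₀ ν - γ • K (covDev w x₀ ν)
        + (γ ^ 2 * ∑ c, w c ^ 2) • covAt G g ξ x₀) = ∫ x, D x ∂ν := by
    have h2 : Integrable (fun x => outerL E (deviation w x₀ x) (deviation w x₀ x)
        - γ • K (outerL E (deviation w x₀ x) (deviation w x₀ x))) ν := hi0.sub hiK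
    have hc : Integrable (fun _ : ι → E => (γ ^ 2 * ∑ c, w c ^ 2) • covAt G g ξ x₀) ν :=
      integrable_const _
    rw [hD, integral_sub hi (h2.fun_add hc), integral_add h2 hc, integral_sub hi0 hiK,
      integral_smul, K.integral_comp_comm hi0, covDev, he]
    simp [covDev]
  rw [hint]
  have hD' : ∀ x, D x = (outerL E (driftedDev g γ w x₀ x) (driftedDev g γ w x₀ x)
      - outerL E (deviation w x₀ x) (deviation w x₀ x)
      + γ • K (outerL E (deviation w x₀ x) (deviation w x₀ x)))
      + γ ^ 2 • ∑ c, w c ^ 2 • (covAt G g ξ (x c) - covAt G g ξ x₀) := by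
    intro x
    simp only [hD, smul_sub, Finset.sum_sub_distrib, mul_smul, Finset.smul_sum, Finset.sum_smul]
    abel
  have hbound : ∀ x, ‖D x‖ ≤ (2 * γ * C₂ * s ^ 3 + γ ^ 2 * L ^ 2 * s ^ 2
        + γ ^ 2 * κ * (2 * s + s ^ 2))
      + (2 * γ * C₂ / s + γ ^ 2 * L ^ 2 / s ^ 2 + γ ^ 2 * κ * (1 / s ^ 3 + 1 / s ^ 2))
        * absDev w x₀ 4 x := by
    intro x
    set a := absDev w x₀ 2 x
    set b := absDev w x₀ 1 x
    set P := absDev w x₀ 4 x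
    have hba := absDev_one_sq_le hw hw1 x₀ x
    obtain ⟨h1, h2, h3⟩ := moment_interpolation hs hba (absDev_two_sq_le hw hw1 x₀ x)
    have hb0 : 0 ≤ b := absDev_nonneg hw x₀ 1 x
    have hδ := norm_deviation_le hw x₀ x
    have hρ : ‖∑ c, w c • g (x c) - A (deviation w x₀ x)‖ ≤ C₂ * a := by
      rw [sum_field_sub_eq]
      refine (norm_sum_weights_le hw fun c => hE.quad (x c)).trans_eq ?_
      simp only [a, absDev, Finset.mul_sum]
      exact Finset.sum_congr rfl fun c _ => by ring
    have hv : ‖∑ c, w c • g (x c)‖ ≤ L * b := by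
      refine (norm_sum_weights_le hw fun c => hG.norm_field_le (x c)).trans_eq ?_
      simp only [b, absDev, Finset.mul_sum]
      exact Finset.sum_congr rfl fun c _ => by ring
    have hcov : ‖∑ c, w c ^ 2 • (covAt G g ξ (x c) - covAt G g ξ x₀)‖ ≤ κ * (b + a) := by
      have hle : ∀ c, w c ≤ 1 := fun c => by
        rw [← hw1]; exact Finset.single_le_sum (fun c _ => hw c) (Finset.mem_univ c)
      calc _ ≤ ∑ c, w c * (κ * (‖x c - x₀‖ + ‖x c - x₀‖ ^ 2)) := by
            refine norm_sum_le_of_le _ fun c _ => ?_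
            rw [norm_smul, Real.norm_of_nonneg (by positivity)]
            -- Reduces the squared weights of the noise to the weights `w`, for which the moments of
            -- the deviation are controlled.
            have hw2 : w c ^ 2 ≤ w c := by nlinarith [hw c, hle c]
            exact mul_le_mul hw2 (hG.norm_covAt_sub_le (x c)) (norm_nonneg _) (hw c)
        _ = _ := by
            simp only [a, b, absDev, pow_one, Finset.mul_sum, ← Finset.sum_add_distrib]
            exact Finset.sum_congr rfl fun c _ => by ring
    rw [hD' x]
    calc _ ≤ (2 * γ * (‖deviation w x₀ x‖ * ‖∑ c, w c • g (x c) - A (deviation w x₀ x)‖)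
          + γ ^ 2 * ‖∑ c, w c • g (x c)‖ ^ 2) + γ ^ 2 * (κ * (b + a)) := by
          refine (norm_add_le _ _).trans (add_le_add (hE.norm_outer_drift_le hγ0 _ _) ?_)
          rw [norm_smul, Real.norm_of_nonneg (by positivity)]
          gcongr
      _ ≤ (2 * γ * (b * (C₂ * a)) + γ ^ 2 * (L * b) ^ 2) + γ ^ 2 * (κ * (b + a)) := by
          gcongr
      _ = 2 * γ * C₂ * (b * a) + γ ^ 2 * L ^ 2 * b ^ 2 + γ ^ 2 * κ * (b + a) := by ring
      _ ≤ 2 * γ * C₂ * (s ^ 3 + P / s) + γ ^ 2 * L ^ 2 * (s ^ 2 + P / s ^ 2)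
          + γ ^ 2 * κ * ((2 * s + P / s ^ 3) + (s ^ 2 + P / s ^ 2)) := by
          have hC := hE.C₂_nonneg
          have := hba.trans h1
          gcongr
      _ = _ := by ring
  have hC := hE.C₂_nonneg
  refine (hν.norm_integral_le (by positivity) hw hw1 (by positivity) hbound).trans ?_
  have e : 2 * γ * C₂ * s ^ 3 + γ ^ 2 * L ^ 2 * s ^ 2 + γ ^ 2 * κ * (2 * s + s ^ 2)
      + (2 * γ * C₂ / s + γ ^ 2 * L ^ 2 / s ^ 2 + γ ^ 2 * κ * (1 / s ^ 3 + 1 / s ^ 2))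
        * (B * s ^ 4)
      = ((1 + B) * (2 * C₂ + L ^ 2 * s + κ * s) + κ * (2 + B)) * s ^ 5 := by
    rw [hγ]; field_simp; ring
  rw [e]
  unfold covErr
  gcongr

/-- The weighted sum of the clients' outer products. -/
noncomputable def outerDev (w : ι → ℝ) (x₀ : E) (x : ι → E) : E →L[ℝ] E :=
  ∑ c, w c • outerL E (x c - x₀) (x c - x₀)

theorem FourthMomentLE.integrable_outer_apply (h : FourthMomentLE ν x₀ M) (c : ι) :
    Integrable (fun x : ι → E => outerL E (x c - x₀) (x c - x₀)) ν :=
  have hL : MemLp (fun x : ι → E => x c - x₀) 2 ν := (h.memLp c).mono_exponent (by norm_num)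
  integrable_outer hL hL

theorem FourthMomentLE.integrable_outerDev (h : FourthMomentLE ν x₀ M) (w : ι → ℝ) :
    Integrable (outerDev w x₀) ν :=
  (integral_weighted_sum (f := fun (c : ι) (x : ι → E) => outerL E (x c - x₀) (x c - x₀))
    h.integrable_outer_apply w).1

theorem FourthMomentLE.integral_outerDev (h : FourthMomentLE ν x₀ M) (w : ι → ℝ) :
    ∫ x, outerDev w x₀ x ∂ν = ∑ c, w c • ∫ x, outerL E (x c - x₀) (x c - x₀) ∂ν :=
  (integral_weighted_sum (f := fun (c : ι) (x : ι → E) => outerL E (x c - x₀) (x c - x₀))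
    h.integrable_outer_apply w).2

/-- Each client's gradient is expanded at its own iterate, so the quadratic term sees the average of
the clients' second moments and not the second moment of their average. -/
theorem norm_meanDev_step_le (hG : IsGradientOracle G g ξ x₀ μ L)
    (hE : HasFieldExpansion g x₀ A K Q C₂ C₃) {s B : ℝ} (hs : 0 < s)
    (hγ : γ = s ^ 2) (hB : 0 ≤ B) (hν : FourthMomentLE ν x₀ (B * s ^ 4))
    (hν' : FourthMomentLE (stepLaw G ξ γ ν) x₀ M) (hw : ∀ c, 0 ≤ w c) (hw1 : ∑ c, w c = 1) :
    ‖meanDev w x₀ (stepLaw G ξ γ ν) - (meanDev w x₀ ν - γ • A (meanDev w x₀ ν)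
        - (γ / 2) • Q (∫ x, outerDev w x₀ x ∂ν))‖
      ≤ C₃ * (1 + B) * s ^ 5 := by
  have := hG.isProbabilityMeasure_stepLaw (γ := γ) (ν := ν)
  have hγ0 : 0 ≤ γ := by rw [hγ]; positivity
  have hC := hE.C₃_nonneg
  obtain ⟨hi, he⟩ := hG.integral_stepLaw
    ((hν'.memLp_deviation w).integrable (by norm_num))
  simp_rw [hG.integral_deviation_step] at hi he
  have hi0 : Integrable (deviation w x₀) ν := (hν.memLp_deviation w).integrable (by norm_num)
  have hiA : Integrable (fun x => γ • A (deviation w x₀ x)) ν := (A.integrable_comp hi0).smul γ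
  have hiS := hν.integrable_outerDev w
  have hiQ : Integrable (fun x : ι → E => (γ / 2) • Q (outerDev w x₀ x)) ν :=
    (Q.integrable_comp hiS).smul (γ / 2)
  have hint : meanDev w x₀ (stepLaw G ξ γ ν) - (meanDev w x₀ ν - γ • A (meanDev w x₀ ν)
        - (γ / 2) • Q (∫ x, outerDev w x₀ x ∂ν))
      = ∫ x, (driftedDev g γ w x₀ x - (deviation w x₀ x - γ • A (deviation w x₀ x)
        - (γ / 2) • Q (outerDev w x₀ x))) ∂ν := by
    have h2 : Integrable (fun x => deviation w x₀ x - γ • A (deviation w x₀ x)) ν :=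
      hi0.sub hiA
    have h3 : Integrable (fun x => deviation w x₀ x - γ • A (deviation w x₀ x)
      - (γ / 2) • Q (outerDev w x₀ x)) ν := h2.sub hiQ
    rw [integral_sub hi h3, integral_sub h2 hiQ,
      integral_sub hi0 hiA, integral_smul, integral_smul, A.integral_comp_comm hi0,
      Q.integral_comp_comm hiS, meanDev, he]
    rfl
  rw [hint]
  have hbound : ∀ x, ‖driftedDev g γ w x₀ x - (deviation w x₀ x - γ • A (deviation w x₀ x)
        - (γ / 2) • Q (outerDev w x₀ x))‖
      ≤ γ * C₃ * s ^ 3 + γ * C₃ / s * absDev w x₀ 4 x := by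
    intro x
    have e : driftedDev g γ w x₀ x - (deviation w x₀ x - γ • A (deviation w x₀ x)
        - (γ / 2) • Q (outerDev w x₀ x))
        = -(γ • ∑ c, w c • (g (x c) - A (x c - x₀)
          - (1 / 2 : ℝ) • Q (outerL E (x c - x₀) (x c - x₀)))) := by
      have h1 : ∑ c, w c • (g (x c) - A (x c - x₀)
          - (1 / 2 : ℝ) • Q (outerL E (x c - x₀) (x c - x₀)))
          = (∑ c, w c • g (x c) - A (deviation w x₀ x))
            - (1 / 2 : ℝ) • Q (outerDev w x₀ x) := by
        rw [sum_field_sub_eq, outerDev, map_sum, Finset.smul_sum, ← Finset.sum_sub_distrib]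
        refine Finset.sum_congr rfl fun c _ => ?_
        rw [map_smul]
        module
      rw [h1, driftedDev]
      module
    rw [e, norm_neg, norm_smul, Real.norm_of_nonneg hγ0]
    calc _ ≤ γ * (C₃ * absDev w x₀ 3 x) := by
          gcongr
          refine (norm_sum_weights_le hw fun c => hE.cubic (x c)).trans_eq ?_
          simp only [absDev, Finset.mul_sum]
          exact Finset.sum_congr rfl fun c _ => by ring
      _ ≤ γ * (C₃ * (s ^ 3 + absDev w x₀ 4 x / s)) := by
          gcongr; exact absDev_three_le hw hw1 x₀ x hs
      _ = _ := by ring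
  refine (hν.norm_integral_le (by positivity) hw hw1 (by positivity) hbound).trans_eq ?_
  rw [hγ]; field_simp

end StepEstimates

/-- A periodic solution of a contracting affine recursion with errors is small. -/
theorem le_of_periodic_recursion {a : ℕ → ℝ} {q e : ℝ} {H : ℕ} (hH : 1 ≤ H) (hq : 0 ≤ q)
    (hq1 : q < 1) (hstep : ∀ h < H, a (h + 1) ≤ q * a h + e) (hper : a H = a 0) :
    a 0 ≤ e / (1 - q) := by
  set t := e / (1 - q) with ht
  have h1q : 0 < 1 - q := by linarith
  have hfix : q * t + e = t := by rw [ht]; field_simp; ring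
  have hiter : ∀ h ≤ H, a h - t ≤ q ^ h * (a 0 - t) := by
    intro h
    induction h with
    | zero => simp
    | succ h ih =>
      intro hh
      have h1 := hstep h (by omega)
      have h2 := mul_le_mul_of_nonneg_left (ih (by omega)) hq
      calc a (h + 1) - t ≤ q * (a h - t) := by linarith
        _ ≤ q * (q ^ h * (a 0 - t)) := h2
        _ = _ := by ring
  -- Periodicity turns this into `a 0 - t ≤ q ^ H * (a 0 - t)` with `q ^ H < 1`, so `a 0` cannot
  -- exceed the fixed point `t`. No factor of `H` is lost.
  have hH' := hiter H le_rfl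
  rw [hper] at hH'
  have hpow : q ^ H < 1 := pow_lt_one₀ hq hq1 (by omega)
  by_contra hcon
  push Not at hcon
  nlinarith

/-! ### Joint laws along a communication round and their fourth moments. -/

section ParallelLaw

variable {Z E ι : Type*} [MeasurableSpace Z] [NormedAddCommGroup E] [InnerProductSpace ℝ E]
  [MeasurableSpace E] [Fintype ι]

/-- The joint law of the clients' iterates after `h` local steps from a common `π`-distributed
point. -/
noncomputable def parallelLaw (ι : Type*) [Fintype ι] (G : Z → E → E) (ξ : Measure Z) (γ : ℝ)
    (π : Measure E) : ℕ → Measure (ι → E)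
  | 0 => π.map fun x _ => x
  | h + 1 => stepLaw G ξ γ (parallelLaw ι G ξ γ π h)

/-- The average of the clients' iterates. -/
noncomputable def average {N : ℕ} (x : Fin N → E) : E := (N : ℝ)⁻¹ • ∑ c, x c

/-- The uniform weights on the clients. -/
noncomputable def unifWeight (N : ℕ) : Fin N → ℝ := fun _ => (N : ℝ)⁻¹

theorem unifWeight_nonneg (N : ℕ) (c : Fin N) : 0 ≤ unifWeight N c := by
  unfold unifWeight; positivity

theorem sum_unifWeight {N : ℕ} (hN : 1 ≤ N) : ∑ c, unifWeight N c = 1 := by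
  have : (N : ℝ) ≠ 0 := by positivity
  simp [unifWeight, this]

theorem sum_unifWeight_sq {N : ℕ} (hN : 1 ≤ N) : ∑ c, unifWeight N c ^ 2 = (N : ℝ)⁻¹ := by
  have : (N : ℝ) ≠ 0 := by positivity
  simp only [unifWeight, Finset.sum_const, Finset.card_univ, Fintype.card_fin, nsmul_eq_mul]
  field_simp

theorem deviation_unifWeight {N : ℕ} (hN : 1 ≤ N) (x₀ : E) (x : Fin N → E) :
    deviation (unifWeight N) x₀ x = average x - x₀ := by
  have h : deviation (unifWeight N) x₀ x
      = ∑ c, unifWeight N c • x c - (∑ c, unifWeight N c) • x₀ := by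
    simp only [deviation, smul_sub, Finset.sum_sub_distrib, Finset.sum_smul]
  rw [h, sum_unifWeight hN, one_smul, average, Finset.smul_sum]
  rfl

theorem deviation_const {w : ι → ℝ} (hw1 : ∑ c, w c = 1) (x₀ x : E) :
    deviation w x₀ (fun _ => x) = x - x₀ := by
  simp only [deviation]
  rw [← Finset.sum_smul, hw1, one_smul]

/-- The weights concentrated on one client specialize the one-step recursions to that client. -/
theorem deviation_single [DecidableEq ι] (c : ι) (x₀ : E) (x : ι → E) :
    deviation (Pi.single c 1) x₀ x = x c - x₀ := by
  simp [deviation, Pi.single_apply]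

variable [BorelSpace E] [SecondCountableTopology E]

theorem measurable_average {N : ℕ} : Measurable (average : (Fin N → E) → E) := by
  unfold average
  fun_prop

theorem measurable_diagonal : Measurable fun (x : E) (_ : ι) => x :=
  measurable_pi_iff.2 fun _ => measurable_id

variable {G : Z → E → E} {g : E → E} {ξ : Measure Z} {x₀ : E} {μ L γ : ℝ} {π : Measure E}

theorem meanDev_diagonal {w : ι → ℝ} (hw1 : ∑ c, w c = 1) :
    meanDev w x₀ (π.map fun x (_ : ι) => x) = ∫ x, (x - x₀) ∂π := by
  have hm : Measurable (deviation w x₀ : (ι → E) → E) := by unfold deviation; fun_prop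
  rw [meanDev, integral_map measurable_diagonal.aemeasurable hm.aestronglyMeasurable]
  simp_rw [deviation_const hw1]

theorem covDev_diagonal {w : ι → ℝ} (hw1 : ∑ c, w c = 1) :
    covDev w x₀ (π.map fun x (_ : ι) => x) = ∫ x, outerL E (x - x₀) (x - x₀) ∂π := by
  have hm : Measurable (deviation w x₀ : (ι → E) → E) := by unfold deviation; fun_prop
  rw [covDev, integral_map measurable_diagonal.aemeasurable
    ((outerL E).aestronglyMeasurable_comp₂ hm.aestronglyMeasurable hm.aestronglyMeasurable)]
  simp_rw [deviation_const hw1]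

theorem meanDev_average {N : ℕ} (hN : 1 ≤ N) (ν : Measure (Fin N → E)) :
    meanDev (unifWeight N) x₀ ν = ∫ x, (x - x₀) ∂(ν.map average) := by
  rw [meanDev, integral_map measurable_average.aemeasurable
    (by fun_prop : Measurable fun x : E => x - x₀).aestronglyMeasurable]
  simp_rw [deviation_unifWeight hN]

theorem covDev_average {N : ℕ} (hN : 1 ≤ N) (ν : Measure (Fin N → E)) :
    covDev (unifWeight N) x₀ ν = ∫ x, outerL E (x - x₀) (x - x₀) ∂(ν.map average) := by
  have hm : Measurable fun x : E => x - x₀ := by fun_prop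
  rw [covDev, integral_map measurable_average.aemeasurable
    ((outerL E).aestronglyMeasurable_comp₂ hm.aestronglyMeasurable hm.aestronglyMeasurable)]
  simp_rw [deviation_unifWeight hN]

/-- The stationary fourth moment is at most `momentConst * γ²`. -/
noncomputable def momentConst (G : Z → E → E) (ξ : Measure Z) (x₀ : E) (μ L : ℝ) : ℝ :=
  driftConst μ L * noiseMoment G ξ x₀ / μ

theorem momentConst_nonneg (hG : IsGradientOracle G g ξ x₀ μ L) :
    0 ≤ momentConst G ξ x₀ μ L :=
  div_nonneg (mul_nonneg (driftConst_nonneg hG.mu_pos hG.L_pos) (noiseMoment_nonneg _ _ _))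
    hG.mu_pos.le

theorem IsGradientOracle.drift_fixedPoint (hG : IsGradientOracle G g ξ x₀ μ L) (hγ : 0 ≤ γ)
    (hγL : γ * L ≤ 1 / 8) :
    ENNReal.ofReal (1 - γ * μ) * ENNReal.ofReal (momentConst G ξ x₀ μ L * γ ^ 2)
      + ENNReal.ofReal (driftConst μ L * noiseMoment G ξ x₀ * γ ^ 3)
      = ENNReal.ofReal (momentConst G ξ x₀ μ L * γ ^ 2) := by
  have hγμ : 0 ≤ 1 - γ * μ := by
    have := mul_le_mul_of_nonneg_left hG.mu_le hγ
    linarith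
  have hB := momentConst_nonneg hG
  have hK := mul_nonneg (driftConst_nonneg hG.mu_pos hG.L_pos) (noiseMoment_nonneg G ξ x₀)
  have hμ := hG.mu_pos.ne'
  rw [← ENNReal.ofReal_mul hγμ, ← ENNReal.ofReal_add (by positivity) (by positivity)]
  congr 1
  unfold momentConst
  field_simp
  ring

variable [IsProbabilityMeasure ξ] [IsProbabilityMeasure π]

theorem IsGradientOracle.isProbabilityMeasure_parallelLaw (hG : IsGradientOracle G g ξ x₀ μ L)
    (h : ℕ) : IsProbabilityMeasure (parallelLaw ι G ξ γ π h) := by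
  induction h with
  | zero => exact Measure.isProbabilityMeasure_map measurable_diagonal.aemeasurable
  | succ h ih => exact hG.isProbabilityMeasure_stepLaw

variable [CompleteSpace E]

/-- The equation for `b` says that `momentConst * γ ^ 2` is a fixed point of the `h`-step drift as
well. Since `b` is chosen before `π`, the bound applies both to a stationary law and to Dirac
masses. -/
theorem IsGradientOracle.lintegral_parallelLaw_le (hG : IsGradientOracle G g ξ x₀ μ L)
    (hγ : 0 ≤ γ) (hγL : γ * L ≤ 1 / 8) (h : ℕ) : ∃ b : ENNReal,
      ENNReal.ofReal (1 - γ * μ) ^ h * ENNReal.ofReal (momentConst G ξ x₀ μ L * γ ^ 2) + b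
        = ENNReal.ofReal (momentConst G ξ x₀ μ L * γ ^ 2) ∧
      ∀ (π : Measure E) [IsProbabilityMeasure π] (c : ι),
        ∫⁻ x, ENNReal.ofReal (‖x c - x₀‖ ^ 4) ∂(parallelLaw ι G ξ γ π h)
          ≤ ENNReal.ofReal (1 - γ * μ) ^ h * ∫⁻ x, ENNReal.ofReal (‖x - x₀‖ ^ 4) ∂π + b := by
  induction h with
  | zero =>
    refine ⟨0, by simp, fun π _ c => ?_⟩
    rw [parallelLaw, lintegral_map (by fun_prop) measurable_diagonal]
    simp
  | succ h ih =>
    obtain ⟨b, hb, hle⟩ := ih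
    set a := ENNReal.ofReal (1 - γ * μ)
    set B := ENNReal.ofReal (momentConst G ξ x₀ μ L * γ ^ 2)
    set b₁ := ENNReal.ofReal (driftConst μ L * noiseMoment G ξ x₀ * γ ^ 3)
    have hfix : a * B + b₁ = B := hG.drift_fixedPoint hγ hγL
    refine ⟨a * b + b₁, ?_, fun π _ c => ?_⟩
    · calc a ^ (h + 1) * B + (a * b + b₁) = a * (a ^ h * B + b) + b₁ := by ring
        _ = B := by rw [hb, hfix]
    · have := hG.isProbabilityMeasure_parallelLaw (ι := ι) (γ := γ) (π := π) h
      refine (hG.lintegral_stepLaw_le hγ hγL c).trans ?_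
      calc _ ≤ a * (a ^ h * ∫⁻ x, ENNReal.ofReal (‖x - x₀‖ ^ 4) ∂π + b) + b₁ := by
            gcongr; exact hle π c
        _ = _ := by ring

theorem IsGradientOracle.fourthMomentLE_parallelLaw (hG : IsGradientOracle G g ξ x₀ μ L)
    (hγ : 0 ≤ γ) (hγL : γ * L ≤ 1 / 8)
    (hπ : ∫⁻ x, ENNReal.ofReal (‖x - x₀‖ ^ 4) ∂π
      ≤ ENNReal.ofReal (momentConst G ξ x₀ μ L * γ ^ 2)) (h : ℕ) :
    FourthMomentLE (parallelLaw ι G ξ γ π h) x₀ (momentConst G ξ x₀ μ L * γ ^ 2) := by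
  obtain ⟨b, hb, hle⟩ := hG.lintegral_parallelLaw_le (ι := ι) hγ hγL h
  intro c
  refine (hle π c).trans ?_
  rw [← hb]
  gcongr

/-- Jensen's inequality for the fourth power of the norm. -/
theorem lintegral_average_le {N : ℕ} (hN : 1 ≤ N) (ν : Measure (Fin N → E)) {M : ENNReal}
    (hM : ∀ c, ∫⁻ x, ENNReal.ofReal (‖x c - x₀‖ ^ 4) ∂ν ≤ M) :
    ∫⁻ x, ENNReal.ofReal (‖average x - x₀‖ ^ 4) ∂ν ≤ M := by
  have hpt : ∀ x : Fin N → E, ENNReal.ofReal (‖average x - x₀‖ ^ 4)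
      ≤ ∑ c, ENNReal.ofReal (unifWeight N c) * ENNReal.ofReal (‖x c - x₀‖ ^ 4) := by
    intro x
    have h1 : ‖average x - x₀‖ ^ 4 ≤ ∑ c, unifWeight N c * ‖x c - x₀‖ ^ 4 := by
      rw [← deviation_unifWeight hN]
      calc _ ≤ absDev (unifWeight N) x₀ 1 x ^ 4 := by
            gcongr; exact norm_deviation_le (unifWeight_nonneg N) x₀ x
        _ ≤ _ := by
            simpa [absDev] using Real.pow_arith_mean_le_arith_mean_pow Finset.univ (unifWeight N)
              (fun c => ‖x c - x₀‖) (fun c _ => unifWeight_nonneg N c) (sum_unifWeight hN)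
              (fun c _ => norm_nonneg _) 4
    refine (ENNReal.ofReal_le_ofReal h1).trans_eq ?_
    rw [ENNReal.ofReal_sum_of_nonneg fun c _ =>
      mul_nonneg (unifWeight_nonneg N c) (by positivity)]
    exact Finset.sum_congr rfl fun c _ => ENNReal.ofReal_mul (unifWeight_nonneg N c)
  calc _ ≤ ∫⁻ x : Fin N → E, ∑ c, ENNReal.ofReal (unifWeight N c)
          * ENNReal.ofReal (‖x c - x₀‖ ^ 4) ∂ν := lintegral_mono hpt
    _ = ∑ c, ENNReal.ofReal (unifWeight N c) * ∫⁻ x, ENNReal.ofReal (‖x c - x₀‖ ^ 4) ∂ν := by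
        rw [lintegral_finsetSum _ fun c _ => by fun_prop]
        exact Finset.sum_congr rfl fun c _ => lintegral_const_mul _ (by fun_prop)
    _ ≤ ∑ c, ENNReal.ofReal (unifWeight N c) * M := by gcongr with c; exact hM c
    _ = M := by
        rw [← Finset.sum_mul, ← ENNReal.ofReal_sum_of_nonneg fun c _ => unifWeight_nonneg N c,
          sum_unifWeight hN, ENNReal.ofReal_one, one_mul]

end ParallelLaw

/-! ### Covariance and mean of a stationary law. -/

section Stationary

variable {Z E : Type*} [MeasurableSpace Z] [NormedAddCommGroup E] [InnerProductSpace ℝ E]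
  [MeasurableSpace E] [BorelSpace E] [SecondCountableTopology E] [CompleteSpace E]
  {G : Z → E → E} {g : E → E} {ξ : Measure Z} [IsProbabilityMeasure ξ] {x₀ : E} {μ L : ℝ}
  {A : E →L[ℝ] E} {K : (E →L[ℝ] E) →L[ℝ] (E →L[ℝ] E)} {Q : (E →L[ℝ] E) →L[ℝ] E} {C₂ C₃ : ℝ}

/-- The stationarity of `π` for `H` parallel steps followed by averaging, together with the
fourth moment bound. -/
structure IsAveragedStationary (G : Z → E → E) (ξ : Measure Z) (x₀ : E) (N H : ℕ) (γ B : ℝ)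
    (π : Measure E) : Prop where
  isProb : IsProbabilityMeasure π
  map_average : (parallelLaw (Fin N) G ξ γ π H).map average = π
  moment : ∫⁻ x, ENNReal.ofReal (‖x - x₀‖ ^ 4) ∂π ≤ ENNReal.ofReal (B * γ ^ 2)

variable {s S : ℝ} {N H : ℕ} {π : Measure E}

/-- The covariance at stationarity. -/
theorem norm_stationary_cov_sub_le (hG : IsGradientOracle G g ξ x₀ μ L)
    (hE : HasFieldExpansion g x₀ A K Q C₂ C₃) {Us : E →L[ℝ] E} (hUs : K Us = covAt G g ξ x₀)
    (hs : 0 < s) (hsS : s ≤ S) (hsL : s ^ 2 * L ≤ 1 / 8)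
    (hK : ∀ M, ‖M - s ^ 2 • K M‖ ≤ (1 - s ^ 2 * μ) * ‖M‖) (hN : 1 ≤ N) (hH : 1 ≤ H)
    (hπ : IsAveragedStationary G ξ x₀ N H (s ^ 2) (momentConst G ξ x₀ μ L) π) :
    ‖∫ x, outerL E (x - x₀) (x - x₀) ∂π - (s ^ 2 / N) • Us‖
      ≤ covErr (momentConst G ξ x₀ μ L) C₂ L (IsGradientOracle.covLip G ξ x₀ L) S / μ
        * s ^ 3 := by
  have := hπ.isProb
  set γ := s ^ 2 with hγ
  set B := momentConst G ξ x₀ μ L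
  set ce := covErr B C₂ L (IsGradientOracle.covLip G ξ x₀ L) S
  set ν := parallelLaw (Fin N) G ξ γ π
  have hprob : ∀ h, IsProbabilityMeasure (ν h) := hG.isProbabilityMeasure_parallelLaw
  have hγ0 : 0 < γ := by positivity
  have hμ := hG.mu_pos
  have hmom : ∀ h, FourthMomentLE (ν h) x₀ (B * s ^ 4) := fun h => by
    have := hG.fourthMomentLE_parallelLaw (ι := Fin N) hγ0.le hsL hπ.moment h
    rwa [hγ, ← pow_mul] at this
  have hw := unifWeight_nonneg N
  have hw1 := sum_unifWeight hN
  have hB : 0 ≤ B := momentConst_nonneg hG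
  have h0 : covDev (unifWeight N) x₀ (ν 0) = ∫ x, outerL E (x - x₀) (x - x₀) ∂π :=
    covDev_diagonal hw1
  have hHeq : covDev (unifWeight N) x₀ (ν H) = ∫ x, outerL E (x - x₀) (x - x₀) ∂π := by
    rw [covDev_average hN, hπ.map_average]
  have hrec := le_of_periodic_recursion
    (a := fun h => ‖covDev (unifWeight N) x₀ (ν h) - (γ / N) • Us‖) (q := 1 - γ * μ)
    (e := ce * s ^ 5) hH
    (by have := mul_le_mul_of_nonneg_left hG.mu_le hγ0.le; linarith)
    (by have : 0 < γ * μ := by positivity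
        linarith)
    (fun h _ => by
      have hst := norm_covDev_step_le hG hE hs hsS hγ hB (hmom h) (hmom (h + 1)) hw hw1
      rw [sum_unifWeight_sq hN] at hst
      set U := covDev (unifWeight N) x₀ (ν h)
      -- Since `K Us` is the noise covariance at `x₀`, `(γ / N) • Us` is the fixed point of the
      -- leading recursion, and the distance to it obeys a homogeneous contraction plus the one-step
      -- error.
      have e : covDev (unifWeight N) x₀ (ν (h + 1)) - (γ / N) • Us
          = ((U - (γ / N) • Us) - γ • K (U - (γ / N) • Us))
            + (covDev (unifWeight N) x₀ (stepLaw G ξ γ (ν h)) - (U - γ • K U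
              + (γ ^ 2 * (N : ℝ)⁻¹) • covAt G g ξ x₀)) := by
        have : covDev (unifWeight N) x₀ (ν (h + 1))
          = covDev (unifWeight N) x₀ (stepLaw G ξ γ (ν h)) := rfl
        rw [this, map_sub, map_smul, hUs]
        module
      rw [e]
      exact (norm_add_le _ _).trans (add_le_add (hK _) hst))
    (by simp only [h0, hHeq])
  simp only [h0] at hrec
  refine hrec.trans_eq ?_
  rw [hγ]; field_simp; ring

/-- The drift of a single client's covariance along one round. -/
noncomputable def localErr (B ce : ℝ) (K : (E →L[ℝ] E) →L[ℝ] (E →L[ℝ] E)) (C₀ : E →L[ℝ] E)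
    (S : ℝ) : ℝ := ‖K‖ * (1 + B) + ‖C₀‖ + ce * S

/-- At the start of a round every client has the stationary law. Each step then changes its second
moment by `-γ K U + γ² C` plus a smaller error, and this is `O(s ^ 4)` because `U` itself is `O(s ^
2)`. -/
theorem norm_local_cov_sub_le (hG : IsGradientOracle G g ξ x₀ μ L)
    (hE : HasFieldExpansion g x₀ A K Q C₂ C₃)
    (hs : 0 < s) (hsS : s ≤ S) (hsL : s ^ 2 * L ≤ 1 / 8)
    (hπ : IsAveragedStationary G ξ x₀ N H (s ^ 2) (momentConst G ξ x₀ μ L) π) (c : Fin N) (h : ℕ) :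
    ‖∫ x, outerL E (x c - x₀) (x c - x₀) ∂(parallelLaw (Fin N) G ξ (s ^ 2) π h)
        - ∫ x, outerL E (x - x₀) (x - x₀) ∂π‖
      ≤ h * (localErr (momentConst G ξ x₀ μ L)
        (covErr (momentConst G ξ x₀ μ L) C₂ L (IsGradientOracle.covLip G ξ x₀ L) S)
        K (covAt G g ξ x₀) S * s ^ 4) := by
  have := hπ.isProb
  set γ := s ^ 2 with hγ
  set B := momentConst G ξ x₀ μ L
  set ce := covErr B C₂ L (IsGradientOracle.covLip G ξ x₀ L) S with hce
  set ν := parallelLaw (Fin N) G ξ γ π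
  have hprob : ∀ h, IsProbabilityMeasure (ν h) := hG.isProbabilityMeasure_parallelLaw
  have hγ0 : 0 < γ := by positivity
  have hmom : ∀ h, FourthMomentLE (ν h) x₀ (B * s ^ 4) := fun h => by
    have := hG.fourthMomentLE_parallelLaw (ι := Fin N) hγ0.le hsL hπ.moment h
    rwa [hγ, ← pow_mul] at this
  set w : Fin N → ℝ := Pi.single c 1 with hwdef
  have hw : ∀ c', 0 ≤ w c' := fun c' => by
    rw [hwdef, Pi.single_apply]; split_ifs <;> norm_num
  have hw1 : ∑ c', w c' = 1 := by simp [hwdef]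
  have hw2 : ∑ c', w c' ^ 2 = 1 := by simp [hwdef, Pi.single_apply]
  have hB : 0 ≤ B := momentConst_nonneg hG
  have hce0 : 0 ≤ ce := by
    have h1 := IsGradientOracle.covLip_nonneg (G := G) (ξ := ξ) (x₀ := x₀) hG.L_pos.le
    have h2 := hE.C₂_nonneg
    have h3 := hG.L_pos
    have h4 : 0 ≤ S := hs.le.trans hsS
    rw [hce]; unfold covErr; positivity
  have hV : ∀ h, covDev w x₀ (ν h) = ∫ x, outerL E (x c - x₀) (x c - x₀) ∂(ν h) := fun h => by
    rw [covDev]; simp_rw [hwdef, deviation_single]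
  rw [← hV]
  induction h with
  | zero =>
    have : covDev w x₀ (ν 0) = ∫ x, outerL E (x - x₀) (x - x₀) ∂π := covDev_diagonal hw1
    rw [this]; simp
  | succ h ih =>
    have hst := norm_covDev_step_le hG hE hs hsS hγ hB (hmom h) (hmom (h + 1)) hw hw1
    rw [hw2, mul_one] at hst
    have hU := (hmom h).norm_covDev_le hB hs hw hw1
    set U := covDev w x₀ (ν h)
    set Sπ := ∫ x, outerL E (x - x₀) (x - x₀) ∂π
    have e : covDev w x₀ (ν (h + 1)) - Sπ = (U - Sπ) + ((covDev w x₀ (stepLaw G ξ γ (ν h))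
        - (U - γ • K U + γ ^ 2 • covAt G g ξ x₀)) + (-(γ • K U) + γ ^ 2 • covAt G g ξ x₀)) := by
      have : covDev w x₀ (ν (h + 1)) = covDev w x₀ (stepLaw G ξ γ (ν h)) := rfl
      rw [this]
      module
    have hlast : ‖-(γ • K U) + γ ^ 2 • covAt G g ξ x₀‖
        ≤ s ^ 2 * (‖K‖ * ((1 + B) * s ^ 2)) + s ^ 4 * ‖covAt G g ξ x₀‖ := by
      refine (norm_add_le _ _).trans ?_
      rw [norm_neg, norm_smul, norm_smul, Real.norm_of_nonneg hγ0.le,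
        Real.norm_of_nonneg (by positivity), hγ, ← pow_mul]
      gcongr
      exact (K.le_opNorm _).trans (by gcongr)
    have h5 : ce * s ^ 5 ≤ ce * S * s ^ 4 := by
      calc ce * s ^ 5 = ce * s * s ^ 4 := by ring
        _ ≤ _ := by gcongr
    rw [e]
    refine (norm_add_le _ _).trans ((add_le_add ih ((norm_add_le _ _).trans
      (add_le_add hst hlast))).trans ?_)
    unfold localErr
    push_cast
    linarith

/-- The mean at stationarity. -/
theorem norm_stationary_mean_sub_le (hG : IsGradientOracle G g ξ x₀ μ L)
    (hE : HasFieldExpansion g x₀ A K Q C₂ C₃) {Us : E →L[ℝ] E} (hUs : K Us = covAt G g ξ x₀)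
    {bs : E} (hbs : A bs = Q Us)
    (hs : 0 < s) (hsS : s ≤ S) (hsL : s ^ 2 * L ≤ 1 / 8)
    (hA : ∀ v, ‖v - s ^ 2 • A v‖ ≤ (1 - s ^ 2 * μ / 2) * ‖v‖)
    (hK : ∀ M, ‖M - s ^ 2 • K M‖ ≤ (1 - s ^ 2 * μ) * ‖M‖) (hN : 1 ≤ N) (hH : 1 ≤ H)
    (hπ : IsAveragedStationary G ξ x₀ N H (s ^ 2) (momentConst G ξ x₀ μ L) π) {B ce le : ℝ}
    (hBdef : B = momentConst G ξ x₀ μ L)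
    (hce : ce = covErr B C₂ L (IsGradientOracle.covLip G ξ x₀ L) S)
    (hle : le = localErr B ce K (covAt G g ξ x₀) S) :
    ‖∫ x, (x - x₀) ∂π - (-(s ^ 2 / (2 * N))) • bs‖
      ≤ (2 * C₃ * (1 + B) + ‖Q‖ * ce / μ) / μ * s ^ 3 + ‖Q‖ * le / μ * (s ^ 4 * H) := by
  have := hπ.isProb
  have hS := norm_stationary_cov_sub_le hG hE hUs hs hsS hsL hK hN hH hπ
  have hV := norm_local_cov_sub_le hG hE hs hsS hsL hπ
  rw [← hBdef] at hS hV
  rw [← hce] at hS hV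
  rw [← hle] at hV
  have hπm := hπ.moment
  set γ := s ^ 2 with hγ
  set ν := parallelLaw (Fin N) G ξ γ π
  have hprob : ∀ h, IsProbabilityMeasure (ν h) := hG.isProbabilityMeasure_parallelLaw
  have hγ0 : 0 < γ := by positivity
  have hμ := hG.mu_pos
  have hN0 : (N : ℝ) ≠ 0 := by positivity
  have hmom : ∀ h, FourthMomentLE (ν h) x₀ (B * s ^ 4) := fun h => by
    have := hG.fourthMomentLE_parallelLaw (ι := Fin N) hγ0.le hsL hπm h
    rwa [hγ, ← pow_mul, ← hBdef] at this
  have hw := unifWeight_nonneg N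
  have hw1 := sum_unifWeight hN
  have hB : 0 ≤ B := hBdef ▸ momentConst_nonneg hG
  -- Read off from the local bound after one step; a client exists because `1 ≤ N`.
  have hle0 : 0 ≤ le := by
    have := (norm_nonneg _).trans (hV ⟨0, hN⟩ 1)
    rw [Nat.cast_one, one_mul] at this
    exact nonneg_of_mul_nonneg_left this (by positivity)
  have h0 : meanDev (unifWeight N) x₀ (ν 0) = ∫ x, (x - x₀) ∂π := meanDev_diagonal hw1
  have hHeq : meanDev (unifWeight N) x₀ (ν H) = ∫ x, (x - x₀) ∂π := by
    rw [meanDev_average hN, hπ.map_average]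
  have hrec := le_of_periodic_recursion
    (a := fun h => ‖meanDev (unifWeight N) x₀ (ν h) - (-(γ / (2 * N))) • bs‖)
    (q := 1 - γ * μ / 2)
    (e := C₃ * (1 + B) * s ^ 5 + γ / 2 * (‖Q‖ * (H * (le * s ^ 4) + ce / μ * s ^ 3))) hH
    (by have := mul_le_mul_of_nonneg_left hG.mu_le hγ0.le; linarith)
    (by have : 0 < γ * μ := by positivity
        linarith)
    (fun h hh => by
      have hst := norm_meanDev_step_le hG hE hs hγ hB (hmom h) (hmom (h + 1)) hw hw1
      set m := meanDev (unifWeight N) x₀ (ν h)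
      set V := ∫ x, outerDev (unifWeight N) x₀ x ∂(ν h) with hVdef
      set Sπ := ∫ x, outerL E (x - x₀) (x - x₀) ∂π
      -- The first term is the drift of the clients within the round, at most `H` steps; the second
      -- is the error of the stationary covariance.
      have hVle : ‖V - (γ / N) • Us‖ ≤ H * (le * s ^ 4) + ce / μ * s ^ 3 := by
        have h1 : ‖V - Sπ‖ ≤ H * (le * s ^ 4) := by
          have e1 : V - Sπ = ∑ c, unifWeight N c
              • (∫ x, outerL E (x c - x₀) (x c - x₀) ∂(ν h) - Sπ) := by
            rw [hVdef, (hmom h).integral_outerDev]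
            simp only [smul_sub, Finset.sum_sub_distrib]
            rw [← Finset.sum_smul, hw1, one_smul]
          rw [e1]
          refine (norm_sum_weights_le hw fun c => hV c h).trans ?_
          rw [← Finset.sum_mul, hw1, one_mul]
          have : (h : ℝ) ≤ H := by exact_mod_cast hh.le
          gcongr
        calc _ = ‖(V - Sπ) + (Sπ - (γ / N) • Us)‖ := by congr 1; abel
          _ ≤ _ := (norm_add_le _ _).trans (add_le_add h1 hS)
      -- As `A bs = Q Us`, the vector `-(γ / (2N)) • bs` is the fixed point of the mean recursion
      -- with `V` replaced by `(γ / N) • Us`.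
      have e : meanDev (unifWeight N) x₀ (ν (h + 1)) - (-(γ / (2 * N))) • bs
          = ((m - (-(γ / (2 * N))) • bs) - γ • A (m - (-(γ / (2 * N))) • bs))
            + ((meanDev (unifWeight N) x₀ (stepLaw G ξ γ (ν h))
              - (m - γ • A m - (γ / 2) • Q V)) + -((γ / 2) • Q (V - (γ / N) • Us))) := by
        have : meanDev (unifWeight N) x₀ (ν (h + 1))
          = meanDev (unifWeight N) x₀ (stepLaw G ξ γ (ν h)) := rfl
        rw [this, map_sub, map_smul, map_sub, map_smul, hbs]
        module
      have hQ : ‖-((γ / 2) • Q (V - (γ / N) • Us))‖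
          ≤ γ / 2 * (‖Q‖ * (H * (le * s ^ 4) + ce / μ * s ^ 3)) := by
        rw [norm_neg, norm_smul, Real.norm_of_nonneg (by positivity)]
        gcongr
        exact (Q.le_opNorm _).trans (by gcongr)
      rw [e]
      exact (norm_add_le _ _).trans (add_le_add (hA _) ((norm_add_le _ _).trans
        (add_le_add hst hQ))))
    (by simp only [h0, hHeq])
  simp only [h0] at hrec
  refine hrec.trans_eq ?_
  rw [hγ]; field_simp; ring

end Stationary

/-! ### Global Taylor bounds from a local condition on the second derivative of the field. -/

section Taylor

variable {E F : Type*} [NormedAddCommGroup E] [NormedSpace ℝ E] [NormedAddCommGroup F]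
  [NormedSpace ℝ F]

/-- The mean value inequality on the ball of radius `‖x - x₀‖` raises the order of vanishing by one.
Its repeated use replaces a Taylor formula and needs no continuity of the top derivative away from
`x₀`. -/
theorem norm_sub_le_of_fderiv_le {φ : E → F} {φ' : E → E →L[ℝ] F} {x₀ : E} {r c : ℝ} {n : ℕ}
    (hc : 0 ≤ c) (hφ : ∀ x, HasFDerivAt φ (φ' x) x)
    (hb : ∀ x, ‖x - x₀‖ < r → ‖φ' x‖ ≤ c * ‖x - x₀‖ ^ n) {x : E} (hx : ‖x - x₀‖ < r) :
    ‖φ x - φ x₀‖ ≤ c * ‖x - x₀‖ ^ (n + 1) := by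
  have h := (convex_closedBall x₀ ‖x - x₀‖).norm_image_sub_le_of_norm_hasFDerivWithin_le
    (f := φ) (f' := φ') (C := c * ‖x - x₀‖ ^ n) (x := x₀) (y := x)
    (fun y _ => (hφ y).hasFDerivWithinAt)
    (fun y hy => by
      rw [Metric.mem_closedBall, dist_eq_norm] at hy
      refine (hb y (hy.trans_lt hx)).trans ?_
      gcongr)
    (Metric.mem_closedBall_self (norm_nonneg _))
    (by rw [Metric.mem_closedBall, dist_eq_norm])
  refine h.trans_eq ?_
  ring

/-- Second- and third-order Taylor bounds, globally for a field of linear growth. -/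
theorem exists_taylor_bounds {g : E → E} {g' : E → E →L[ℝ] E} {g'' : E → E →L[ℝ] E →L[ℝ] E}
    {x₀ : E} {L : ℝ} (hL : 0 ≤ L) (hg : ∀ x, HasFDerivAt g (g' x) x)
    (hg' : ∀ x, HasFDerivAt g' (g'' x) x)
    (hg'' : (fun x => g'' x - g'' x₀) =O[𝓝 x₀] fun x => x - x₀) (h0 : g x₀ = 0)
    (hlip : ∀ x, ‖g x‖ ≤ L * ‖x - x₀‖) :
    ∃ C₂ C₃ : ℝ, 0 ≤ C₂ ∧ 0 ≤ C₃ ∧ (∀ x, ‖g x - g' x₀ (x - x₀)‖ ≤ C₂ * ‖x - x₀‖ ^ 2) ∧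
      ∀ x, ‖g x - g' x₀ (x - x₀) - (1 / 2 : ℝ) • g'' x₀ (x - x₀) (x - x₀)‖
        ≤ C₃ * ‖x - x₀‖ ^ 3 := by
  set A := g' x₀
  set T := g'' x₀
  -- Symmetry makes `T v` the derivative of `½ T v v`.
  have hsymm : ∀ u v, T u v = T v u := second_derivative_symmetric hg (hg' x₀)
  obtain ⟨c, hc, hbig⟩ := hg''.exists_nonneg
  obtain ⟨r, hr, hball⟩ := Metric.eventually_nhds_iff.1 hbig.bound
  have b2 : ∀ x, ‖x - x₀‖ < r → ‖g'' x - T‖ ≤ c * ‖x - x₀‖ ^ 1 := fun x hx => by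
    simpa using hball (y := x) (by rwa [dist_eq_norm])
  have b1 : ∀ x, ‖x - x₀‖ < r → ‖g' x - A - T (x - x₀)‖ ≤ c * ‖x - x₀‖ ^ 2 := by
    intro x hx
    have hd : ∀ y, HasFDerivAt (fun y => g' y - T (y - x₀)) (g'' y - T) y := fun y =>
      (hg' y).sub (T.hasFDerivAt.comp y ((hasFDerivAt_id y).sub_const x₀))
    have := norm_sub_le_of_fderiv_le hc hd b2 hx
    simp only [sub_self, map_zero, sub_zero] at this
    rwa [sub_right_comm]
  have b0 : ∀ x, ‖x - x₀‖ < r → ‖g x - A (x - x₀) - (1 / 2 : ℝ) • T (x - x₀) (x - x₀)‖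
      ≤ c * ‖x - x₀‖ ^ 3 := by
    intro x hx
    have hd : ∀ y, HasFDerivAt
        (fun y => g y - A (y - x₀) - (1 / 2 : ℝ) • T (y - x₀) (y - x₀))
        (g' y - A - T (y - x₀)) y := by
      intro y
      have hid : HasFDerivAt (fun y : E => y - x₀) (ContinuousLinearMap.id ℝ E) y :=
        (hasFDerivAt_id y).sub_const x₀
      have h1 : HasFDerivAt (fun y => A (y - x₀)) A y := A.hasFDerivAt.comp y hid
      have h2 := (T.hasFDerivAt_of_bilinear hid hid).const_smul (1 / 2 : ℝ)
      have h3 := ((hg y).sub h1).sub h2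
      have e : g' y - A - (1 / 2 : ℝ) • (T.precompR E (y - x₀) (ContinuousLinearMap.id ℝ E)
          + T.precompL E (ContinuousLinearMap.id ℝ E) (y - x₀)) = g' y - A - T (y - x₀) := by
        congr 1
        ext v
        change (1 / 2 : ℝ) • (T (y - x₀) v + T v (y - x₀)) = T (y - x₀) v
        rw [hsymm v (y - x₀)]
        module
      rw [e] at h3
      exact h3
    have := norm_sub_le_of_fderiv_le hc hd b1 hx
    simpa [h0] using this
  have hA : ∀ x, ‖x - x₀‖ < r → ‖g x - A (x - x₀)‖
      ≤ c * ‖x - x₀‖ ^ 3 + 1 / 2 * (‖T‖ * ‖x - x₀‖ ^ 2) := by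
    intro x hx
    calc _ = ‖(g x - A (x - x₀) - (1 / 2 : ℝ) • T (x - x₀) (x - x₀))
          + (1 / 2 : ℝ) • T (x - x₀) (x - x₀)‖ := by congr 1; abel
      _ ≤ c * ‖x - x₀‖ ^ 3 + ‖(1 / 2 : ℝ) • T (x - x₀) (x - x₀)‖ :=
          (norm_add_le _ _).trans (by gcongr; exact b0 x hx)
      _ ≤ _ := by
          rw [norm_smul, Real.norm_of_nonneg (by norm_num)]
          gcongr
          refine (T.le_opNorm₂ _ _).trans_eq ?_
          ring
  have hglob : ∀ x, ‖g x - A (x - x₀)‖ ≤ (L + ‖A‖) * ‖x - x₀‖ := by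
    intro x
    calc _ ≤ ‖g x‖ + ‖A (x - x₀)‖ := norm_sub_le _ _
      _ ≤ L * ‖x - x₀‖ + ‖A‖ * ‖x - x₀‖ := add_le_add (hlip x) (A.le_opNorm _)
      _ = _ := by ring
  -- The terms with a division by a power of `r` handle `‖x - x₀‖ ≥ r`, where linear growth suffices
  -- because `1 ≤ ‖x - x₀‖ / r`; the others come from the local expansion.
  refine ⟨c * r + ‖T‖ / 2 + (L + ‖A‖) / r, c + (L + ‖A‖) / r ^ 2 + ‖T‖ / (2 * r),
    by positivity, by positivity, fun x => ?_, fun x => ?_⟩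
  · rcases lt_or_ge ‖x - x₀‖ r with hx | hx
    · have h1 : c * ‖x - x₀‖ ^ 3 ≤ c * r * ‖x - x₀‖ ^ 2 := by
        calc c * ‖x - x₀‖ ^ 3 = c * ‖x - x₀‖ * ‖x - x₀‖ ^ 2 := by ring
          _ ≤ _ := by gcongr
      have h2 : 0 ≤ (L + ‖A‖) / r * ‖x - x₀‖ ^ 2 := by positivity
      have := hA x hx
      linarith
    · have h1 : (L + ‖A‖) * ‖x - x₀‖ ≤ (L + ‖A‖) / r * ‖x - x₀‖ ^ 2 := by
        have : ‖x - x₀‖ ≤ ‖x - x₀‖ ^ 2 / r := by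
          rw [le_div_iff₀ hr, sq]; gcongr
        calc _ ≤ (L + ‖A‖) * (‖x - x₀‖ ^ 2 / r) := by gcongr
          _ = _ := by ring
      have h2 : 0 ≤ (c * r + ‖T‖ / 2) * ‖x - x₀‖ ^ 2 := by positivity
      have := hglob x
      linarith
  · rcases lt_or_ge ‖x - x₀‖ r with hx | hx
    · have h2 : 0 ≤ ((L + ‖A‖) / r ^ 2 + ‖T‖ / (2 * r)) * ‖x - x₀‖ ^ 3 := by positivity
      have := b0 x hx
      linarith
    · have h1 : (L + ‖A‖) * ‖x - x₀‖ ≤ (L + ‖A‖) / r ^ 2 * ‖x - x₀‖ ^ 3 := by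
        have : ‖x - x₀‖ ≤ ‖x - x₀‖ ^ 3 / r ^ 2 := by
          rw [le_div_iff₀ (by positivity)]
          calc ‖x - x₀‖ * r ^ 2 ≤ ‖x - x₀‖ * ‖x - x₀‖ ^ 2 := by gcongr
            _ = _ := by ring
        calc _ ≤ (L + ‖A‖) * (‖x - x₀‖ ^ 3 / r ^ 2) := by gcongr
          _ = _ := by ring
      have h2 : ‖(1 / 2 : ℝ) • T (x - x₀) (x - x₀)‖ ≤ ‖T‖ / (2 * r) * ‖x - x₀‖ ^ 3 := by
        rw [norm_smul, Real.norm_of_nonneg (by norm_num)]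
        have h3 := T.le_opNorm₂ (x - x₀) (x - x₀)
        have h4 : ‖x - x₀‖ ^ 2 ≤ ‖x - x₀‖ ^ 3 / r := by
          rw [le_div_iff₀ hr, pow_succ ‖x - x₀‖ 2]; gcongr
        calc _ ≤ 1 / 2 * (‖T‖ * ‖x - x₀‖ ^ 2) := by
              gcongr; exact h3.trans_eq (by ring)
          _ ≤ 1 / 2 * (‖T‖ * (‖x - x₀‖ ^ 3 / r)) := by gcongr
          _ = _ := by ring
      have h5 : 0 ≤ c * ‖x - x₀‖ ^ 3 := by positivity
      have := norm_sub_le (g x - A (x - x₀)) ((1 / 2 : ℝ) • T (x - x₀) (x - x₀))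
      have := hglob x
      linarith

end Taylor

/-! ### Strong monotonicity, contraction and invertibility from Hessian bounds. -/

section Monotone

variable {E : Type*} [NormedAddCommGroup E] [InnerProductSpace ℝ E]

/-- Mean value theorem for `t ↦ ⟨x - y, g (y + t(x - y))⟩` on `[0, 1]`. -/
theorem strongMono_of_hess {g : E → E} {g' : E → E →L[ℝ] E} {μ : ℝ}
    (hg : ∀ x, HasFDerivAt g (g' x) x) (hconv : ∀ x v, μ * ‖v‖ ^ 2 ≤ inner ℝ (g' x v) v)
    (x y : E) : μ * ‖x - y‖ ^ 2 ≤ inner ℝ (x - y) (g x - g y) := by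
  have hline : ∀ t : ℝ, HasDerivAt (fun t : ℝ => y + t • (x - y)) (x - y) t := fun t => by
    simpa using ((hasDerivAt_id t).smul_const (x - y)).const_add y
  have hd : ∀ t : ℝ, HasDerivAt (fun t : ℝ => (inner ℝ (x - y) (g (y + t • (x - y))) : ℝ))
      (inner ℝ (x - y) (g' (y + t • (x - y)) (x - y))) t := fun t => by
    simpa using (hasDerivAt_const t (x - y)).inner ℝ ((hg _).comp_hasDerivAt t (hline t))
  obtain ⟨t, _, ht⟩ := exists_hasDerivAt_eq_slope _ _ (zero_lt_one' ℝ)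
    (fun t _ => (hd t).continuousAt.continuousWithinAt) (fun t _ => hd t)
  have h1 : (inner ℝ (x - y) (g' (y + t • (x - y)) (x - y)) : ℝ)
      = inner ℝ (x - y) (g x - g y) := by
    rw [ht]; simp [inner_sub_right]
  rw [← h1, real_inner_comm]
  exact hconv _ _

variable {A : E →L[ℝ] E} {μ L γ : ℝ}

/-- A symmetric operator with spectrum in `[μ, L]`: `Id - γ A` contracts. -/
theorem norm_sub_smul_le_of_symmetric (hμ : 0 < μ) (hL : 0 < L) (hμL : μ ≤ L) (hγ : 0 ≤ γ)
    (hγL : γ * L ≤ 1) (hsymm : ∀ u v, (inner ℝ (A u) v : ℝ) = inner ℝ u (A v))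
    (hlow : ∀ v, μ * ‖v‖ ^ 2 ≤ inner ℝ (A v) v) (hup : ∀ v, inner ℝ (A v) v ≤ L * ‖v‖ ^ 2)
    (v : E) : ‖v - γ • A v‖ ≤ (1 - γ * μ / 2) * ‖v‖ := by
  have hq := hlow v
  set q : ℝ := inner ℝ (A v) v with hqdef
  -- Positivity of the form at `L v - A v`, with the upper bound at `A v`, gives cocoercivity
  -- without diagonalizing `A`.
  have hco : ‖A v‖ ^ 2 ≤ L * q := by
    have h1 := hlow (L • v - A v)
    have h2 : 0 ≤ μ * ‖L • v - A v‖ ^ 2 := by positivity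
    have h3 := hup (A v)
    have e : (inner ℝ (A (L • v - A v)) (L • v - A v) : ℝ)
        = L ^ 2 * q - 2 * L * ‖A v‖ ^ 2 + inner ℝ (A (A v)) (A v) := by
      simp only [map_sub, map_smul, inner_sub_left, inner_sub_right, inner_smul_left,
        inner_smul_right, hqdef]
      rw [hsymm (A v) v, real_inner_self_eq_norm_sq]
      simp
      ring
    have h4 : L * ‖A v‖ ^ 2 ≤ L * (L * q) := by nlinarith
    exact le_of_mul_le_mul_left h4 hL
  have hexp : ‖v - γ • A v‖ ^ 2 = ‖v‖ ^ 2 - 2 * γ * q + γ ^ 2 * ‖A v‖ ^ 2 := by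
    rw [norm_sub_sq_real, inner_smul_right, norm_smul, Real.norm_of_nonneg hγ, hqdef,
      real_inner_comm]
    ring
  have hγμ : γ * μ ≤ 1 := (mul_le_mul_of_nonneg_left hμL hγ).trans hγL
  have hq0 : 0 ≤ q := le_trans (by positivity) hq
  have h1 : γ ^ 2 * ‖A v‖ ^ 2 ≤ γ * q := by
    calc γ ^ 2 * ‖A v‖ ^ 2 ≤ γ ^ 2 * (L * q) := by gcongr
      _ = γ * q * (γ * L) := by ring
      _ ≤ γ * q * 1 := by gcongr
      _ = _ := by ring
  have h2 : γ * (μ * ‖v‖ ^ 2) ≤ γ * q := by gcongr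
  refine le_of_sq_le_sq ?_ (mul_nonneg (by linarith) (norm_nonneg _))
  have h3 : 0 ≤ (γ * μ / 2) ^ 2 * ‖v‖ ^ 2 := by positivity
  rw [hexp]
  nlinarith

/-- Neumann series for `γ • K = 1 - (1 - γ • K)`. -/
theorem isUnit_of_norm_sub_smul_le {F : Type*} [NormedAddCommGroup F] [NormedSpace ℝ F]
    [CompleteSpace F] {K : F →L[ℝ] F} {q : ℝ} (hγ : 0 < γ) (hq0 : 0 ≤ q) (hq : q < 1)
    (h : ∀ v, ‖v - γ • K v‖ ≤ q * ‖v‖) : IsUnit K := by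
  have hn : ‖(1 : F →L[ℝ] F) - γ • K‖ < 1 :=
    (ContinuousLinearMap.opNorm_le_bound _ hq0 h).trans_lt hq
  have hu : IsUnit (γ • K) := by
    have := isUnit_one_sub_of_norm_lt_one hn
    rwa [sub_sub_cancel] at this
  have e : K = γ⁻¹ • (γ • K) := by rw [smul_smul, inv_mul_cancel₀ hγ.ne', one_smul]
  rw [e]
  exact hu.smul (Units.mk0 γ⁻¹ (inv_ne_zero hγ.ne'))

theorem apply_inverse_of_isUnit {F : Type*} [NormedAddCommGroup F] [NormedSpace ℝ F]
    {K : F →L[ℝ] F} (h : IsUnit K) (v : F) : K (Ring.inverse K v) = v := by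
  rw [← mul_apply_eq_comp, Ring.mul_inverse_cancel K h, one_apply_eq_self]

end Monotone

/-! ### The Kronecker sum and the contraction with the third derivative. -/

section Kronecker

variable {d : ℕ}

theorem kronSum_apply (A M : Op d) : kronSum A M = M.comp A + A.comp M := rfl

theorem kronSum_outer {A : Op d} (hsymm : ∀ u v, (inner ℝ (A u) v : ℝ) = inner ℝ u (A v))
    (u : Param d) : kronSum A (outerL (Param d) u u)
      = outerL (Param d) (A u) u + outerL (Param d) u (A u) := by
  ext1 v
  simp only [kronSum_apply, add_apply, ContinuousLinearMap.comp_apply, outerL_apply, map_smul,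
    hsymm]
  abel

/-- With `R = 1 - 2γA` one has `M - γ(MA + AM) = ½(MR + RM)`, so the contraction rate of `R` passes
to matrices in operator norm. -/
theorem norm_sub_smul_kronSum_le {A : Op d} {γ q : ℝ} (hq : 0 ≤ q)
    (h : ∀ v, ‖v - (2 * γ) • A v‖ ≤ q * ‖v‖) (M : Op d) :
    ‖M - γ • kronSum A M‖ ≤ q * ‖M‖ := by
  set R : Op d := 1 - (2 * γ) • A with hR
  have hRn : ‖R‖ ≤ q := ContinuousLinearMap.opNorm_le_bound _ hq h
  have e : M - γ • kronSum A M = (1 / 2 : ℝ) • (M * R + R * M) := by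
    ext1 v
    simp only [kronSum_apply, hR, sub_apply, smul_apply, add_apply, mul_apply_eq_comp,
      one_apply_eq_self, ContinuousLinearMap.comp_apply, map_sub, map_smul]
    module
  rw [e, norm_smul, Real.norm_of_nonneg (by norm_num)]
  have h1 : ‖M * R + R * M‖ ≤ ‖M‖ * q + q * ‖M‖ :=
    (norm_add_le _ _).trans (add_le_add ((norm_mul_le _ _).trans (by gcongr))
      ((norm_mul_le _ _).trans (by gcongr)))
  linarith

/-- The contraction with a third derivative, as a continuous linear map. -/
noncomputable def contractL (T : Param d →L[ℝ] Op d) : Op d →L[ℝ] Param d :=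
  LinearMap.toContinuousLinearMap
    { toFun := contract T
      map_add' := fun M M' => by simp [contract, Finset.sum_add_distrib]
      map_smul' := fun c M => by simp [contract, Finset.smul_sum] }

theorem contractL_apply (T : Param d →L[ℝ] Op d) (M : Op d) : contractL T M = contract T M := rfl

theorem contractL_outer (T : Param d →L[ℝ] Op d) (u : Param d) :
    contractL T (outerL (Param d) u u) = T u u := by
  have hu : u = ∑ j, u j • EuclideanSpace.single j (1 : ℝ) := by
    simpa using ((EuclideanSpace.basisFun (Fin d) ℝ).sum_repr u).symm
  have h1 : ∀ j, T (outerL (Param d) u u (EuclideanSpace.single j 1)) (EuclideanSpace.single j 1)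
      = u j • T u (EuclideanSpace.single j 1) := fun j => by
    rw [outerL_apply, EuclideanSpace.inner_single_right, map_smul, smul_apply]
    simp
  rw [contractL_apply, contract, Finset.sum_congr rfl fun j _ => h1 j]
  have key : T u u = T u (∑ j, u j • EuclideanSpace.single j (1 : ℝ)) := congrArg (T u) hu
  rw [key, map_sum]
  exact Finset.sum_congr rfl fun j _ => (map_smul _ _ _).symm

end Kronecker

/-! ### Gradients of the stochastic functions form an oracle for the gradient of the objective. -/

section Gradient

variable {E : Type*} [NormedAddCommGroup E] [InnerProductSpace ℝ E] [CompleteSpace E]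

theorem inner_gradient_eq {φ : E → ℝ} (x v : E) :
    (inner ℝ (gradient φ x) v : ℝ) = fderiv ℝ φ x v := by
  rw [gradient, InnerProductSpace.toDual_symm_apply]

theorem fderiv_eq_toDual_gradient (φ : E → ℝ) (x : E) :
    fderiv ℝ φ x = InnerProductSpace.toDual ℝ E (gradient φ x) := by
  rw [gradient, LinearIsometryEquiv.apply_symm_apply]

theorem gradient_eq_zero_of_isMinOn {φ : E → ℝ} {x : E} (h : IsMinOn φ Set.univ x) :
    gradient φ x = 0 := by
  have h1 : fderiv ℝ φ x = 0 := (h.isLocalMin Filter.univ_mem).fderiv_eq_zero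
  rw [gradient, h1, map_zero]

/-- The derivative of a gradient is symmetric. -/
theorem inner_fderiv_gradient_symm {φ : E → ℝ} (h1 : Differentiable ℝ φ)
    (h2 : Differentiable ℝ (gradient φ)) (x u v : E) :
    (inner ℝ (fderiv ℝ (gradient φ) x u) v : ℝ) = inner ℝ u (fderiv ℝ (gradient φ) x v) := by
  let J : E →L[ℝ] E →L[ℝ] ℝ := innerSL ℝ
  have hJ : ∀ a b : E, J a b = inner ℝ a b := fun a b => rfl
  have hφ : ∀ y, HasFDerivAt φ (J (gradient φ y)) y := fun y => by
    have e : J (gradient φ y) = fderiv ℝ φ y := by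
      ext w; rw [hJ, inner_gradient_eq]
    rw [e]; exact (h1 y).hasFDerivAt
  have hφ' : HasFDerivAt (fun y => J (gradient φ y)) (J.comp (fderiv ℝ (gradient φ) x)) x :=
    J.hasFDerivAt.comp x (h2 x).hasFDerivAt
  have := second_derivative_symmetric hφ hφ' u v
  simp only [ContinuousLinearMap.comp_apply, hJ] at this
  rw [this, real_inner_comm]

end Gradient

section Oracle

variable {Z : Type*} [MeasurableSpace Z] {d : ℕ} {F : Z → Param d → ℝ} {ξ : Measure Z}
  {f : Param d → ℝ} {θs : Param d} {μ L : ℝ}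

/-- Each coordinate of the gradient is a pointwise limit of difference quotients, which are jointly
measurable in the sample and the parameter. -/
theorem measurable_gradient (hF : Measurable (Function.uncurry F))
    (hd : ∀ z, Differentiable ℝ (F z)) :
    Measurable (Function.uncurry fun z => gradient (F z)) := by
  have hcoord : ∀ v : Param d,
      Measurable fun p : Z × Param d => (inner ℝ (gradient (F p.1) p.2) v : ℝ) := by
    intro v
    refine measurable_of_tendsto_metrizable
      (f := fun (n : ℕ) (p : Z × Param d) =>
        (n : ℝ) • (F p.1 (p.2 + (n : ℝ)⁻¹ • v) - F p.1 p.2)) (fun n => ?_) ?_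
    · have h1 : Measurable fun p : Z × Param d => F p.1 (p.2 + (n : ℝ)⁻¹ • v) :=
        hF.comp (measurable_fst.prodMk (measurable_snd.add_const _))
      exact (h1.sub hF).const_smul (n : ℝ)
    · refine tendsto_pi_nhds.2 fun p => ?_
      rw [inner_gradient_eq]
      exact ((hd p.1 p.2).hasFDerivAt.lim_real v).comp tendsto_natCast_atTop_atTop
  have hsum : (Function.uncurry fun z => gradient (F z)) = fun p : Z × Param d =>
      ∑ i, (inner ℝ (gradient (F p.1) p.2) (EuclideanSpace.basisFun (Fin d) ℝ i) : ℝ)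
        • EuclideanSpace.basisFun (Fin d) ℝ i := by
    funext p
    rw [← (EuclideanSpace.basisFun (Fin d) ℝ).sum_repr' (Function.uncurry _ p)]
    exact Finset.sum_congr rfl fun i _ => by rw [real_inner_comm]; rfl
  rw [hsum]
  exact Finset.measurable_sum _ fun i _ => (hcoord _).smul_const _

theorem integrable_of_norm_pow_four {E : Type*} [NormedAddCommGroup E] {ρ : Measure Z}
    [IsFiniteMeasure ρ] {X : Z → E} (hX : AEStronglyMeasurable X ρ)
    (h : Integrable (fun z => ‖X z‖ ^ 4) ρ) : Integrable X ρ := by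
  refine ((integrable_const (1 : ℝ)).add h).mono' hX (Filter.Eventually.of_forall fun z => ?_)
  change ‖X z‖ ≤ 1 + ‖X z‖ ^ 4
  nlinarith [sq_nonneg (‖X z‖ ^ 2 - 1 / 2), sq_nonneg (‖X z‖ - 1 / 2)]

/-- Differentiation of the objective under the integral sign. -/
theorem integral_gradient_eq [IsProbabilityMeasure ξ]
    (hF_int : ∀ θ, Integrable (fun z => F z θ) ξ) (hd : ∀ z, Differentiable ℝ (F z))
    (hlip : ∀ z θ η, ‖gradient (F z) θ - gradient (F z) η‖ ≤ L * ‖θ - η‖) (hL : 0 ≤ L)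
    (hint : ∀ θ, Integrable (fun z => gradient (F z) θ) ξ) (θ : Param d) :
    ∫ z, gradient (F z) θ ∂ξ = gradient (objective F ξ) θ := by
  have hcl : Continuous (InnerProductSpace.toDual ℝ (Param d)) :=
    (InnerProductSpace.toDual ℝ (Param d)).continuous
  have hnorm : ∀ z η, ‖fderiv ℝ (F z) η‖ = ‖gradient (F z) η‖ := fun z η => by
    rw [fderiv_eq_toDual_gradient, LinearIsometryEquiv.norm_map]
  have hmeas : AEStronglyMeasurable (fun z => fderiv ℝ (F z) θ) ξ := by
    simp_rw [fderiv_eq_toDual_gradient]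
    exact hcl.comp_aestronglyMeasurable (hint θ).aestronglyMeasurable
  have hfd : HasFDerivAt (objective F ξ) (∫ z, fderiv ℝ (F z) θ ∂ξ) θ := by
    refine hasFDerivAt_integral_of_dominated_of_fderiv_le (s := Metric.ball θ 1)
      (F := fun η z => F z η) (F' := fun η z => fderiv ℝ (F z) η)
      -- On the unit ball around `θ` the gradient varies by at most `L`.
      (bound := fun z => ‖gradient (F z) θ‖ + L) (Metric.ball_mem_nhds θ one_pos)
      (Filter.Eventually.of_forall fun η => (hF_int η).aestronglyMeasurable) (hF_int θ) hmeas
      (Filter.Eventually.of_forall fun z η hη => ?_) ((hint θ).norm.add (integrable_const L))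
      (Filter.Eventually.of_forall fun z η _ => (hd z η).hasFDerivAt)
    rw [hnorm]
    rw [Metric.mem_ball, dist_eq_norm] at hη
    have h1 : ‖gradient (F z) η - gradient (F z) θ‖ ≤ L * 1 :=
      (hlip z η θ).trans (by gcongr)
    have h2 := norm_le_norm_add_norm_sub' (gradient (F z) η) (gradient (F z) θ)
    linarith
  refine ext_inner_right ℝ fun v => ?_
  have hif : Integrable (fun z => fderiv ℝ (F z) θ) ξ := by
    refine (hint θ).norm.mono' hmeas (Filter.Eventually.of_forall fun z => ?_)
    rw [hnorm]
  rw [inner_gradient_eq, hfd.fderiv, ContinuousLinearMap.integral_apply hif, real_inner_comm,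
    ← integral_inner (hint θ)]
  exact integral_congr_ae (Filter.Eventually.of_forall fun z => by
    change (inner ℝ v (gradient (F z) θ) : ℝ) = _
    rw [real_inner_comm, inner_gradient_eq])

theorem isGradientOracle_gradient [IsProbabilityMeasure ξ]
    (hF : Measurable (Function.uncurry F))
    (hF_int : ∀ θ, Integrable (fun z => F z θ) ξ) (hθs : IsMinOn (objective F ξ) Set.univ θs)
    (hf2 : Differentiable ℝ (gradient (objective F ξ)))
    (hμ : 0 < μ) (hL : 0 < L) (hμL : μ ≤ L)
    (hconv : ∀ θ v, μ * ‖v‖ ^ 2 ≤ inner ℝ (hess (objective F ξ) θ v) v)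
    (hd : ∀ z, Differentiable ℝ (F z))
    (hlip : ∀ z θ η, ‖gradient (F z) θ - gradient (F z) η‖ ≤ L * ‖θ - η‖)
    (hco : ∀ z θ η, ‖gradient (F z) θ - gradient (F z) η‖ ^ 2
      ≤ 2 * L * inner ℝ (θ - η) (gradient (F z) θ - gradient (F z) η))
    (hnoise : Integrable (fun z => ‖gradNoise F ξ z θs‖ ^ 4) ξ) :
    IsGradientOracle (fun z => gradient (F z)) (gradient (objective F ξ)) ξ θs μ L := by
  have hcrit := gradient_eq_zero_of_isMinOn hθs
  have hm := measurable_gradient hF hd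
  have hmθ : ∀ θ, Measurable fun z => gradient (F z) θ := fun θ =>
    hm.comp (measurable_id.prodMk measurable_const)
  have hmom : Integrable (fun z => ‖gradient (F z) θs‖ ^ 4) ξ := by
    simpa [gradNoise, hcrit] using hnoise
  have hint : ∀ θ, Integrable (fun z => gradient (F z) θ) ξ := by
    intro θ
    have h0 := integrable_of_norm_pow_four (hmθ θs).aestronglyMeasurable hmom
    refine (h0.norm.add (integrable_const (L * ‖θ - θs‖))).mono' (hmθ θ).aestronglyMeasurable
      (Filter.Eventually.of_forall fun z => ?_)
    change _ ≤ ‖gradient (F z) θs‖ + L * ‖θ - θs‖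
    have := norm_le_norm_add_norm_sub' (gradient (F z) θ) (gradient (F z) θs)
    linarith [hlip z θ θs]
  exact
    { measurable := hm
      lipschitz := hlip
      cocoercive := hco
      moment := hmom
      integral_eq := integral_gradient_eq hF_int hd hlip hL.le hint
      critical := hcrit
      strongMono := strongMono_of_hess (fun x => (hf2 x).hasFDerivAt) hconv
      mu_pos := hμ
      L_pos := hL
      mu_le := hμL }

end Oracle

/-! ### Splitting off the samples of the last local step. -/

section Noise

variable {Z : Type*} [MeasurableSpace Z] (ξ : Measure Z) [IsProbabilityMeasure ξ]

theorem measurePreserving_init_last (h : ℕ) :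
    MeasurePreserving (fun z : Fin (h + 1) → Z => ((Fin.init z : Fin h → Z), z (Fin.last h)))
      (Measure.pi fun _ : Fin (h + 1) => ξ) ((Measure.pi fun _ : Fin h => ξ).prod ξ) := by
  have h1 := measurePreserving_piFinSuccAbove (fun _ : Fin (h + 1) => ξ) (Fin.last h)
  have h2 := Measure.measurePreserving_swap.comp h1
  have e : (fun z : Fin (h + 1) → Z => ((Fin.init z : Fin h → Z), z (Fin.last h)))
      = Prod.swap ∘ MeasurableEquiv.piFinSuccAbove (fun _ => Z) (Fin.last h) := by
    funext z
    refine Prod.ext ?_ rfl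
    funext i
    simp [MeasurableEquiv.piFinSuccAbove, Fin.init, Fin.insertNthEquiv]
  rw [e]
  exact h2

instance isProbabilityMeasure_stateLaw (N H : ℕ) :
    IsProbabilityMeasure (stateLaw (fun _ : Fin N => ξ) H) := by
  unfold stateLaw; infer_instance

theorem measurePreserving_stateLaw_succ (N h : ℕ) :
    MeasurePreserving
      (fun z : Fin N → Fin (h + 1) → Z =>
        ((fun c => (Fin.init (z c) : Fin h → Z)), fun c => z c (Fin.last h)))
      (stateLaw (fun _ : Fin N => ξ) (h + 1))
      ((stateLaw (fun _ : Fin N => ξ) h).prod (Measure.pi fun _ : Fin N => ξ)) :=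
  (measurePreserving_arrowProdEquivProdArrow (Fin h → Z) Z (Fin N)
      (fun _ => Measure.pi fun _ : Fin h => ξ) fun _ => ξ).comp
    (measurePreserving_pi _ _ fun _ => measurePreserving_init_last ξ h)

end Noise

/-! ### The FedAvg chain as a random map: law of a round, drift, contraction, stationarity. -/

section Chain

variable {Z : Type*} [MeasurableSpace Z] {d : ℕ} {F : Z → Param d → ℝ} {ξ : Measure Z}
  {g : Param d → Param d} {x₀ : Param d} {μ L γ : ℝ} {N H : ℕ}

theorem measurable_localUpdate (hm : Measurable (Function.uncurry fun z => gradient (F z)))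
    (γ : ℝ) (h : ℕ) :
    Measurable fun p : Param d × (Fin h → Z) => localUpdate F γ h p.1 p.2 := by
  induction h with
  | zero => exact measurable_fst
  | succ h ih =>
    have h1 : Measurable fun p : Param d × (Fin (h + 1) → Z) =>
        localUpdate F γ h p.1 (Fin.init p.2) :=
      ih.comp (measurable_fst.prodMk (measurable_pi_iff.2 fun i =>
        (measurable_pi_apply i.castSucc).comp measurable_snd))
    have h2 : Measurable fun p : Param d × (Fin (h + 1) → Z) => p.2 (Fin.last h) :=
      (measurable_pi_apply _).comp measurable_snd
    exact h1.sub ((hm.comp (h2.prodMk h1)).const_smul γ)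

theorem measurable_localUpdates (hm : Measurable (Function.uncurry fun z => gradient (F z)))
    (γ : ℝ) (h : ℕ) :
    Measurable fun (p : Param d × (Fin N → Fin h → Z)) (c : Fin N) =>
      localUpdate F γ h p.1 (p.2 c) :=
  measurable_pi_iff.2 fun c => (measurable_localUpdate hm γ h).comp
    (measurable_fst.prodMk ((measurable_pi_apply c).comp measurable_snd))

theorem measurable_globalUpdate (hm : Measurable (Function.uncurry fun z => gradient (F z)))
    (γ : ℝ) (H : ℕ) :
    Measurable (Function.uncurry (globalUpdate (fun _ : Fin N => F) γ H)) :=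
  measurable_average.comp (measurable_localUpdates hm γ H)

theorem isStationary_iff_isStationaryMap [IsProbabilityMeasure ξ]
    (hm : Measurable (Function.uncurry fun z => gradient (F z)))
    (π : Measure (Param d)) :
    IsStationary (fun _ : Fin N => F) (fun _ => ξ) γ H π
      ↔ IsStationaryMap (globalUpdate (fun _ : Fin N => F) γ H) (stateLaw (fun _ => ξ) H) π := by
  unfold IsStationary IsStationaryMap
  refine and_congr_right fun hπ => ?_
  have e : π.bind (kernel (fun _ : Fin N => F) (fun _ => ξ) γ H)
      = (π.prod (stateLaw (fun _ : Fin N => ξ) H)).map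
        (Function.uncurry (globalUpdate (fun _ : Fin N => F) γ H)) := by
    rw [kernel]
    have h1 := Measure.map_comp π
      (Kernel.prod Kernel.id (Kernel.const (Param d) (stateLaw (fun _ : Fin N => ξ) H)))
      (measurable_globalUpdate (N := N) hm γ H)
    rw [← Measure.compProd_eq_comp_prod, Measure.compProd_const] at h1
    exact h1.symm
  rw [Kernel.Invariant, e]

variable [IsProbabilityMeasure ξ]

/-- The joint law of the clients' local iterates. -/
theorem map_localUpdates_eq_parallelLaw
    (hm : Measurable (Function.uncurry fun z => gradient (F z)))
    (hG : IsGradientOracle (fun z => gradient (F z)) g ξ x₀ μ L)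
    (π : Measure (Param d)) [IsProbabilityMeasure π] (h : ℕ) :
    (π.prod (stateLaw (fun _ : Fin N => ξ) h)).map
        (fun p c => localUpdate F γ h p.1 (p.2 c))
      = parallelLaw (Fin N) (fun z => gradient (F z)) ξ γ π h := by
  induction h with
  | zero =>
    have h1 : (π.prod (stateLaw (fun _ : Fin N => ξ) 0)).map Prod.fst = π := by simp
    calc _ = ((π.prod (stateLaw (fun _ : Fin N => ξ) 0)).map Prod.fst).map
          (fun x (_ : Fin N) => x) := by
          rw [Measure.map_map measurable_diagonal measurable_fst]; rfl
      _ = _ := by rw [h1]; rfl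
  | succ h ih =>
    have hL := measurable_localUpdates (N := N) hm γ h
    have hsplit := (MeasurePreserving.id π).prod (measurePreserving_stateLaw_succ ξ N h)
    have hassoc := hsplit.map_eq
    have hS := hG.measurable_parallelStep (ι := Fin N) γ
    have hLid : Measurable (Prod.map (fun (p : Param d × (Fin N → Fin h → Z)) (c : Fin N) =>
      localUpdate F γ h p.1 (p.2 c)) (id : (Fin N → Z) → Fin N → Z)) := hL.prodMap measurable_id
    have := hG.isProbabilityMeasure_parallelLaw (ι := Fin N) (γ := γ) (π := π) h
    rw [parallelLaw, stepLaw, ← ih]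
    conv_rhs => rw [← Measure.map_id (μ := Measure.pi fun _ : Fin N => ξ)]
    rw [Measure.map_prod_map _ _ hL measurable_id, Measure.map_map hS hLid,
      ← (MeasurePreserving.symm _ (measurePreserving_prodAssoc π
        (stateLaw (fun _ : Fin N => ξ) h) (Measure.pi fun _ : Fin N => ξ))).map_eq,
      Measure.map_map (hS.comp hLid) (MeasurableEquiv.measurable _),
      ← hassoc,
      Measure.map_map ((hS.comp hLid).comp (MeasurableEquiv.measurable _)) hsplit.measurable]
    rfl

theorem map_globalUpdate_eq (hG : IsGradientOracle (fun z => gradient (F z)) g ξ x₀ μ L)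
    (π : Measure (Param d)) [IsProbabilityMeasure π] :
    (π.prod (stateLaw (fun _ : Fin N => ξ) H)).map
        (Function.uncurry (globalUpdate (fun _ : Fin N => F) γ H))
      = (parallelLaw (Fin N) (fun z => gradient (F z)) ξ γ π H).map average := by
  rw [← map_localUpdates_eq_parallelLaw hG.measurable hG,
    Measure.map_map measurable_average (measurable_localUpdates hG.measurable γ H)]
  rfl

/-- One round of FedAvg contracts the fourth moment, up to noise. -/
theorem exists_drift_globalUpdate (hG : IsGradientOracle (fun z => gradient (F z)) g ξ x₀ μ L)
    (hN : 1 ≤ N) (hγ : 0 ≤ γ) (hγL : γ * L ≤ 1 / 8) (H : ℕ) : ∃ b : ENNReal,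
      ENNReal.ofReal (1 - γ * μ) ^ H
          * ENNReal.ofReal (momentConst (fun z => gradient (F z)) ξ x₀ μ L * γ ^ 2) + b
        = ENNReal.ofReal (momentConst (fun z => gradient (F z)) ξ x₀ μ L * γ ^ 2) ∧
      ∀ x, ∫⁻ z, ENNReal.ofReal (‖globalUpdate (fun _ : Fin N => F) γ H x z - x₀‖ ^ 4)
          ∂(stateLaw (fun _ : Fin N => ξ) H)
        ≤ ENNReal.ofReal (1 - γ * μ) ^ H * ENNReal.ofReal (‖x - x₀‖ ^ 4) + b := by
  obtain ⟨b, hb, hle⟩ := hG.lintegral_parallelLaw_le (ι := Fin N) hγ hγL H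
  refine ⟨b, hb, fun x => ?_⟩
  have hV : Measurable fun y : Param d => ENNReal.ofReal (‖y - x₀‖ ^ 4) := by fun_prop
  have hmg := measurable_globalUpdate (N := N) hG.measurable γ H
  -- Starting from a Dirac mass turns the moment bound on laws into a drift inequality at each
  -- point.
  have h1 := map_globalUpdate_eq (N := N) (H := H) (γ := γ) hG (Measure.dirac x)
  calc _ = ∫⁻ y, ENNReal.ofReal (‖y - x₀‖ ^ 4)
        ∂(((Measure.dirac x).prod (stateLaw (fun _ : Fin N => ξ) H)).map
          (Function.uncurry (globalUpdate (fun _ : Fin N => F) γ H))) := by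
        have hVg : Measurable fun p : Param d × (Fin N → Fin H → Z) => ENNReal.ofReal
          (‖Function.uncurry (globalUpdate (fun _ : Fin N => F) γ H) p - x₀‖ ^ 4) := hV.comp hmg
        rw [lintegral_map hV hmg, lintegral_prod _ hVg.aemeasurable,
          lintegral_dirac' x (Measurable.lintegral_prod_right' hVg)]
        rfl
    _ ≤ _ := by
        rw [h1, lintegral_map hV measurable_average]
        refine lintegral_average_le hN _ fun c => (hle (Measure.dirac x) c).trans_eq ?_
        rw [lintegral_dirac' x hV]

theorem isAveragedStationary_of_isStationary
    (hG : IsGradientOracle (fun z => gradient (F z)) g ξ x₀ μ L)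
    (hN : 1 ≤ N) (hH : 1 ≤ H) (hγ : 0 < γ) (hγL : γ * L ≤ 1 / 8) {π : Measure (Param d)}
    (hπ : IsStationary (fun _ : Fin N => F) (fun _ => ξ) γ H π) :
    IsAveragedStationary (fun z => gradient (F z)) ξ x₀ N H γ
      (momentConst (fun z => gradient (F z)) ξ x₀ μ L) π := by
  have hst := (isStationary_iff_isStationaryMap hG.measurable π).1 hπ
  have := hπ.1
  refine ⟨hπ.1, ?_, ?_⟩
  · rw [← map_globalUpdate_eq hG]; exact hst.2
  · obtain ⟨b, hb, hle⟩ := exists_drift_globalUpdate hG hN hγ.le hγL H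
    refine lintegral_le_of_drift (measurable_globalUpdate hG.measurable γ H) hst
      (by fun_prop) (fun x => ENNReal.ofReal_ne_top) ?_ hb.le hle
    refine pow_lt_one₀ zero_le ?_ (by omega)
    rw [ENNReal.ofReal_lt_one]
    have := mul_pos hγ hG.mu_pos
    linarith

theorem norm_localUpdate_sub_le (hG : IsGradientOracle (fun z => gradient (F z)) g ξ x₀ μ L)
    (hγ : 0 ≤ γ) (hγL : γ * L ≤ 1 / 8) (h : ℕ) (x y : Param d) (z : Fin h → Z) :
    ‖localUpdate F γ h x z - localUpdate F γ h y z‖ ≤ ‖x - y‖ := by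
  induction h with
  | zero => exact le_rfl
  | succ h ih => exact (hG.nonexpansive hγ hγL _ _ _).trans (ih _)

/-- The last sample is independent of the earlier iterates, so by Fubini the mean contraction rates
of the steps multiply. -/
theorem lintegral_localUpdate_sub_le
    (hG : IsGradientOracle (fun z => gradient (F z)) g ξ x₀ μ L)
    (hγ : 0 ≤ γ) (hγL : γ * L ≤ 1 / 8) (h : ℕ) (x y : Param d) :
    ∫⁻ z, ‖localUpdate F γ h x z - localUpdate F γ h y z‖ₑ ∂(Measure.pi fun _ : Fin h => ξ)
      ≤ ENNReal.ofReal (1 - γ * μ / 2) ^ h * ‖x - y‖ₑ := by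
  induction h with
  | zero => simp [localUpdate]
  | succ h ih =>
    set q := ENNReal.ofReal (1 - γ * μ / 2) with hq
    have hq0 : 0 ≤ 1 - γ * μ / 2 := by
      have := mul_le_mul_of_nonneg_left hG.mu_le hγ
      linarith
    have hloc : ∀ x, Measurable fun z : Fin h → Z => localUpdate F γ h x z := fun x =>
      (measurable_localUpdate hG.measurable γ h).comp measurable_prodMk_left
    obtain ⟨W, hW⟩ : ∃ W : Param d → (Fin h → Z) × Z → Param d, ∀ x p, W x p
        = localUpdate F γ h x p.1 - γ • gradient (F p.2) (localUpdate F γ h x p.1) :=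
      ⟨_, fun _ _ => rfl⟩
    have hWm : ∀ x, Measurable (W x) := fun x => by
      have h1 : Measurable fun p : (Fin h → Z) × Z => localUpdate F γ h x p.1 :=
        (hloc x).comp measurable_fst
      rw [funext (hW x)]
      exact h1.sub ((hG.measurable.comp (measurable_snd.prodMk h1)).const_smul γ)
    have hsucc : ∀ (x : Param d) (z : Fin (h + 1) → Z),
        localUpdate F γ (h + 1) x z = W x (Fin.init z, z (Fin.last h)) :=
      fun x z => by rw [hW, localUpdate]
    have hm : Measurable fun p => ‖W x p - W y p‖ₑ := ((hWm x).sub (hWm y)).enorm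
    have hone : ∀ u v : Param d, ∫⁻ z, ‖(u - γ • gradient (F z) u) - (v - γ • gradient (F z) v)‖ₑ
        ∂ξ ≤ q * ‖u - v‖ₑ := by
      intro u v
      have hi : Integrable (fun z => (u - γ • gradient (F z) u) - (v - γ • gradient (F z) v)) ξ :=
        ((integrable_const u).sub ((hG.integrable u).smul γ)).sub
          ((integrable_const v).sub ((hG.integrable v).smul γ))
      rw [← ofReal_integral_norm_eq_lintegral_enorm hi, ← ofReal_norm (u - v), hq,
        ← ENNReal.ofReal_mul hq0]
      exact ENNReal.ofReal_le_ofReal (hG.integral_norm_step_sub_le hγ hγL u v)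
    simp_rw [hsucc]
    calc _ = ∫⁻ p, ‖W x p - W y p‖ₑ ∂((Measure.pi fun _ : Fin h => ξ).prod ξ) :=
          (measurePreserving_init_last ξ h).lintegral_comp hm
      _ ≤ ∫⁻ z, q * ‖localUpdate F γ h x z - localUpdate F γ h y z‖ₑ
            ∂(Measure.pi fun _ : Fin h => ξ) := by
          rw [lintegral_prod _ hm.aemeasurable]
          refine lintegral_mono fun z => ?_
          simp only [hW]
          exact hone _ _
      _ = q * ∫⁻ z, ‖localUpdate F γ h x z - localUpdate F γ h y z‖ₑ
            ∂(Measure.pi fun _ : Fin h => ξ) :=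
          lintegral_const_mul _ ((hloc x).sub (hloc y)).enorm
      _ ≤ q * (q ^ h * ‖x - y‖ₑ) := by gcongr
      _ = _ := by ring

theorem isMeanContraction_globalUpdate
    (hG : IsGradientOracle (fun z => gradient (F z)) g ξ x₀ μ L)
    (hN : 1 ≤ N) (hγ : 0 ≤ γ) (hγL : γ * L ≤ 1 / 8) (H : ℕ) :
    IsMeanContraction (globalUpdate (fun _ : Fin N => F) γ H) (stateLaw (fun _ => ξ) H)
      (ENNReal.ofReal (1 - γ * μ / 2) ^ H) := by
  have hNR : (N : ℝ) ≠ 0 := by positivity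
  have hsub : ∀ (x y : Param d) (z : Fin N → Fin H → Z),
      globalUpdate (fun _ : Fin N => F) γ H x z - globalUpdate (fun _ : Fin N => F) γ H y z
        = (N : ℝ)⁻¹ • ∑ c, (localUpdate F γ H x (z c) - localUpdate F γ H y (z c)) :=
    fun x y z => by rw [globalUpdate, globalUpdate, ← smul_sub, Finset.sum_sub_distrib]
  refine ⟨measurable_globalUpdate hG.measurable γ H, fun z x y => ?_, fun x y => ?_⟩
  · rw [hsub, norm_smul, Real.norm_of_nonneg (by positivity)]
    calc _ ≤ (N : ℝ)⁻¹ * ∑ _c : Fin N, ‖x - y‖ := by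
          gcongr
          exact (norm_sum_le _ _).trans
            (Finset.sum_le_sum fun c _ => norm_localUpdate_sub_le hG hγ hγL H x y (z c))
      _ = _ := by simp [hNR]
  · have hloc : ∀ x, Measurable fun z : Fin H → Z => localUpdate F γ H x z := fun x =>
      (measurable_localUpdate hG.measurable γ H).comp measurable_prodMk_left
    have hm : Measurable fun z : Fin H → Z =>
      ‖localUpdate F γ H x z - localUpdate F γ H y z‖ₑ := ((hloc x).sub (hloc y)).enorm
    have hNE : (N : ENNReal) ≠ 0 := by exact_mod_cast (by omega : N ≠ 0)
    have hinv : ‖((N : ℝ)⁻¹ : ℝ)‖ₑ = (N : ENNReal)⁻¹ := by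
      rw [enorm_inv hNR]; simp
    calc _ ≤ ∫⁻ z : Fin N → Fin H → Z, (N : ENNReal)⁻¹
          * ∑ c, ‖localUpdate F γ H x (z c) - localUpdate F γ H y (z c)‖ₑ
            ∂(stateLaw (fun _ => ξ) H) := by
          refine lintegral_mono fun z => ?_
          rw [hsub, enorm_smul, hinv]
          gcongr
          exact enorm_sum_le _ _
      _ = (N : ENNReal)⁻¹ * ∑ c : Fin N, ∫⁻ z : Fin N → Fin H → Z,
            ‖localUpdate F γ H x (z c) - localUpdate F γ H y (z c)‖ₑ
            ∂(stateLaw (fun _ => ξ) H) := by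
          have hmc : ∀ c : Fin N, Measurable fun z : Fin N → Fin H → Z =>
              ‖localUpdate F γ H x (z c) - localUpdate F γ H y (z c)‖ₑ := fun c =>
            hm.comp (measurable_pi_apply c)
          rw [lintegral_const_mul _ (Finset.measurable_sum _ fun c _ => hmc c),
            lintegral_finsetSum _ fun c _ => hmc c]
      _ ≤ (N : ENNReal)⁻¹ * ∑ _c : Fin N, ENNReal.ofReal (1 - γ * μ / 2) ^ H * ‖x - y‖ₑ := by
          gcongr with c
          exact ((measurePreserving_eval (fun _ : Fin N => Measure.pi fun _ : Fin H => ξ)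
            c).lintegral_comp hm).trans_le (lintegral_localUpdate_sub_le hG hγ hγL H x y)
      _ = _ := by
          rw [Finset.sum_const, Finset.card_univ, Fintype.card_fin, nsmul_eq_mul, ← mul_assoc,
            ENNReal.inv_mul_cancel hNE (ENNReal.natCast_ne_top N), one_mul]

theorem existsUnique_isStationary (hG : IsGradientOracle (fun z => gradient (F z)) g ξ x₀ μ L)
    (hN : 1 ≤ N) (hH : 1 ≤ H) (hγ : 0 < γ) (hγL : γ * L ≤ 1 / 8) :
    ∃! π : Measure (Param d), IsStationary (fun _ : Fin N => F) (fun _ => ξ) γ H π := by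
  simp_rw [isStationary_iff_isStationaryMap hG.measurable]
  have hΦ := isMeanContraction_globalUpdate hG hN hγ.le hγL H
  have hq : ENNReal.ofReal (1 - γ * μ / 2) ^ H < 1 := by
    refine pow_lt_one₀ zero_le ?_ (by omega)
    rw [ENNReal.ofReal_lt_one]
    have := mul_pos hγ hG.mu_pos
    linarith
  obtain ⟨b, hb, hle⟩ := exists_drift_globalUpdate hG hN hγ.le hγL H
  have hfin : ∫⁻ z, ‖globalUpdate (fun _ : Fin N => F) γ H x₀ z - x₀‖ₑ
      ∂(stateLaw (fun _ : Fin N => ξ) H) ≠ ⊤ := by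
    -- `b` is a summand of a finite quantity. The drift at `x₀` then bounds a fourth moment, and `t
    -- ≤ 1 + t⁴` yields the first moment needed for existence.
    have hbtop : b ≠ ⊤ := fun h => by simp [h] at hb
    refine ne_top_of_le_ne_top (b := 1 + b) (by simp [hbtop]) ?_
    calc _ ≤ ∫⁻ z, (1 + ENNReal.ofReal
            (‖globalUpdate (fun _ : Fin N => F) γ H x₀ z - x₀‖ ^ 4))
            ∂(stateLaw (fun _ : Fin N => ξ) H) := by
          refine lintegral_mono fun z => ?_
          rw [← ofReal_norm, ← ENNReal.ofReal_one,
            ← ENNReal.ofReal_add zero_le_one (by positivity)]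
          refine ENNReal.ofReal_le_ofReal ?_
          set t := ‖globalUpdate (fun _ : Fin N => F) γ H x₀ z - x₀‖
          nlinarith [sq_nonneg (t ^ 2 - 1 / 2), sq_nonneg (t - 1 / 2)]
      _ = 1 + ∫⁻ z, ENNReal.ofReal
            (‖globalUpdate (fun _ : Fin N => F) γ H x₀ z - x₀‖ ^ 4)
            ∂(stateLaw (fun _ : Fin N => ξ) H) := by
          rw [lintegral_add_left measurable_const]; simp
      _ ≤ 1 + b := by
          gcongr
          simpa using hle x₀
  obtain ⟨π, hπ⟩ := hΦ.exists_stationary hq x₀ hfin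
  exact ⟨π, hπ, fun π' hπ' => hΦ.stationary_unique hq hπ' hπ⟩

end Chain

/-! ### The abstract expansion specialized to the objective. -/

section Expansion

variable {Z : Type*} [MeasurableSpace Z] {d : ℕ} {F : Z → Param d → ℝ} {ξ : Measure Z}
  [IsProbabilityMeasure ξ] {θs : Param d} {μ L : ℝ}

theorem exists_hasFieldExpansion {f : Param d → ℝ} (hL : 0 ≤ L)
    (hf1 : Differentiable ℝ f) (hf2 : Differentiable ℝ (gradient f))
    (hf3 : Differentiable ℝ (hess f))
    (hf4 : (fun θ => third f θ - third f θs) =O[𝓝 θs] fun θ => θ - θs)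
    (h0 : gradient f θs = 0) (hlip : ∀ θ, ‖gradient f θ‖ ≤ L * ‖θ - θs‖) :
    ∃ C₂ C₃, HasFieldExpansion (gradient f) θs (hess f θs) (kronSum (hess f θs))
      (contractL (third f θs)) C₂ C₃ := by
  obtain ⟨C₂, C₃, h2, h3, hq, hc⟩ := exists_taylor_bounds (g := gradient f) (g' := hess f)
    (g'' := third f) hL (fun x => (hf2 x).hasFDerivAt) (fun x => (hf3 x).hasFDerivAt) hf4 h0 hlip
  exact ⟨C₂, C₃, hq, fun y => by rw [contractL_outer]; exact hc y,
    kronSum_outer (inner_fderiv_gradient_symm hf1 hf2 θs), h2, h3⟩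

/-- The operator and vector equations solved by the leading terms. -/
theorem leadingTerm_equations {f : Param d → ℝ} (hμ : 0 < μ) (hL : 0 < L) (hμL : μ ≤ L)
    (hsymm : ∀ u v, (inner ℝ (hess f θs u) v : ℝ) = inner ℝ u (hess f θs v))
    (hlow : ∀ v, μ * ‖v‖ ^ 2 ≤ inner ℝ (hess f θs v) v)
    (hup : ∀ v, inner ℝ (hess f θs v) v ≤ L * ‖v‖ ^ 2) {γ : ℝ} (hγ : 0 < γ)
    (hγL : γ * L ≤ 1 / 8) :
    (∀ v, ‖v - γ • hess f θs v‖ ≤ (1 - γ * μ / 2) * ‖v‖) ∧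
    (∀ M, ‖M - γ • kronSum (hess f θs) M‖ ≤ (1 - γ * μ) * ‖M‖) ∧
    (∀ v, hess f θs (Ring.inverse (hess f θs) v) = v) ∧
    ∀ M, kronSum (hess f θs) (opA f θs M) = M := by
  have hγμ : 0 < γ * μ := mul_pos hγ hμ
  have hγμL : γ * μ ≤ 1 / 8 := (mul_le_mul_of_nonneg_left hμL hγ.le).trans hγL
  have hA := norm_sub_smul_le_of_symmetric hμ hL hμL hγ.le (by linarith) hsymm hlow hup
  have hA2 := norm_sub_smul_le_of_symmetric (γ := 2 * γ) hμ hL hμL (by positivity)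
    (by linarith) hsymm hlow hup
  have hK : ∀ M, ‖M - γ • kronSum (hess f θs) M‖ ≤ (1 - γ * μ) * ‖M‖ :=
    -- The vector contraction at step size `2γ` has rate `1 - (2γ)μ/2 = 1 - γμ`.
    norm_sub_smul_kronSum_le (by linarith) fun v => (hA2 v).trans_eq (by ring)
  exact ⟨hA, hK, apply_inverse_of_isUnit
    (isUnit_of_norm_sub_smul_le hγ (by linarith) (by linarith) hA),
    apply_inverse_of_isUnit (isUnit_of_norm_sub_smul_le hγ (by linarith) (by linarith) hK)⟩

theorem rpow_three_halves_sq {s : ℝ} (hs : 0 ≤ s) : (s ^ 2) ^ (3 / 2 : ℝ) = s ^ 3 := by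
  rw [← Real.rpow_natCast, ← Real.rpow_mul hs, ← Real.rpow_natCast]
  norm_num

theorem memLp_of_isAveragedStationary {G : Z → Param d → Param d} {N H : ℕ} {γ B : ℝ}
    {π : Measure (Param d)} (h : IsAveragedStationary G ξ θs N H γ B π) :
    MemLp (fun θ => θ) 2 π := by
  have := h.isProb
  have hm : Measurable fun θ : Param d => θ - θs := by fun_prop
  have h4 : MemLp (fun θ : Param d => θ - θs) 4 π := by
    rw [← integrable_norm_rpow_iff hm.aestronglyMeasurable (by norm_num) (by norm_num)]
    have hi : Integrable (fun θ : Param d => ‖θ - θs‖ ^ 4) π := by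
      refine ⟨(hm.norm.pow_const 4).aestronglyMeasurable, ?_⟩
      rw [hasFiniteIntegral_iff_ofReal (ae_of_all _ fun θ => by positivity)]
      exact h.moment.trans_lt ENNReal.ofReal_lt_top
    refine hi.congr (ae_of_all _ fun θ => ?_)
    simp only
    rw [← Real.rpow_natCast]
    norm_num
  have h2 : MemLp (fun θ : Param d => θ - θs) 2 π := h4.mono_exponent (by norm_num)
  exact (h2.add (memLp_const θs)).ae_eq (ae_of_all _ fun θ => sub_add_cancel θ θs)

end Expansion

end FedAvg

/-! ### The theorem: one constant for all `N`, `H`, `γ`, and bias for small steps. -/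

open FedAvg

theorem mainTheorem2
    {Z : Type*} [MeasurableSpace Z] (d : ℕ)
    -- the common stochastic functions `F_z` of the clients and the common law of their states
    (F : Z → FedAvg.Param d → ℝ) (ξ : Measure Z) [IsProbabilityMeasure ξ]
    (hF_meas : Measurable (Function.uncurry F))
    (hF_int : ∀ θ, Integrable (fun z => F z θ) ξ)
    (f : FedAvg.Param d → ℝ) (hf : f = FedAvg.objective F ξ)
    -- `θs` is the minimizer of `f`
    (θs : FedAvg.Param d) (hθs : IsMinOn f Set.univ θs)
    -- `f` is three times differentiable, and its third derivative is Lipschitz at the minimizer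
    (hf1 : Differentiable ℝ f) (hf2 : Differentiable ℝ (gradient f))
    (hf3 : Differentiable ℝ (FedAvg.hess f))
    (hf4 : (fun θ => FedAvg.third f θ - FedAvg.third f θs) =O[𝓝 θs] fun θ => θ - θs)
    -- strong convexity and smoothness
    (μ L : ℝ) (hμ : 0 < μ) (hL : 0 < L)
    (h_convex : ∀ θ v, μ * ‖v‖ ^ 2 ≤ inner ℝ (FedAvg.hess f θ v) v)
    (hF_diff : ∀ z, Differentiable ℝ (F z))
    (hF_smooth : ∀ z θ η, ‖gradient (F z) θ - gradient (F z) η‖ ≤ L * ‖θ - η‖)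
    (hF_cocoercive : ∀ z θ η, ‖gradient (F z) θ - gradient (F z) η‖ ^ 2
      ≤ 2 * L * inner ℝ (θ - η) (gradient (F z) θ - gradient (F z) η))
    (h_smooth : ∀ θ v, inner ℝ (FedAvg.hess f θ v) v ≤ L * ‖v‖ ^ 2)
    -- moments of the gradient noise
    (τ k : ℝ) (hτ : 0 ≤ τ) (hk : 0 ≤ k)
    (h_noise : ∀ θ, ∀ p ∈ ({1, 2, 3} : Finset ℕ),
      Integrable (fun z => ‖FedAvg.gradNoise F ξ z θ‖ ^ (2 * p)) ξ ∧
      (∫ z, ‖FedAvg.gradNoise F ξ z θ‖ ^ (2 * p) ∂ξ) ^ (1 / (p : ℝ))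
        ≤ τ ^ 2 * (1 + ‖θ - θs‖ ^ k)) :
    -- the stationary distribution exists and is unique
    (∀ N H : ℕ, 1 ≤ N → 1 ≤ H → ∀ γ : ℝ, 0 < γ → γ ≤ min (1 / (8 * L)) (1 / (H : ℝ)) →
      ∃! π : Measure (FedAvg.Param d),
        FedAvg.IsStationary (fun _ : Fin N => F) (fun _ : Fin N => ξ) γ H π) ∧
    -- expansions of its mean and covariance, with a constant independent of `N`, `H` and `γ`
    (∃ C : ℝ, ∀ N H : ℕ, 1 ≤ N → 1 ≤ H → ∀ γ : ℝ, 0 < γ →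
      γ ≤ min (1 / (8 * L)) (1 / (H : ℝ)) → ∀ π : Measure (FedAvg.Param d),
        FedAvg.IsStationary (fun _ : Fin N => F) (fun _ : Fin N => ξ) γ H π →
        MemLp (fun θ => θ) 2 π ∧
        ‖((∫ θ, θ ∂π) - θs) - (-(γ / (2 * N))) • FedAvg.stochBias F ξ θs‖
          ≤ C * (γ ^ 2 * H + γ ^ (3 / 2 : ℝ)) ∧
        ‖(∫ θ, FedAvg.tensorSq (θ - θs) ∂π)
            - (γ / N) • FedAvg.opA f θs (FedAvg.noiseCov F ξ θs)‖
          ≤ C * (γ ^ 2 * H + γ ^ (3 / 2 : ℝ))) ∧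
    -- a nonzero leading term makes FedAvg biased for all small step sizes
    (FedAvg.stochBias F ξ θs ≠ 0 → ∀ N H : ℕ, 1 ≤ N → 1 ≤ H → ∃ γ₀ : ℝ, 0 < γ₀ ∧
      ∀ γ : ℝ, 0 < γ → γ < γ₀ → ∀ π : Measure (FedAvg.Param d),
        FedAvg.IsStationary (fun _ : Fin N => F) (fun _ : Fin N => ξ) γ H π →
        (∫ θ, θ ∂π) ≠ θs) := by
  have hbias : stochBias F ξ θs = Ring.inverse (hess f θs)
      (contract (third f θs) (opA f θs (noiseCov F ξ θs))) := by rw [hf]; rfl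
  have hcov : noiseCov F ξ θs = covAt (fun z => gradient (F z)) (gradient f) ξ θs := by
    rw [hf]; rfl
  -- The Hessian bounds force `μ ≤ L` only when `d ≥ 1`; passing to `min μ L` also covers `d = 0`.
  have hm : 0 < min μ L := lt_min hμ hL
  have hmL : min μ L ≤ L := min_le_right _ _
  have hlow : ∀ θ v, min μ L * ‖v‖ ^ 2 ≤ inner ℝ (hess f θ v) v := fun θ v =>
    (mul_le_mul_of_nonneg_right (min_le_left _ _) (sq_nonneg _)).trans (h_convex θ v)
  have hG : IsGradientOracle (fun z => gradient (F z)) (gradient f) ξ θs (min μ L) L := by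
    -- `p = 2` is the fourth moment of the noise, at the minimizer.
    have hn := (h_noise θs 2 (by simp)).1
    subst hf
    exact isGradientOracle_gradient hF_meas hF_int hθs hf2 hm hL hmL hlow hF_diff hF_smooth
      hF_cocoercive hn
  have hγL : ∀ {H : ℕ} {γ : ℝ}, γ ≤ min (1 / (8 * L)) (1 / (H : ℝ)) → γ * L ≤ 1 / 8 := by
    intro H γ hγ
    calc γ * L ≤ 1 / (8 * L) * L := by gcongr; exact hγ.trans (min_le_left _ _)
      _ = 1 / 8 := by field_simp
  obtain ⟨C₂, C₃, hE⟩ := exists_hasFieldExpansion (L := L) hL.le hf1 hf2 hf3 hf4 hG.critical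
    hG.norm_field_le
  have hex : ∃ C : ℝ, ∀ N H : ℕ, 1 ≤ N → 1 ≤ H → ∀ γ : ℝ, 0 < γ →
      γ ≤ min (1 / (8 * L)) (1 / (H : ℝ)) → ∀ π : Measure (Param d),
        IsStationary (fun _ : Fin N => F) (fun _ : Fin N => ξ) γ H π →
        MemLp (fun θ => θ) 2 π ∧
        ‖((∫ θ, θ ∂π) - θs) - (-(γ / (2 * N))) • stochBias F ξ θs‖
          ≤ C * (γ ^ 2 * H + γ ^ (3 / 2 : ℝ)) ∧
        ‖(∫ θ, tensorSq (θ - θs) ∂π) - (γ / N) • opA f θs (noiseCov F ξ θs)‖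
          ≤ C * (γ ^ 2 * H + γ ^ (3 / 2 : ℝ)) := by
    -- An upper bound for all admissible `s = √γ`, which makes the constants below independent of
    -- `γ`, `N` and `H`.
    set S := √(1 / (8 * L)) with hS
    set B := momentConst (fun z => gradient (F z)) ξ θs (min μ L) L with hB
    set ce := covErr B C₂ L (IsGradientOracle.covLip (fun z => gradient (F z)) ξ θs L) S with hce
    set le := localErr B ce (kronSum (hess f θs))
      (covAt (fun z => gradient (F z)) (gradient f) ξ θs) S with hle
    set Q := contractL (third f θs) with hQ
    set c₁ := ce / min μ L
    set c₂ := (2 * C₃ * (1 + B) + ‖Q‖ * ce / min μ L) / min μ L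
    set c₃ := ‖Q‖ * le / min μ L
    refine ⟨|c₁| + |c₂| + |c₃|, fun N H hN hH γ hγ hγle π hπ => ?_⟩
    have hγL' := hγL hγle
    obtain ⟨hA, hK, hinvA, hinvK⟩ := leadingTerm_equations (f := f) (θs := θs) hm hL hmL
      (inner_fderiv_gradient_symm hf1 hf2 θs) (hlow θs) (h_smooth θs) hγ hγL'
    have hst := isAveragedStationary_of_isStationary hG hN hH hγ hγL' hπ
    have hmem := memLp_of_isAveragedStationary hst
    have := hπ.1
    obtain ⟨s, hs, rfl⟩ : ∃ s : ℝ, 0 < s ∧ γ = s ^ 2 :=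
      ⟨√γ, Real.sqrt_pos.2 hγ, (Real.sq_sqrt hγ.le).symm⟩
    have hsS : s ≤ S := Real.le_sqrt_of_sq_le (hγle.trans (min_le_left _ _))
    have hUs : kronSum (hess f θs) (opA f θs (noiseCov F ξ θs))
        = covAt (fun z => gradient (F z)) (gradient f) ξ θs := by rw [hinvK, hcov]
    have hbs : hess f θs (stochBias F ξ θs) = Q (opA f θs (noiseCov F ξ θs)) := by
      rw [hbias, hinvA]; rfl
    have h1 := norm_stationary_cov_sub_le hG hE hUs hs hsS hγL' hK hN hH hst
    have h2 := norm_stationary_mean_sub_le hG hE hUs hbs hs hsS hγL' hA hK hN hH hst hB hce hle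
    rw [integral_sub (hmem.integrable (by norm_num)) (integrable_const θs)] at h2
    simp only [integral_const, probReal_univ, one_smul] at h2
    rw [rpow_three_halves_sq hs.le]
    have e4 : (s ^ 2) ^ 2 * (H : ℝ) = s ^ 4 * H := by ring
    rw [e4]
    have hs3 : 0 ≤ s ^ 3 := by positivity
    have hs4 : 0 ≤ s ^ 4 * (H : ℝ) := by positivity
    have b1 : c₁ * s ^ 3 ≤ |c₁| * s ^ 3 := by gcongr; exact le_abs_self _
    have b2 : c₂ * s ^ 3 ≤ |c₂| * s ^ 3 := by gcongr; exact le_abs_self _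
    have b3 : c₃ * (s ^ 4 * H) ≤ |c₃| * (s ^ 4 * H) := by gcongr; exact le_abs_self _
    have p1 := mul_nonneg (abs_nonneg c₁) hs3
    have p2 := mul_nonneg (abs_nonneg c₂) hs3
    have p3 := mul_nonneg (abs_nonneg c₃) hs3
    have q1 := mul_nonneg (abs_nonneg c₁) hs4
    have q2 := mul_nonneg (abs_nonneg c₂) hs4
    have q3 := mul_nonneg (abs_nonneg c₃) hs4
    refine ⟨hmem, h2.trans ?_, h1.trans ?_⟩
    · linarith
    · linarith
  refine ⟨fun N H hN hH γ hγ hγle => existsUnique_isStationary hG hN hH hγ (hγL hγle), hex, ?_⟩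
  intro hb N H hN hH
  obtain ⟨C, hC⟩ := hex
  have hb' : 0 < ‖stochBias F ξ θs‖ := norm_pos_iff.2 hb
  have hNpos : (0 : ℝ) < N := by exact_mod_cast hN
  have hHpos : (0 : ℝ) < H := by exact_mod_cast hH
  -- If the mean were `θs`, the expansion would give `s² D ≤ C (s⁴ H + s³)`, which for `s < 1` is at
  -- most `s³ C' (H + 1)`. This fails once `s < s₀`, with `s₀ = D / (C' (H + 1))`.
  set D := ‖stochBias F ξ θs‖ / (2 * N) with hD
  have hDpos : 0 < D := by positivity
  -- A strictly positive majorant of `C`, so that one may divide by it.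
  set C' := |C| + 1 with hC'
  have hC'pos : 0 < C' := by positivity
  set s₀ := D / (C' * (H + 1)) with hs₀
  have hs₀pos : 0 < s₀ := by positivity
  refine ⟨min (min (1 / (8 * L)) (1 / (H : ℝ))) (min 1 (s₀ ^ 2)),
    lt_min (lt_min (by positivity) (by positivity)) (lt_min one_pos (by positivity)), ?_⟩
  intro γ hγ hγlt π hπ hmean
  have hγ1 := hγlt.le.trans (min_le_left _ _)
  have hγ2 := hγlt.trans_le ((min_le_right _ _).trans (min_le_left _ _))
  have hγ3 := hγlt.trans_le ((min_le_right _ _).trans (min_le_right _ _))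
  have h := (hC N H hN hH γ hγ hγ1 π hπ).2.1
  obtain ⟨s, hs, rfl⟩ : ∃ s : ℝ, 0 < s ∧ γ = s ^ 2 :=
    ⟨√γ, Real.sqrt_pos.2 hγ, (Real.sq_sqrt hγ.le).symm⟩
  rw [hmean, sub_self, zero_sub, norm_neg, norm_smul, norm_neg,
    Real.norm_of_nonneg (by positivity), rpow_three_halves_sq hs.le] at h
  have hs1 : s < 1 := lt_of_pow_lt_pow_left₀ 2 one_pos.le (by simpa using hγ2)
  have hss : s < s₀ := lt_of_pow_lt_pow_left₀ 2 hs₀pos.le hγ3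
  have hlhs : s ^ 2 / (2 * N) * ‖stochBias F ξ θs‖ = s ^ 2 * D := by rw [hD]; ring
  rw [hlhs] at h
  have hsD : s * (C' * (H + 1)) < D := by rwa [hs₀, lt_div_iff₀ (by positivity)] at hss
  have hbound : C * ((s ^ 2) ^ 2 * H + s ^ 3) ≤ s ^ 2 * (s * (C' * (H + 1))) := by
    calc C * ((s ^ 2) ^ 2 * H + s ^ 3) ≤ C' * ((s ^ 2) ^ 2 * H + s ^ 3) := by
          gcongr
          rw [hC']; linarith [le_abs_self C]
      _ = C' * (s ^ 3 * (s * H) + s ^ 3) := by ring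
      _ ≤ C' * (s ^ 3 * (1 * H) + s ^ 3) := by gcongr
      _ = _ := by ring
  have : s ^ 2 * (s * (C' * (H + 1))) < s ^ 2 * D := by gcongr
  linarith
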